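/- **Setting.** Let $U\subset\mathbb R^2$ be a bounded domain (non-empty, open, connected) with $C^2$-boundary, and let $\widehat x=(\widehat x_1,\widehat x_2,\widehat x_3)\in [C^2(\overline U)]^3$. Put $\Gamma_0=\widehat x(U)\subset\mathbb R^3$, and assume that $\widehat x:\overline U\to\overline{\Gamma_0}$ is bijective and that there is $\lambda_{\min}>0$ such that, for all $X \in \overline U$, $$\Big(\tfrac{\partial \widehat x_2}{\partial X_1}\tfrac{\partial \widehat x_3}{\partial X_2}-\tfrac{\partial \widehat x_2}{\partial X_2}\tfrac{\partial \widehat x_3}{\partial X_1}\Big)^2+\Big(\tfrac{\partial \widehat x_1}{\partial X_1}\tfrac{\partial \widehat x_3}{\partial X_2}-\tfrac{\partial \widehat x_1}{\partial X_2}\tfrac{\partial \widehat x_3}{\partial X_1}\Big)^2+\Big(\tfrac{\partial \widehat x_1}{\partial X_1}\tfrac{\partial \widehat x_2}{\partial X_2}-\tfrac{\partial \widehat x_1}{\partial X_2}\tfrac{\partial \widehat x_2}{\partial X_1}\Big)^2\ge\lambda_{\min}^2 .$$ The surface $\Gamma_0$ (with boundary $\partial\Gamma_0=\widehat x(\partial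 U)$) is considered together with its parametrization $\widehat x$; let $\breve X:\overline{\Gamma_0}\to\overline U$ be the inverse of $\widehat x$, and for $\varphi$ on $U$ write $\breve\varphi=\varphi\circ\breve X$. Let $\mathfrak g_\alpha=\partial\widehat x/\partial X_\alpha$, $\mathfrak g_{\alpha\beta}=\mathfrak g_\alpha\cdot\mathfrak g_\beta$, $(\mathfrak g^{\alpha\beta})=(\mathfrak g_{\alpha\beta})^{-1}$. For a differentiable function $\varphi$ on $U$ the surface derivatives of $\breve\varphi$ are, for $j=1,2,3$, $$\partial_j^\Gamma\breve\varphi=\sum_{\alpha,\beta=1}^2\mathfrak g^{\alpha\beta}\,\frac{\partial\widehat x_j}{\partial X_\alpha}\,\frac{\partial\varphi}{\partial X_\beta}\quad\text{(evaluated at }\breve X(x)).$$ Let $n=\mathfrak g_1\times\mathfrak g_2/|\mathfrak g_1\times\mathfrak g_2|$ be the unit normal and $H_\Gamma=-\sum_{j}\partial_j^\Gamma n_j$ the mean curvature. $L^2(\Gamma_0)$ is the real $L^2$-space with respect to the 2-dimensional Hausdorff measure $\mathcal H^2$ on $\Gamma_0$, and $\langle f,h\rangle=\int_{\Gamma_0}fh\,d\mathcal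 H^2$. For $\psi\in L^2(\Gamma_0)$, $\Upsilon\in L^2(\Gamma_0)$ is the weak derivative $\partial_j^\Gamma\psi$ if $$\int_{\Gamma_0}\Upsilon\phi\,d\mathcal H^2=-\int_{\Gamma_0}\psi\,(\partial_j^\Gamma\phi+H_\Gamma n_j\phi)\,d\mathcal H^2\quad\text{for all }\phi=\breve\varphi,\ \varphi\in C^1_0(U),$$ where $C^1_0(U)$ is the set of $C^1$ functions with compact support in $U$. Set $\nabla_\Gamma\psi=(\partial_1^\Gamma\psi,\partial_2^\Gamma\psi,\partial_3^\Gamma\psi)$, $\langle\nabla_\Gamma v,\nabla_\Gamma\psi\rangle=\int_{\Gamma_0}\nabla_\Gamma v\cdot\nabla_\Gamma\psi\,d\mathcal H^2$, and $$W^{1,2}(\Gamma_0)=\{\psi\in L^2(\Gamma_0):\psi=\breve\varphi,\ \varphi\in W^{1,2}(U),\ \|\psi\|_{W^{1,2}(\Gamma_0)}<\infty\},\qquad \|\psi\|_{W^{1,2}(\Gamma_0)}=\Big(\int_{\Gamma_0}(|\psi|^2+|\nabla_\Gamma\psi|^2)\,d\mathcal H^2\Big)^{1/2},$$ where finiteness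 of the norm includes that the three weak derivatives exist in $L^2(\Gamma_0)$. Finally let $L^2_0(\Gamma_0)=\{f\in L^2(\Gamma_0):\int_{\Gamma_0}f\,d\mathcal H^2=0\}$ and $H^1(\Gamma_0)=L^2_0(\Gamma_0)\cap W^{1,2}(\Gamma_0)$. For $F\in L^2_0(\Gamma_0)$, a function $v\in H^1(\Gamma_0)$ is called a weak solution of $-\Delta_\Gamma v=F$ on $\Gamma_0$, $\partial v/\partial\nu=0$ on $\partial\Gamma_0$, if $$\langle\nabla_\Gamma v,\nabla_\Gamma\psi\rangle=\langle F,\psi\rangle\quad\text{for all }\psi\in W^{1,2}(\Gamma_0).$$ **Proposition 2.8 (Weak solution).** For every $F\in L^2_0(\Gamma_0)$ there exists a unique weak solution $v\in H^1(\Gamma_0)$. Moreover, there is a constant $C_\dagger=C_\dagger(\Gamma_0)>0$, independent of $F$, such that $$\|v\|_{W^{1,2}(\Gamma_0)}\le C_\dagger\|F\|_{L^2(\Gamma_0)} .$$ -/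

import Mathlib

open Set MeasureTheory
open scoped Matrix

noncomputable section

/-- The parameter plane `ℝ²`. -/
abbrev Plane : Type := EuclideanSpace ℝ (Fin 2)

/-- The ambient space `ℝ³`. -/
abbrev Space : Type := EuclideanSpace ℝ (Fin 3)

/-- The partial derivative `∂f/∂X_α` on a set `s` (one-sided at boundary points of `s`; the usual
partial derivative at interior points of `s`). -/
def pderivOn {V : Type*} [NormedAddCommGroup V] [NormedSpace ℝ V]
    (s : Set Plane) (α : Fin 2) (f : Plane → V) (X : Plane) : V :=
  fderivWithin ℝ f s X (EuclideanSpace.single α 1)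

/-- `U ⊆ ℝ²` has a boundary of class `C²`: near each boundary point, after a rotation or reflection
of the coordinate axes, `U` is the region strictly above the graph of a `C²` function. -/
def HasC2Boundary (U : Set Plane) : Prop :=
  ∀ p ∈ frontier U, ∃ r > 0, ∃ e : Plane ≃ₗᵢ[ℝ] Plane, ∃ γ : ℝ → ℝ, ContDiff ℝ 2 γ ∧
    ∀ X ∈ Metric.ball p r, (X ∈ U ↔ γ (e X 0) < e X 1)

/-- The test functions on `U`: `C¹` functions with compact support contained in `U`. -/
def IsTestFunction (U : Set Plane) (φ : Plane → ℝ) : Prop :=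
  ContDiff ℝ 1 φ ∧ HasCompactSupport φ ∧ tsupport φ ⊆ U

/-- `φ ∈ W^{1,2}(U)` for an open set `U`: `φ` is in `L²(U)` and has both weak partial derivatives
in `L²(U)`. -/
def MemW12 (U : Set Plane) (φ : Plane → ℝ) : Prop :=
  MemLp φ 2 (volume.restrict U) ∧
    ∀ α : Fin 2, ∃ g : Plane → ℝ, MemLp g 2 (volume.restrict U) ∧
      ∀ η : Plane → ℝ, IsTestFunction U η →
        ∫ X in U, g X * η X = - ∫ X in U, φ X * fderiv ℝ η X (EuclideanSpace.single α 1)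

/-- A surface with boundary in `ℝ³`, given by its global parametrization
`param : closure domain → ℝ³`. -/
structure SurfaceWithBoundary where
  /-- the parameter domain `U` -/
  domain : Set Plane
  /-- the parametrization; only its values on `closure domain` matter -/
  param : Plane → Space
  isOpen_domain : IsOpen domain
  isConnected_domain : IsConnected domain
  isBounded_domain : Bornology.IsBounded domain
  hasC2Boundary_domain : HasC2Boundary domain
  contDiffOn_param : ContDiffOn ℝ 2 param (closure domain)
  bijOn_param : BijOn param (closure domain) (closure (param '' domain))
  nondegenerate : ∃ lam > 0, ∀ X ∈ closure domain,
    let D : Fin 2 → Space := fun α => pderivOn (closure domain) α param X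
    lam ^ 2 ≤ (D 0 1 * D 1 2 - D 1 1 * D 0 2) ^ 2 + (D 0 0 * D 1 2 - D 1 0 * D 0 2) ^ 2
      + (D 0 0 * D 1 1 - D 1 0 * D 0 1) ^ 2

namespace SurfaceWithBoundary

variable (Γ : SurfaceWithBoundary)

/-- The surface `Γ₀` as a subset of `ℝ³`. -/
def carrier : Set Space := Γ.param '' Γ.domain

/-- The boundary `∂Γ₀` of the surface. -/
def boundary : Set Space := Γ.param '' frontier Γ.domain

/-- The inverse of the parametrization, from `closure Γ₀` to `closure U`. -/
def chart : Space → Plane := Function.invFunOn Γ.param (closure Γ.domain)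

/-- The 2-dimensional Hausdorff measure on the surface, with the normalization for which it is
Lebesgue measure on planes. -/
def area : Measure Space := (μHE[2]).restrict Γ.carrier

/-- The partial derivative `∂f/∂X_α` of a function on the closed parameter domain. -/
def pderiv {V : Type*} [NormedAddCommGroup V] [NormedSpace ℝ V]
    (α : Fin 2) (f : Plane → V) : Plane → V :=
  pderivOn (closure Γ.domain) α f

/-- The tangent vector field `𝔤_α = ∂x̂/∂X_α`, in the parameter. -/
def tangent (α : Fin 2) : Plane → Space := Γ.pderiv α Γ.param

/-- The first fundamental form `𝔤_{αβ} = 𝔤_α · 𝔤_β`. -/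
def metric (X : Plane) : Matrix (Fin 2) (Fin 2) ℝ :=
  Matrix.of fun α β => inner ℝ (Γ.tangent α X) (Γ.tangent β X)

/-- The surface derivative `∂_j^Γ`, in the parameter: for `φ` differentiable,
`∂_j^Γ φ = ∑ 𝔤^{αβ} (∂x̂_j/∂X_α) (∂φ/∂X_β)`, where `(𝔤^{αβ})` is the inverse of `(𝔤_{αβ})`. It is
the `j`-th component of the tangential gradient. -/
def surfDeriv (j : Fin 3) (φ : Plane → ℝ) (X : Plane) : ℝ :=
  ∑ α : Fin 2, ∑ β : Fin 2, (Γ.metric X)⁻¹ α β * Γ.tangent α X j * Γ.pderiv β φ X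

/-- The unit normal `n = 𝔤₁ × 𝔤₂ / |𝔤₁ × 𝔤₂|`, in the parameter. -/
def normal (X : Plane) : Space :=
  let w : Space := WithLp.toLp 2 ((Γ.tangent 0 X).ofLp ⨯₃ (Γ.tangent 1 X).ofLp)
  ‖w‖⁻¹ • w

/-- The mean curvature `H_Γ = - div_Γ n = - ∑_j ∂_j^Γ n_j` in the direction `n`, in the parameter.
(The product `H_Γ n` does not depend on the choice of the sign of `n`.) -/
def meanCurv (X : Plane) : ℝ :=
  - ∑ j : Fin 3, Γ.surfDeriv j (fun Y => Γ.normal Y j) X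

/-- The Hilbert space `L²(Γ₀)`. -/
abbrev L2 : Type := Lp ℝ 2 Γ.area

/-- `Υ = ∂_j^Γ ψ` weakly: for all `φ ∈ C¹₀(U)`, with everything transported to the surface,
`∫_{Γ₀} Υ φ dℋ² = - ∫_{Γ₀} ψ (∂_j^Γ φ + H_Γ n_j φ) dℋ²`. -/
def IsWeakSurfDeriv (j : Fin 3) (ψ Υ : Γ.L2) : Prop :=
  ∀ φ : Plane → ℝ, IsTestFunction Γ.domain φ →
    ∫ x, Υ x * φ (Γ.chart x) ∂Γ.area =
      - ∫ x, ψ x * (Γ.surfDeriv j φ (Γ.chart x) +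
          Γ.meanCurv (Γ.chart x) * Γ.normal (Γ.chart x) j * φ (Γ.chart x)) ∂Γ.area

open Classical in
/-- The weak surface derivative `∂_j^Γ ψ ∈ L²(Γ₀)` of `ψ ∈ L²(Γ₀)`; it is used only
for `ψ` that have one. -/
def weakSurfDeriv (j : Fin 3) (ψ : Γ.L2) : Γ.L2 :=
  if h : ∃ Υ : Γ.L2, Γ.IsWeakSurfDeriv j ψ Υ then h.choose else 0

/-- `W^{1,2}(Γ₀)`: the functions `ψ = φ ∘ chart` with `φ ∈ W^{1,2}(U)` that have weak surface
derivatives in `L²(Γ₀)` (so that the `W^{1,2}` norm is finite). -/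
def W12 : Set Γ.L2 :=
  {ψ | (∃ φ : Plane → ℝ, MemW12 Γ.domain φ ∧ ψ =ᵐ[Γ.area] fun x => φ (Γ.chart x)) ∧
    ∀ j : Fin 3, ∃ Υ : Γ.L2, Γ.IsWeakSurfDeriv j ψ Υ}

/-- `⟨∇_Γ v, ∇_Γ ψ⟩ = ∫_{Γ₀} ∇_Γ v · ∇_Γ ψ dℋ²`. -/
def gradInner (v ψ : Γ.L2) : ℝ :=
  ∑ j : Fin 3, ∫ x, Γ.weakSurfDeriv j v x * Γ.weakSurfDeriv j ψ x ∂Γ.area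

/-- The norm `‖ψ‖_{W^{1,2}(Γ₀)} = (∫_{Γ₀} (|ψ|² + |∇_Γ ψ|²) dℋ²)^{1/2}`. -/
def W12norm (ψ : Γ.L2) : ℝ :=
  Real.sqrt (∫ x, (|ψ x| ^ 2 + ∑ j : Fin 3, |Γ.weakSurfDeriv j ψ x| ^ 2) ∂Γ.area)

/-- `L²₀(Γ₀)`: the functions in `L²(Γ₀)` with mean zero. -/
def L20 : Set Γ.L2 := {f | ∫ x, f x ∂Γ.area = 0}

/-- `H¹(Γ₀)`: the functions in `W^{1,2}(Γ₀)` with mean zero. -/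
def H1 : Set Γ.L2 := Γ.L20 ∩ Γ.W12

/-- `v ∈ H¹(Γ₀)` is a weak solution of `-Δ_Γ v = F` on `Γ₀`, `∂v/∂ν = 0` on `∂Γ₀`. -/
def IsWeakSolution (F v : Γ.L2) : Prop :=
  v ∈ Γ.H1 ∧ ∀ ψ ∈ Γ.W12, Γ.gradInner v ψ = ∫ x, F x * ψ x ∂Γ.area

end SurfaceWithBoundary

end

/-! The problem is variational. On mean-zero functions the form `⟨∇_Γ v, ∇_Γ ψ⟩` is coercive by a
Poincaré inequality, so Lax–Milgram yields the solution. The energy identity obtained by testing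
with `v` itself gives the estimate. A test function of nonzero mean costs nothing: subtracting a
constant changes neither its surface gradient nor its pairing with the mean-zero `F`.

The analysis is carried out in the parameter domain `U`. By the area formula
(`measurePreserving_param`), `ℋ²` on the surface is Lebesgue measure on `U` with density `J = |𝔤₁ ×
𝔤₂|`. This density is bounded below by nondegeneracy and above by compactness, so the two `L²` norms
are comparable. The geometric heart is `sum_fderiv_conormal`: with `c₁ = 𝔤₂ × n` and `c₂ = n × 𝔤₁`
one has `J ∂_j^Γ φ = ∑ (c_β)_j ∂_β φ` and `∑ ∂_β (c_β)_j = J H_Γ n_j`. Hence the expression tested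
in the weak surface derivative is exactly a divergence in `U`. Since `𝔤_α · c_β = J δ_{αβ}`, weak
surface derivatives and weak partial derivatives determine each other linearly
(`isWeakSurfDeriv_iff_ae_eq`, `hasWeakGrad_paramGrad`).

The Poincaré inequality on `U` (`HasC2Boundary.poincareOn`) is proved on convex sets by averaging
finite differences, carried to boundary neighbourhoods by a measure-preserving shear that
straightens the boundary, and propagated through a finite cover by connectedness.

Completeness of `W^{1,2}(Γ₀)` is replaced by a closed subspace of `L²(Γ₀)⁴`, the graph of the
surface gradient (`gradGraph`), which is cut out by continuous linear functionals. Its mean-zero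
part is the Hilbert space on which `exists_sum_inner_succ_eq` operates. -/

noncomputable section

/-! ### The area formula for injective immersions -/

section AreaFormula

open Filter Topology
open scoped NNReal ENNReal

/-- If `f` expands distances on `s` by at most a factor `C` compared with `g`, then its image has at
most `C ^ d` times the `d`-dimensional measure. -/
theorem euclideanHausdorffMeasure_image_le_of_dist_le {X Y Z : Type*} [Nonempty X]
    [MetricSpace Y] [MeasurableSpace Y] [BorelSpace Y]
    [MetricSpace Z] [MeasurableSpace Z] [BorelSpace Z] (d : ℕ) {f : X → Y} {g : X → Z} {s : Set X}
    (C : ℝ≥0) (h : ∀ x ∈ s, ∀ y ∈ s, dist (f x) (f y) ≤ C * dist (g x) (g y)) :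
    μHE[d] (f '' s) ≤ (C : ℝ≥0∞) ^ d * μHE[d] (g '' s) := by
  -- On `s`, `f` factors through `g` by a map that is `C`-Lipschitz on `g '' s`. No injectivity of
  -- `g` is needed: the hypothesis makes `f` constant on the fibres of `g`.
  set k : Z → Y := f ∘ Function.invFunOn g s with hk
  have hmem : ∀ z ∈ g '' s, Function.invFunOn g s z ∈ s ∧ g (Function.invFunOn g s z) = z :=
    fun z hz => ⟨Function.invFunOn_mem hz, Function.invFunOn_eq hz⟩
  have hlip : LipschitzOnWith C k (g '' s) := by
    refine LipschitzOnWith.of_dist_le_mul fun z hz z' hz' => ?_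
    have := h _ (hmem z hz).1 _ (hmem z' hz').1
    rwa [(hmem z hz).2, (hmem z' hz').2] at this
  have himg : f '' s = k '' (g '' s) := by
    rw [image_image]
    refine image_congr fun x hx => ?_
    have h1 := hmem (g x) ⟨x, hx, rfl⟩
    have h2 := h x hx _ h1.1
    rw [h1.2, dist_self, mul_zero] at h2
    exact dist_le_zero.1 h2
  have := hlip.hausdorffMeasure_image_le (d := (d : ℝ)) (by positivity)
  rw [ENNReal.rpow_natCast] at this
  rw [himg]
  simp only [Measure.euclideanHausdorffMeasure_def, Measure.smul_apply, ENNReal.smul_def,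
    smul_eq_mul]
  rw [mul_left_comm]
  gcongr

variable {E F : Type*} [NormedAddCommGroup E] [InnerProductSpace ℝ E] [FiniteDimensional ℝ E]
  [MeasurableSpace E] [BorelSpace E]
  [NormedAddCommGroup F] [InnerProductSpace ℝ F] [MeasurableSpace F] [BorelSpace F]

omit [MeasurableSpace E] [BorelSpace E] [MeasurableSpace F] [BorelSpace F] in
/-- Near a point where the derivative is injective, a map is nearly isometric to its derivative. -/
theorem HasStrictFDerivAt.eventually_dist_le_mul_dist {f : E → F} {L : E →L[ℝ] F} {x₀ : E}
    (hf : HasStrictFDerivAt f L x₀) (hL : Function.Injective L) {C : ℝ} (hC : 1 < C) :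
    ∃ O ∈ 𝓝 x₀, ∀ x ∈ O, ∀ y ∈ O, dist (f x) (f y) ≤ C * dist (L x) (L y) ∧
      dist (L x) (L y) ≤ C * dist (f x) (f y) := by
  obtain ⟨K, hK, hanti⟩ := L.toLinearMap.exists_antilipschitzWith (LinearMap.ker_eq_bot.2 hL)
  have hKpos : (0 : ℝ) < K := by exact_mod_cast hK
  -- As `L` is bounded below by `1 / K`, this `c` makes the linearization error at most `(1 - C⁻¹)
  -- ‖L (x - y)‖`. The lower bound for `f` is then immediate, and the upper one follows from `2 -
  -- C⁻¹ ≤ C`.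
  set c : ℝ := (1 - C⁻¹) / K with hc
  have hC1 : C⁻¹ < 1 := inv_lt_one_of_one_lt₀ hC
  have hC0 : 0 < C := by linarith
  have hcpos : 0 < c := by apply div_pos <;> linarith
  obtain ⟨O, hO, hOf⟩ := hf.approximates_deriv_on_nhds (c := ⟨c, hcpos.le⟩) (Or.inr hcpos)
  refine ⟨O, hO, fun x hx y hy => ?_⟩
  have h1 : ‖f x - f y - L (x - y)‖ ≤ c * ‖x - y‖ := hOf x hx y hy
  have h2 : ‖x - y‖ ≤ K * ‖L (x - y)‖ := by
    have := hanti.le_mul_dist x y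
    simpa [dist_eq_norm, ← map_sub] using this
  have h3 : c * ‖x - y‖ ≤ (1 - C⁻¹) * ‖L (x - y)‖ := by
    calc c * ‖x - y‖ ≤ c * (K * ‖L (x - y)‖) := by gcongr
      _ = (1 - C⁻¹) * ‖L (x - y)‖ := by rw [hc]; field_simp
  rw [dist_eq_norm, dist_eq_norm, ← map_sub]
  have h4 : C⁻¹ * C = 1 := inv_mul_cancel₀ hC0.ne'
  have h5 : 2 ≤ C + C⁻¹ := by
    have : 0 ≤ C⁻¹ * (C - 1) ^ 2 := by positivity
    nlinarith [this]
  constructor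
  · have : ‖f x - f y‖ ≤ ‖f x - f y - L (x - y)‖ + ‖L (x - y)‖ := by
      simpa using norm_add_le (f x - f y - L (x - y)) (L (x - y))
    nlinarith [norm_nonneg (L (x - y))]
  · have : ‖L (x - y)‖ ≤ ‖f x - f y‖ + ‖f x - f y - L (x - y)‖ := by
      have := norm_sub_le (f x - f y) (f x - f y - L (x - y))
      simpa using this
    have h6 : C⁻¹ * ‖L (x - y)‖ ≤ ‖f x - f y‖ := by linarith
    calc ‖L (x - y)‖ = C * (C⁻¹ * ‖L (x - y)‖) := by rw [← mul_assoc, mul_comm C, h4, one_mul]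
      _ ≤ C * ‖f x - f y‖ := by gcongr

/-- Near a point where the derivative is injective, the measure of images is nearly the integral of
the Jacobian `J`. -/
theorem HasStrictFDerivAt.eventually_measure_image_le {f : E → F} {L : E →L[ℝ] F} {x₀ : E}
    (hf : HasStrictFDerivAt f L x₀) (hL : Function.Injective L) {J : E → ℝ}
    (hJ : ContinuousAt J x₀) (hJL : J x₀ = L.toLinearMap.normDet) {C : ℝ≥0} (hC : 1 < C) :
    ∃ O ∈ 𝓝 x₀, ∀ s ⊆ O, MeasurableSet s →
      μHE[Module.finrank ℝ E] (f '' s) ≤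
        (C : ℝ≥0∞) ^ (Module.finrank ℝ E + 1) * ∫⁻ x in s, ENNReal.ofReal (J x) ∧
      ∫⁻ x in s, ENNReal.ofReal (J x) ≤
        (C : ℝ≥0∞) ^ (Module.finrank ℝ E + 1) * μHE[Module.finrank ℝ E] (f '' s) := by
  set d := Module.finrank ℝ E
  obtain ⟨O, hO, hOd⟩ := hf.eventually_dist_le_mul_dist hL (C := C) (by exact_mod_cast hC)
  have hJpos : 0 < J x₀ := by
    rw [hJL]
    refine lt_of_le_of_ne (LinearMap.normDet_nonneg _) (Ne.symm ?_)
    exact (L.toLinearMap.normDet_ne_zero_tfae.out 4 0).1 hL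
  have hC0 : (0 : ℝ) < C := by have : (1 : ℝ) < C := by exact_mod_cast hC
                               linarith
  have hev : ∀ᶠ x in 𝓝 x₀, J x < C * J x₀ ∧ J x₀ < C * J x := by
    have hC' : (1 : ℝ) < C := by exact_mod_cast hC
    refine (hJ.eventually_lt continuousAt_const (by nlinarith)).and
      (continuousAt_const.eventually_lt (continuousAt_const.mul hJ) (by nlinarith))
  -- Of the `d + 1` factors `C`, `d` come from replacing `f` by its derivative at `x₀`, and one from
  -- replacing `J` by its value there.
  refine ⟨O ∩ {x | J x < C * J x₀ ∧ J x₀ < C * J x}, inter_mem hO hev, fun s hs hsm => ?_⟩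
  have hvol : μHE[d] (L '' s) = ENNReal.ofReal (J x₀) * volume s := by
    rw [hJL]
    exact L.toLinearMap.euclideanHausdorffMeasure_image_eq_normDet_mul_volume s
  have hle1 : μHE[d] (f '' s) ≤ (C : ℝ≥0∞) ^ d * μHE[d] (L '' s) :=
    euclideanHausdorffMeasure_image_le_of_dist_le d C
      fun x hx y hy => (hOd x (hs hx).1 y (hs hy).1).1
  have hle2 : μHE[d] (L '' s) ≤ (C : ℝ≥0∞) ^ d * μHE[d] (f '' s) :=
    euclideanHausdorffMeasure_image_le_of_dist_le d C
      fun x hx y hy => (hOd x (hs hx).1 y (hs hy).1).2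
  have hle3 : ENNReal.ofReal (J x₀) * volume s ≤ C * ∫⁻ x in s, ENNReal.ofReal (J x) := by
    rw [← lintegral_const_mul' _ _ (by simp), ← setLIntegral_const]
    refine setLIntegral_mono' hsm fun x hx => ?_
    rw [← ENNReal.ofReal_coe_nnreal, ← ENNReal.ofReal_mul C.coe_nonneg]
    exact ENNReal.ofReal_le_ofReal (hs hx).2.2.le
  have hle4 : ∫⁻ x in s, ENNReal.ofReal (J x) ≤ C * (ENNReal.ofReal (J x₀) * volume s) := by
    rw [← mul_assoc, ← setLIntegral_const]
    refine setLIntegral_mono' hsm fun x hx => ?_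
    rw [← ENNReal.ofReal_coe_nnreal, ← ENNReal.ofReal_mul C.coe_nonneg]
    exact ENNReal.ofReal_le_ofReal (hs hx).2.1.le
  rw [pow_succ]
  constructor
  · calc _ ≤ (C : ℝ≥0∞) ^ d * (C * ∫⁻ x in s, ENNReal.ofReal (J x)) := by
          refine hle1.trans ?_
          rw [hvol]
          gcongr
      _ = _ := by ring
  · calc _ ≤ C * ((C : ℝ≥0∞) ^ d * μHE[d] (f '' s)) := by
          refine hle4.trans ?_
          rw [← hvol]
          gcongr
      _ = _ := by ring

/-- The area formula for injective immersions of class `C¹`. -/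
theorem euclideanHausdorffMeasure_image_eq_lintegral {f : E → F} {f' : E → E →L[ℝ] F} {U : Set E}
    {J : E → ℝ} (hf : ∀ x ∈ U, HasStrictFDerivAt f (f' x) x)
    (hf' : ∀ x ∈ U, Function.Injective (f' x)) (hinj : InjOn f U)
    (hJ : ∀ x ∈ U, ContinuousAt J x) (hJf : ∀ x ∈ U, J x = (f' x).toLinearMap.normDet)
    {s : Set E} (hsU : s ⊆ U) (hs : MeasurableSet s) :
    μHE[Module.finrank ℝ E] (f '' s) = ∫⁻ x in s, ENNReal.ofReal (J x) := by
  set d := Module.finrank ℝ E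
  -- Countably many neighbourhoods with the two-sided estimate for `C` cover `s`. They are made
  -- disjoint and the estimates are summed, with the same `C` for all pieces; afterwards `C` tends
  -- to `1`.
  have key : ∀ C : ℝ≥0, 1 < C →
      μHE[d] (f '' s) ≤ (C : ℝ≥0∞) ^ (d + 1) * ∫⁻ x in s, ENNReal.ofReal (J x) ∧
      ∫⁻ x in s, ENNReal.ofReal (J x) ≤ (C : ℝ≥0∞) ^ (d + 1) * μHE[d] (f '' s) := by
    intro C hC
    rcases s.eq_empty_or_nonempty with rfl | hne
    · simp
    have hloc := fun x (hx : x ∈ U) => (hf x hx).eventually_measure_image_le (hf' x hx) (hJ x hx)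
      (hJf x hx) hC
    choose! O hO hOs using hloc
    obtain ⟨T, hTs, hTc, hcov⟩ := TopologicalSpace.countable_cover_nhdsWithin (s := s)
      (f := fun x => interior (O x))
      (fun x hx => mem_nhdsWithin_of_mem_nhds (interior_mem_nhds.2 (hO x (hsU hx))))
    have hTne : T.Nonempty := by
      by_contra h
      rw [not_nonempty_iff_eq_empty] at h
      simp only [h, mem_empty_iff_false, iUnion_of_empty, iUnion_empty, subset_empty_iff] at hcov
      exact hne.ne_empty hcov
    obtain ⟨e, rfl⟩ := hTc.exists_eq_range hTne
    rw [biUnion_range] at hcov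
    set D : ℕ → Set E := fun n => s ∩ disjointed (fun n => interior (O (e n))) n with hD
    have hDm : ∀ n, MeasurableSet (D n) := fun n =>
      hs.inter (MeasurableSet.disjointed (fun n => isOpen_interior.measurableSet) n)
    have hDd : Pairwise (Function.onFun Disjoint D) := fun i j hij =>
      ((disjoint_disjointed (fun n => interior (O (e n)))) hij).mono
        inter_subset_right inter_subset_right
    have hDs : s = ⋃ n, D n := by
      rw [← inter_iUnion, iUnion_disjointed, inter_eq_left.2 hcov]
    have hDO : ∀ n, D n ⊆ O (e n) := fun n =>
      inter_subset_right.trans ((disjointed_subset _ n).trans interior_subset)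
    have hDU : ∀ n, D n ⊆ U := fun n => inter_subset_left.trans hsU
    have heU : ∀ n, e n ∈ U := fun n => hsU (hTs (mem_range_self n))
    have hcont : ContinuousOn f U := fun x hx => (hf x hx).continuousAt.continuousWithinAt
    have himg : μHE[d] (f '' s) = ∑' n, μHE[d] (f '' D n) := by
      conv_lhs => rw [hDs, image_iUnion]
      refine measure_iUnion (fun i j hij => ?_) fun n =>
        (hDm n).image_of_continuousOn_injOn (hcont.mono (hDU n)) (hinj.mono (hDU n))
      exact (hDd hij).image hinj (hDU i) (hDU j)
    have hint : ∫⁻ x in s, ENNReal.ofReal (J x) = ∑' n, ∫⁻ x in D n, ENNReal.ofReal (J x) := by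
      conv_lhs => rw [hDs]
      exact lintegral_iUnion hDm hDd _
    rw [himg, hint, ← ENNReal.tsum_mul_left, ← ENNReal.tsum_mul_left]
    exact ⟨ENNReal.tsum_le_tsum fun n => (hOs _ (heU n) (D n) (hDO n) (hDm n)).1,
      ENNReal.tsum_le_tsum fun n => (hOs _ (heU n) (D n) (hDO n) (hDm n)).2⟩
  have hlim : ∀ a b : ℝ≥0∞, (∀ C : ℝ≥0, 1 < C → a ≤ (C : ℝ≥0∞) ^ (d + 1) * b) → a ≤ b := by
    intro a b hab
    have h1 : Tendsto (fun C : ℝ≥0 => (C : ℝ≥0∞) ^ (d + 1) * b) (𝓝[>] 1) (𝓝 (1 * b)) := by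
      refine ENNReal.Tendsto.mul_const ?_ (Or.inl one_ne_zero)
      have : Continuous fun C : ℝ≥0 => (C : ℝ≥0∞) ^ (d + 1) := by fun_prop
      have := this.tendsto 1
      simp only [ENNReal.coe_one, one_pow] at this
      exact this.mono_left nhdsWithin_le_nhds
    rw [one_mul] at h1
    exact ge_of_tendsto h1 (eventually_mem_nhdsWithin.mono fun C hC => hab C hC)
  exact le_antisymm (hlim _ _ fun C hC => (key C hC).1) (hlim _ _ fun C hC => (key C hC).2)

/-- An injective immersion transports the measure with density its Jacobian to the Hausdorff measure
on its image. -/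
theorem measurePreserving_indicator_of_immersion {f : E → F} {f' : E → E →L[ℝ] F} {U : Set E}
    {J : E → ℝ} (hU : MeasurableSet U) (hf : ∀ x ∈ U, HasStrictFDerivAt f (f' x) x)
    (hf' : ∀ x ∈ U, Function.Injective (f' x)) (hinj : InjOn f U)
    (hJ : ∀ x ∈ U, ContinuousAt J x) (hJf : ∀ x ∈ U, J x = (f' x).toLinearMap.normDet) :
    MeasurePreserving (U.indicator f)
      ((volume.restrict U).withDensity fun x => ENNReal.ofReal (J x))
      (μHE[Module.finrank ℝ E].restrict (f '' U)) := by
  have hcont : ContinuousOn f U := fun x hx => (hf x hx).continuousAt.continuousWithinAt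
  -- Nothing is known about `f` outside `U`, so it is extended by zero to be measurable; the measure
  -- does not see the change.
  have hmeas : Measurable (U.indicator f) := by
    classical
    rw [← piecewise_eq_indicator]
    exact hcont.measurable_piecewise continuousOn_const hU
  refine ⟨hmeas, ?_⟩
  ext A hA
  have h1 : MeasurableSet (U.indicator f ⁻¹' A) := hmeas hA
  rw [Measure.map_apply hmeas hA, withDensity_apply _ h1, Measure.restrict_restrict h1,
    Measure.restrict_apply hA, ← euclideanHausdorffMeasure_image_eq_lintegral hf hf' hinj hJ hJf
      inter_subset_right (h1.inter hU)]
  congr 1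
  ext y
  constructor
  · rintro ⟨x, ⟨hx, hxU⟩, rfl⟩
    rw [mem_preimage, indicator_of_mem hxU] at hx
    exact ⟨hx, x, hxU, rfl⟩
  · rintro ⟨hy, x, hxU, rfl⟩
    exact ⟨x, ⟨by rwa [mem_preimage, indicator_of_mem hxU], hxU⟩, rfl⟩

/-- The inverse of an injective immersion transports the Hausdorff measure on the image to the
measure with density the Jacobian. -/
theorem measurePreserving_indicator_inverse_of_immersion {f : E → F} {f' : E → E →L[ℝ] F}
    {g : F → E} {U : Set E} {J : E → ℝ} (hU : MeasurableSet U)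
    (hf : ∀ x ∈ U, HasStrictFDerivAt f (f' x) x)
    (hf' : ∀ x ∈ U, Function.Injective (f' x)) (hg : ∀ x ∈ U, g (f x) = x)
    (hJ : ∀ x ∈ U, ContinuousAt J x) (hJf : ∀ x ∈ U, J x = (f' x).toLinearMap.normDet) :
    MeasurePreserving ((f '' U).indicator g)
      (μHE[Module.finrank ℝ E].restrict (f '' U))
      ((volume.restrict U).withDensity fun x => ENNReal.ofReal (J x)) := by
  have hinj : InjOn f U := fun x hx y hy h => by rw [← hg x hx, ← hg y hy, h]
  have hcont : ContinuousOn f U := fun x hx => (hf x hx).continuousAt.continuousWithinAt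
  have himg : MeasurableSet (f '' U) := hU.image_of_continuousOn_injOn hcont hinj
  have hmeas : Measurable ((f '' U).indicator g) := by
    classical
    intro B hB
    rw [← piecewise_eq_indicator, piecewise_preimage]
    -- Measurability of the inverse comes from the Lusin–Souslin theorem: preimages under `g` are
    -- injective continuous images of Borel sets.
    have h1 : g ⁻¹' B ∩ f '' U = f '' (U ∩ B) := by
      ext y
      constructor
      · rintro ⟨hy, x, hx, rfl⟩
        rw [mem_preimage, hg x hx] at hy
        exact ⟨x, ⟨hx, hy⟩, rfl⟩
      · rintro ⟨x, ⟨hx, hxB⟩, rfl⟩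
        exact ⟨by rwa [mem_preimage, hg x hx], x, hx, rfl⟩
    refine MeasurableSet.union ?_ ((measurable_zero hB).diff himg)
    rw [h1]
    exact (hU.inter hB).image_of_continuousOn_injOn (hcont.mono inter_subset_left)
      (hinj.mono inter_subset_left)
  have hP := measurePreserving_indicator_of_immersion hU hf hf' hinj hJ hJf
  refine ⟨hmeas, ?_⟩
  rw [← hP.map_eq, Measure.map_map hmeas hP.measurable]
  conv_rhs => rw [← Measure.map_id (μ := (volume.restrict U).withDensity _)]
  refine Measure.map_congr ?_
  refine (withDensity_absolutelyContinuous _ _).ae_le ?_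
  filter_upwards [ae_restrict_mem hU] with x hx
  simp [indicator_of_mem hx, indicator_of_mem (mem_image_of_mem f hx), hg x hx]

end AreaFormula

/-! ### Pairings of square integrable functions -/

section SquareIntegrable

variable {α : Type*} [MeasurableSpace α] {μ : Measure α}

theorem MeasureTheory.MemLp.integral_mul_eq_inner {f g : α → ℝ} (hf : MemLp f 2 μ)
    (hg : MemLp g 2 μ) : ∫ x, f x * g x ∂μ = inner ℝ (hf.toLp f) (hg.toLp g) := by
  rw [L2.inner_def]
  refine integral_congr_ae ?_
  filter_upwards [hf.coeFn_toLp, hg.coeFn_toLp] with x h1 h2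
  rw [h1, h2, real_inner_eq_re_inner]
  simp [mul_comm]

theorem MeasureTheory.MemLp.abs_integral_mul_le {f g : α → ℝ} (hf : MemLp f 2 μ)
    (hg : MemLp g 2 μ) :
    |∫ x, f x * g x ∂μ| ≤ (eLpNorm f 2 μ).toReal * (eLpNorm g 2 μ).toReal := by
  rw [hf.integral_mul_eq_inner hg, ← Lp.norm_toLp f hf, ← Lp.norm_toLp g hg]
  exact abs_real_inner_le_norm _ _

theorem MeasureTheory.MemLp.integrable_mul_two {f g : α → ℝ} (hf : MemLp f 2 μ)
    (hg : MemLp g 2 μ) : Integrable (fun x => f x * g x) μ :=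
  hf.integrable_mul hg

/-- A bounded measurable multiple of a square integrable function is square integrable. -/
theorem MeasureTheory.MemLp.bounded_mul {f b : α → ℝ} (hf : MemLp f 2 μ)
    (hb : AEStronglyMeasurable b μ) {C : ℝ} (hC : ∀ᵐ x ∂μ, |b x| ≤ C) :
    MemLp (fun x => b x * f x) 2 μ := by
  refine MemLp.of_le_mul (c := C) hf (hb.mul hf.aestronglyMeasurable) ?_
  filter_upwards [hC] with x hx
  rw [norm_mul]
  exact mul_le_mul_of_nonneg_right hx (norm_nonneg _)

end SquareIntegrable

/-! ### Test functions and duality in `L²` -/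

section TestFunctions

open Filter Topology
open scoped ContDiff

variable {U V : Set Plane} {η : Plane → ℝ}

theorem IsTestFunction.mono (h : IsTestFunction V η) (hVU : V ⊆ U) : IsTestFunction U η :=
  ⟨h.1, h.2.1, h.2.2.trans hVU⟩

theorem IsTestFunction.eq_zero (h : IsTestFunction V η) {X : Plane} (hX : X ∉ V) : η X = 0 :=
  image_eq_zero_of_notMem_tsupport fun hx => hX (h.2.2 hx)

theorem IsTestFunction.fderiv_eq_zero (h : IsTestFunction V η) {X : Plane} (hX : X ∉ V) :
    fderiv ℝ η X = 0 :=
  image_eq_zero_of_notMem_tsupport (f := fderiv ℝ η)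
    fun hx => hX (h.2.2 (tsupport_fderiv_subset ℝ hx))

theorem IsTestFunction.continuous_fderiv (h : IsTestFunction V η) : Continuous (fderiv ℝ η) :=
  h.1.continuous_fderiv one_ne_zero

theorem IsTestFunction.memLp (h : IsTestFunction V η) (μ : Measure Plane)
    [IsFiniteMeasureOnCompacts μ] : MemLp η 2 μ :=
  h.1.continuous.memLp_of_hasCompactSupport h.2.1

theorem IsTestFunction.memLp_fderiv (h : IsTestFunction V η) (μ : Measure Plane)
    [IsFiniteMeasureOnCompacts μ] (v : Plane) : MemLp (fun X => fderiv ℝ η X v) 2 μ :=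
  (h.continuous_fderiv.clm_apply continuous_const).memLp_of_hasCompactSupport
    (h.2.1.fderiv_apply (𝕜 := ℝ) v)

/-- The product of a test function on `U` with a function of class `C¹` on `U` is a test
function. -/
theorem IsTestFunction.mul_left (h : IsTestFunction U η) (hU : IsOpen U) {a : Plane → ℝ}
    (ha : ContDiffOn ℝ 1 a U) : IsTestFunction U (fun X => a X * η X) := by
  have hsub : tsupport (fun X => a X * η X) ⊆ tsupport η := tsupport_mul_subset_right
  refine ⟨?_, h.2.1.mono' (subset_trans subset_closure hsub), hsub.trans h.2.2⟩
  rw [contDiff_iff_contDiffAt]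
  intro X
  by_cases hX : X ∈ U
  · exact (ha.contDiffAt (hU.mem_nhds hX)).mul h.1.contDiffAt
  · have hX' : X ∉ tsupport η := fun hx => hX (h.2.2 hx)
    have : (fun X => a X * η X) =ᶠ[𝓝 X] fun _ => 0 := by
      filter_upwards [(isClosed_tsupport η).isOpen_compl.mem_nhds hX'] with Y hY
      rw [image_eq_zero_of_notMem_tsupport hY, mul_zero]
    exact contDiffAt_const.congr_of_eventuallyEq this

theorem IsTestFunction.add {ζ : Plane → ℝ} (h : IsTestFunction U η) (h' : IsTestFunction U ζ) :
    IsTestFunction U (η + ζ) :=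
  ⟨h.1.add h'.1, h.2.1.add h'.2.1,
    (tsupport_add η ζ).trans (union_subset h.2.2 h'.2.2)⟩

theorem IsTestFunction.smul (h : IsTestFunction U η) (c : ℝ) : IsTestFunction U (c • η) :=
  ⟨h.1.const_smul c, h.2.1.smul_left (f := fun _ => c),
    (tsupport_smul_subset_right (fun _ => c) η).trans h.2.2⟩

theorem IsTestFunction.zero : IsTestFunction U (0 : Plane → ℝ) :=
  ⟨contDiff_const, HasCompactSupport.zero, by simp [tsupport_zero]⟩

/-- A square integrable function is determined by its integrals against test functions. -/
theorem ae_eq_zero_of_forall_isTestFunction (hV : IsOpen V) {f : Plane → ℝ}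
    (hf : MemLp f 2 (volume.restrict V))
    (h : ∀ η, IsTestFunction V η → ∫ X in V, f X * η X = 0) : f =ᵐ[volume.restrict V] 0 := by
  have hloc : LocallyIntegrableOn f V volume := by
    rw [locallyIntegrableOn_iff hV.isLocallyClosed]
    intro K hKV hK
    have : IsFiniteMeasure (volume.restrict K) := ⟨by simpa using hK.measure_lt_top⟩
    exact (hf.mono_measure (Measure.restrict_mono hKV le_rfl)).integrable (by norm_num)
  have := hV.ae_eq_zero_of_integral_contDiff_smul_eq_zero (μ := volume) hloc fun g hg hgc hgs => by
    have ht : IsTestFunction V g := ⟨hg.of_le (by exact_mod_cast le_top), hgc, hgs⟩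
    rw [← h g ht, setIntegral_eq_integral_of_forall_compl_eq_zero]
    · simp [mul_comm]
    · intro X hX
      rw [ht.eq_zero hX, mul_zero]
  rw [EventuallyEq, ae_restrict_iff' hV.measurableSet]
  exact this

/-- The `L²` norm of a function is bounded by its action on test functions. -/
theorem eLpNorm_toReal_le_of_forall_isTestFunction (hV : IsOpen V) {f : Plane → ℝ}
    (hf : MemLp f 2 (volume.restrict V)) {K : ℝ} (hK : 0 ≤ K)
    (h : ∀ η, IsTestFunction V η →
      |∫ X in V, f X * η X| ≤ K * (eLpNorm η 2 (volume.restrict V)).toReal) :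
    (eLpNorm f 2 (volume.restrict V)).toReal ≤ K := by
  set μ := (volume : Measure Plane).restrict V with hμ
  -- The classes of test functions form a subspace with trivial orthogonal complement, hence a dense
  -- one. The bound extends to all of `L²` by continuity and is then applied to `f` itself.
  let S : Submodule ℝ (Lp ℝ 2 μ) :=
    { carrier := {u | ∃ η, IsTestFunction V η ∧ u =ᵐ[μ] η}
      add_mem' := by
        rintro u v ⟨η, hη, hu⟩ ⟨ζ, hζ, hv⟩
        exact ⟨η + ζ, hη.add hζ, (Lp.coeFn_add u v).trans (hu.add hv)⟩
      zero_mem' := ⟨0, IsTestFunction.zero, Lp.coeFn_zero _ _ _⟩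
      smul_mem' := by
        rintro c u ⟨η, hη, hu⟩
        exact ⟨c • η, hη.smul c, (Lp.coeFn_smul c u).trans (hu.const_smul c)⟩ }
  have hSperp : Sᗮ = ⊥ := by
    rw [Submodule.eq_bot_iff]
    intro u hu
    have hu0 : ∀ η, IsTestFunction V η → ∫ X in V, u X * η X = 0 := by
      intro η hη
      have hmem : (hη.memLp μ).toLp η ∈ S := ⟨η, hη, (hη.memLp μ).coeFn_toLp⟩
      have := (Submodule.mem_orthogonal' S u).1 hu _ hmem
      rw [← Lp.toLp_coeFn u (Lp.memLp u), ← MemLp.integral_mul_eq_inner (Lp.memLp u)] at this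
      exact this
    exact (Lp.eq_zero_iff_ae_eq_zero).2 (ae_eq_zero_of_forall_isTestFunction hV (Lp.memLp u) hu0)
  have hdense : Dense (S : Set (Lp ℝ 2 μ)) := by
    rw [← Submodule.topologicalClosure_eq_top_iff] at hSperp
    exact Submodule.dense_iff_topologicalClosure_eq_top.2 hSperp
  set F := hf.toLp f
  have hall : ∀ u : Lp ℝ 2 μ, |inner ℝ F u| ≤ K * ‖u‖ := by
    intro u
    refine hdense.induction (P := fun u => |inner ℝ F u| ≤ K * ‖u‖) ?_ ?_ u
    · rintro u ⟨η, hη, hu⟩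
      have hueq : u = (hη.memLp μ).toLp η := by
        ext1
        exact hu.trans (hη.memLp μ).coeFn_toLp.symm
      rw [hueq, ← MemLp.integral_mul_eq_inner, Lp.norm_toLp]
      exact h η hη
    · exact isClosed_le (by fun_prop) (by fun_prop)
  have hFF := hall F
  rw [← Lp.norm_toLp f hf]
  rw [real_inner_self_eq_norm_sq, abs_of_nonneg (by positivity), sq] at hFF
  by_cases h0 : ‖F‖ = 0
  · rwa [h0]
  · exact le_of_mul_le_mul_right hFF (lt_of_le_of_ne (norm_nonneg _) (Ne.symm h0))

end TestFunctions

/-! ### Weak gradients and finite differences -/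

/-- `φ` is square integrable on `U` and has the square integrable weak partial derivatives `G α`. -/
structure HasWeakGrad (U : Set Plane) (φ : Plane → ℝ) (G : Fin 2 → Plane → ℝ) : Prop where
  memLp : MemLp φ 2 (volume.restrict U)
  memLp_grad : ∀ α, MemLp (G α) 2 (volume.restrict U)
  integral_eq : ∀ α η, IsTestFunction U η →
    ∫ X in U, G α X * η X = - ∫ X in U, φ X * fderiv ℝ η X (EuclideanSpace.single α 1)

section WeakGradient

open Filter Topology
open scoped NNReal ENNReal

variable {U V : Set Plane} {φ : Plane → ℝ} {G : Fin 2 → Plane → ℝ}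

theorem plane_eq_sum (v : Plane) :
    v = v 0 • EuclideanSpace.single (0 : Fin 2) (1 : ℝ) + v 1 • EuclideanSpace.single 1 1 := by
  ext i
  fin_cases i <;> simp

/-- The weak derivative in the direction `v`. -/
theorem HasWeakGrad.integral_dir_eq (h : HasWeakGrad U φ G) {η : Plane → ℝ}
    (hη : IsTestFunction U η) (v : Plane) :
    ∫ X in U, (v 0 * G 0 X + v 1 * G 1 X) * η X = - ∫ X in U, φ X * fderiv ℝ η X v := by
  have hi : ∀ α, Integrable (fun X => G α X * η X) (volume.restrict U) :=
    fun α => (h.memLp_grad α).integrable_mul_two (hη.memLp _)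
  have hd : ∀ w, Integrable (fun X => φ X * fderiv ℝ η X w) (volume.restrict U) :=
    fun w => h.memLp.integrable_mul_two (hη.memLp_fderiv _ w)
  have h1 : ∀ X, (v 0 * G 0 X + v 1 * G 1 X) * η X
      = v 0 * (G 0 X * η X) + v 1 * (G 1 X * η X) := fun X => by ring
  have h2 : ∀ X, φ X * fderiv ℝ η X v
      = v 0 * (φ X * fderiv ℝ η X (EuclideanSpace.single 0 1))
        + v 1 * (φ X * fderiv ℝ η X (EuclideanSpace.single 1 1)) := by
    intro X
    conv_lhs => rw [plane_eq_sum v, map_add, map_smul, map_smul, smul_eq_mul, smul_eq_mul]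
    ring
  simp_rw [h1, h2]
  rw [integral_add ((hi 0).const_mul _) ((hi 1).const_mul _),
    integral_add ((hd _).const_mul _) ((hd _).const_mul _)]
  simp_rw [integral_const_mul]
  rw [h.integral_eq 0 η hη, h.integral_eq 1 η hη]
  ring

theorem HasWeakGrad.memLp_dir (h : HasWeakGrad U φ G) (v : Plane) :
    MemLp (fun X => v 0 * G 0 X + v 1 * G 1 X) 2 (volume.restrict U) :=
  ((h.memLp_grad 0).const_mul _).add ((h.memLp_grad 1).const_mul _)

theorem setIntegral_mul_eq_of_isTestFunction {η : Plane → ℝ} (hη : IsTestFunction V η)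
    (hVU : V ⊆ U) (f : Plane → ℝ) : ∫ X in U, f X * η X = ∫ X in V, f X * η X := by
  rw [setIntegral_eq_integral_of_forall_compl_eq_zero,
    setIntegral_eq_integral_of_forall_compl_eq_zero]
  · intro X hX
    rw [hη.eq_zero hX, mul_zero]
  · intro X hX
    rw [(hη.mono hVU).eq_zero hX, mul_zero]

theorem setIntegral_mul_fderiv_eq_of_isTestFunction {η : Plane → ℝ} (hη : IsTestFunction V η)
    (hVU : V ⊆ U) (f : Plane → ℝ) (v : Plane) :
    ∫ X in U, f X * fderiv ℝ η X v = ∫ X in V, f X * fderiv ℝ η X v := by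
  rw [setIntegral_eq_integral_of_forall_compl_eq_zero,
    setIntegral_eq_integral_of_forall_compl_eq_zero]
  · intro X hX
    rw [hη.fderiv_eq_zero hX]
    simp
  · intro X hX
    rw [(hη.mono hVU).fderiv_eq_zero hX]
    simp

theorem HasWeakGrad.mono (h : HasWeakGrad U φ G) (hVU : V ⊆ U) : HasWeakGrad V φ G where
  memLp := h.memLp.mono_measure (Measure.restrict_mono hVU le_rfl)
  memLp_grad α := (h.memLp_grad α).mono_measure (Measure.restrict_mono hVU le_rfl)
  integral_eq α η hη := by
    rw [← setIntegral_mul_eq_of_isTestFunction hη hVU,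
      ← setIntegral_mul_fderiv_eq_of_isTestFunction hη hVU, h.integral_eq α η (hη.mono hVU)]

theorem HasWeakGrad.congr (h : HasWeakGrad U φ G) {ψ : Plane → ℝ}
    (hψ : φ =ᵐ[volume.restrict U] ψ) : HasWeakGrad U ψ G where
  memLp := h.memLp.ae_eq hψ
  memLp_grad := h.memLp_grad
  integral_eq α η hη := by
    rw [h.integral_eq α η hη]
    congr 1
    refine integral_congr_ae ?_
    filter_upwards [hψ] with X hX
    rw [hX]

/-- The sum of the `L²` norms of the weak partial derivatives. -/
def gradNorm (U : Set Plane) (G : Fin 2 → Plane → ℝ) : ℝ :=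
  ∑ α, (eLpNorm (G α) 2 (volume.restrict U)).toReal

theorem gradNorm_nonneg : 0 ≤ gradNorm U G :=
  Finset.sum_nonneg fun _ _ => ENNReal.toReal_nonneg

theorem HasWeakGrad.eLpNorm_dir_le (h : HasWeakGrad U φ G) (v : Plane) :
    (eLpNorm (fun X => v 0 * G 0 X + v 1 * G 1 X) 2 (volume.restrict U)).toReal
      ≤ ‖v‖ * gradNorm U G := by
  have h0 := (h.memLp_grad 0).const_mul (v 0)
  have h1 := (h.memLp_grad 1).const_mul (v 1)
  have hadd := eLpNorm_add_le h0.aestronglyMeasurable h1.aestronglyMeasurable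
    (p := 2) (by norm_num)
  have hle := ENNReal.toReal_mono (ENNReal.add_ne_top.2 ⟨h0.eLpNorm_ne_top, h1.eLpNorm_ne_top⟩) hadd
  rw [ENNReal.toReal_add h0.eLpNorm_ne_top h1.eLpNorm_ne_top] at hle
  have hs : ∀ α, (eLpNorm (fun X => v α * G α X) 2 (volume.restrict U)).toReal
      = |v α| * (eLpNorm (G α) 2 (volume.restrict U)).toReal := by
    intro α
    have := eLpNorm_const_smul (v α) (G α) 2 (volume.restrict U)
    rw [show (fun X => v α * G α X) = v α • G α from rfl, this, ENNReal.toReal_mul]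
    simp
  have hv : ∀ α, |v α| ≤ ‖v‖ := fun α => by simpa using PiLp.norm_apply_le v α
  rw [hs 0, hs 1] at hle
  refine hle.trans ?_
  rw [gradNorm, Fin.sum_univ_two, mul_add]
  gcongr <;> exact hv _

/-- The translate of a test function along a segment that stays in `U`. -/
theorem IsTestFunction.comp_sub {η : Plane → ℝ} (hη : IsTestFunction V η) {w : Plane}
    (hw : ∀ X ∈ V, X + w ∈ U) : IsTestFunction U (fun X => η (X - w)) := by
  have hts : tsupport (fun X => η (X - w)) = (fun X => X - w) ⁻¹' tsupport η :=
    tsupport_comp_eq_preimage η (Homeomorph.subRight w)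
  refine ⟨hη.1.comp (contDiff_id.sub contDiff_const), ?_, ?_⟩
  · exact hη.2.1.comp_homeomorph (Homeomorph.subRight w)
  · rw [hts]
    intro X hX
    simpa using hw _ (hη.2.2 hX)

/-- Finite differences of a function are bounded by its weak gradient. -/
theorem HasWeakGrad.abs_integral_sub_le (h : HasWeakGrad U φ G)
    (hUfin : volume U ≠ ∞) {w : Plane}
    (hw : ∀ t ∈ Icc (0 : ℝ) 1, ∀ X ∈ V, X + t • w ∈ U) {η : Plane → ℝ} (hη : IsTestFunction V η) :
    |(∫ X in U, φ X * η (X - w)) - ∫ X in U, φ X * η X| ≤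
      ‖w‖ * gradNorm U G * (eLpNorm η 2 (volume.restrict V)).toReal := by
  have : IsFiniteMeasure (volume.restrict U) := ⟨by simpa using hUfin.lt_top⟩
  -- The translation is put on `η`, so no smoothing of `φ` is required. `F` is differentiable
  -- because `η` is `C¹`, its derivative is a weak derivative of `φ` paired with a translate of `η`,
  -- and the mean value inequality on `[0, 1]` concludes.
  set F : ℝ → ℝ := fun t => ∫ X in U, φ X * η (X - t • w) with hF
  obtain ⟨C, hC⟩ := hη.continuous_fderiv.bounded_above_of_compact_support (hη.2.1.fderiv (𝕜 := ℝ))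
  have hφi : Integrable φ (volume.restrict U) := h.memLp.integrable (by norm_num)
  have hcont : ∀ t : ℝ, Continuous fun X : Plane => η (X - t • w) := fun t =>
    hη.1.continuous.comp (by fun_prop)
  obtain ⟨C', hC'⟩ := hη.1.continuous.bounded_above_of_compact_support hη.2.1
  have hderiv : ∀ t : ℝ, HasDerivAt F (∫ X in U, φ X * fderiv ℝ η (X - t • w) (-w)) t := by
    intro t
    refine (hasDerivAt_integral_of_dominated_loc_of_deriv_le (s := univ)
      (μ := volume.restrict U) (F := fun s X => φ X * η (X - s • w))
      (F' := fun s X => φ X * fderiv ℝ η (X - s • w) (-w))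
      (bound := fun X => ‖φ X‖ * (C * ‖w‖)) univ_mem ?_ ?_ ?_ ?_ ?_ ?_).2
    · exact Eventually.of_forall fun s =>
        hφi.aestronglyMeasurable.mul (hcont s).aestronglyMeasurable
    · exact hφi.mul_bdd (c := C') (hcont t).aestronglyMeasurable
        (Eventually.of_forall fun X => hC' _)
    · refine hφi.aestronglyMeasurable.mul (Continuous.aestronglyMeasurable ?_)
      exact (hη.continuous_fderiv.comp (by fun_prop)).clm_apply continuous_const
    · refine Eventually.of_forall fun X s _ => ?_
      rw [norm_mul]
      gcongr
      refine ((fderiv ℝ η (X - s • w)).le_opNorm (-w)).trans ?_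
      rw [norm_neg]
      gcongr
      exact hC _
    · exact hφi.norm.mul_const _
    · refine Eventually.of_forall fun X s _ => ?_
      have h1 : HasDerivAt (fun s : ℝ => X - s • w) (-w) s := by
        simpa using ((hasDerivAt_id s).smul_const w).const_sub X
      have h2 := (hη.1.differentiable one_ne_zero (X - s • w)).hasFDerivAt
      exact (h2.comp_hasDerivAt s h1).const_mul (φ X)
  have hbound : ∀ t ∈ Ico (0 : ℝ) 1, ‖∫ X in U, φ X * fderiv ℝ η (X - t • w) (-w)‖ ≤
      ‖w‖ * gradNorm U G * (eLpNorm η 2 (volume.restrict V)).toReal := by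
    intro t ht
    have ht' := hη.comp_sub (hw t (Ico_subset_Icc_self ht))
    have hfd : ∀ X, fderiv ℝ (fun X => η (X - t • w)) X = fderiv ℝ η (X - t • w) :=
      fun X => fderiv_comp_sub (f := η) (x := X) (t • w)
    have h1 := h.integral_dir_eq ht' (-w)
    simp_rw [hfd] at h1
    rw [← neg_eq_iff_eq_neg] at h1
    rw [← h1, norm_neg, Real.norm_eq_abs]
    refine ((h.memLp_dir (-w)).abs_integral_mul_le (ht'.memLp _)).trans ?_
    have h2 := h.eLpNorm_dir_le (-w)
    rw [norm_neg] at h2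
    refine mul_le_mul h2 ?_ ENNReal.toReal_nonneg (by have := gradNorm_nonneg (U := U) (G := G); positivity)
    -- The translate has norm over `U` at most that of `η` over the plane, which equals the norm
    -- over `V` because `η` vanishes off `V`.
    have hηV : eLpNorm η 2 (volume.restrict V) = eLpNorm η 2 volume :=
      eLpNorm_restrict_eq_of_support_subset (by
        intro X hX
        by_contra h
        exact hX (hη.eq_zero h))
    refine ENNReal.toReal_mono (hη.memLp _).eLpNorm_ne_top ?_
    rw [hηV]
    refine (eLpNorm_restrict_le _ _ _ _).trans (le_of_eq ?_)
    exact eLpNorm_comp_measurePreserving (f := fun X : Plane => X - t • w)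
      hη.1.continuous.aestronglyMeasurable (measurePreserving_sub_right volume (t • w))
  have := norm_image_sub_le_of_norm_deriv_le_segment_01'
    (fun t _ => (hderiv t).hasDerivWithinAt) hbound
  simpa [hF] using this

end WeakGradient

/-! ### The Poincaré inequality on convex sets -/

section Poincare

open Filter Topology
open scoped NNReal ENNReal

variable {U V Q : Set Plane} {φ : Plane → ℝ} {G : Fin 2 → Plane → ℝ}

theorem eLpNorm_two_sq {α : Type*} [MeasurableSpace α] (μ : Measure α) (f : α → ℝ) :
    eLpNorm f 2 μ ^ 2 = ∫⁻ x, ‖f x‖ₑ ^ 2 ∂μ := by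
  have := eLpNorm_nnreal_pow_eq_lintegral (f := f) (μ := μ) (p := 2) (by norm_num)
  simpa using this

theorem toReal_le_of_sq_le_ofReal_sq {a : ℝ≥0∞} {b : ℝ} (hb : 0 ≤ b)
    (h : a ^ 2 ≤ ENNReal.ofReal (b ^ 2)) : a.toReal ≤ b := by
  have := ENNReal.toReal_mono ENNReal.ofReal_ne_top h
  rw [ENNReal.toReal_pow, ENNReal.toReal_ofReal (by positivity)] at this
  exact le_of_sq_le_sq this hb

/-- Finite differences of a function on a convex set are bounded by its weak gradient. -/
theorem HasWeakGrad.lintegral_sub_sq_le (h : HasWeakGrad Q φ G) (hQ : IsOpen Q)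
    (hconv : Convex ℝ Q) (hQfin : volume Q ≠ ∞) (w : Plane) :
    ∫⁻ X in Q ∩ (fun X => X + w) ⁻¹' Q, ‖φ (X + w) - φ X‖ₑ ^ 2 ≤
      ENNReal.ofReal ((‖w‖ * gradNorm Q G) ^ 2) := by
  -- These are the points for which the difference makes sense. Convexity keeps the whole segment
  -- from `X` to `X + w` inside `Q`.
  set V := Q ∩ (fun X => X + w) ⁻¹' Q with hV
  have hVo : IsOpen V := hQ.inter (hQ.preimage (by fun_prop))
  have hw : ∀ t ∈ Icc (0 : ℝ) 1, ∀ X ∈ V, X + t • w ∈ Q := by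
    intro t ht X hX
    have := hconv hX.1 hX.2 (sub_nonneg.2 ht.2) ht.1 (by ring)
    convert this using 1
    module
  have hmp : MeasurePreserving (fun X : Plane => X + w) (volume.restrict ((fun X => X + w) ⁻¹' Q))
      (volume.restrict Q) :=
    (measurePreserving_add_right volume w).restrict_preimage hQ.measurableSet
  have hm1 : MemLp (fun X => φ (X + w)) 2 (volume.restrict V) :=
    (h.memLp.comp_measurePreserving hmp).mono_measure
      (Measure.restrict_mono inter_subset_right le_rfl)
  have hm2 : MemLp φ 2 (volume.restrict V) :=
    h.memLp.mono_measure (Measure.restrict_mono inter_subset_left le_rfl)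
  have hm : MemLp (fun X => φ (X + w) - φ X) 2 (volume.restrict V) := hm1.sub hm2
  have hN : 0 ≤ ‖w‖ * gradNorm Q G := mul_nonneg (norm_nonneg _) gradNorm_nonneg
  -- By duality it suffices to pair the difference with a test function; a change of variables moves
  -- the translation onto it.
  have hle := eLpNorm_toReal_le_of_forall_isTestFunction hVo hm hN fun η hη => by
    have h1 : ∫ X in V, (φ (X + w) - φ X) * η X
        = (∫ X in Q, φ X * η (X - w)) - ∫ X in Q, φ X * η X := by
      simp_rw [sub_mul]
      rw [integral_sub (hm1.integrable_mul_two (hη.memLp _)) (hm2.integrable_mul_two (hη.memLp _)),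
        setIntegral_mul_eq_of_isTestFunction hη inter_subset_left]
      congr 1
      have hη' : IsTestFunction Q fun X => η (X - w) :=
        hη.comp_sub fun X hX => by simpa using hw 1 (by simp) X hX
      rw [setIntegral_eq_integral_of_forall_compl_eq_zero,
        setIntegral_eq_integral_of_forall_compl_eq_zero,
        ← integral_add_right_eq_self (fun X => φ X * η (X - w)) w]
      · simp
      · intro X hX
        rw [hη'.eq_zero hX, mul_zero]
      · intro X hX
        rw [hη.eq_zero hX, mul_zero]
    rw [h1]
    exact h.abs_integral_sub_le hQfin hw hη
  rw [← eLpNorm_two_sq, ← ENNReal.ofReal_toReal hm.eLpNorm_ne_top,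
    ← ENNReal.ofReal_pow ENNReal.toReal_nonneg]
  exact ENNReal.ofReal_le_ofReal (pow_le_pow_left₀ ENNReal.toReal_nonneg hle 2)

/-- The Poincaré inequality on `V` for functions with weak gradient on `U`. -/
def PoincareOn (U V : Set Plane) : Prop :=
  ∃ C : ℝ, 0 ≤ C ∧ ∀ (φ : Plane → ℝ) (G : Fin 2 → Plane → ℝ), HasWeakGrad U φ G →
    ∃ c : ℝ, (eLpNorm (fun X => φ X - c) 2 (volume.restrict V)).toReal ≤ C * gradNorm U G

/-- The Poincaré inequality on bounded convex open sets. -/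
theorem poincareOn_of_convex (hQ : IsOpen Q) (hconv : Convex ℝ Q) (hne : Q.Nonempty)
    (hb : Bornology.IsBounded Q) : PoincareOn Q Q := by
  have hQfin : volume Q ≠ ∞ := hb.measure_lt_top.ne
  have hQpos : volume Q ≠ 0 := (hQ.measure_pos volume hne).ne'
  obtain ⟨R, hR0, hR⟩ : ∃ R : ℝ, 0 < R ∧ ∀ X ∈ Q, ∀ Y ∈ Q, dist X Y < R :=
    ⟨Metric.diam Q + 1, by have := Metric.diam_nonneg (s := Q); linarith, fun X hX Y hY => by
      have := Metric.dist_le_diam_of_mem hb hX hY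
      linarith⟩
  set B := Metric.ball (0 : Plane) R
  have hBfin : volume B ≠ ∞ := Metric.isBounded_ball.measure_lt_top.ne
  refine ⟨Real.sqrt ((volume B).toReal / (volume Q).toReal) * R, by positivity, ?_⟩
  -- A Borel representative of `φ` makes the integrand of the double integral below jointly
  -- measurable and its point values usable.
  suffices H : ∀ (φ : Plane → ℝ) (G : Fin 2 → Plane → ℝ), Measurable φ → HasWeakGrad Q φ G →
      ∃ c : ℝ, (eLpNorm (fun X => φ X - c) 2 (volume.restrict Q)).toReal ≤
        Real.sqrt ((volume B).toReal / (volume Q).toReal) * R * gradNorm Q G by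
    intro φ G h
    have hae := h.memLp.aestronglyMeasurable.ae_eq_mk
    obtain ⟨c, hc⟩ := H _ G h.memLp.aestronglyMeasurable.stronglyMeasurable_mk.measurable
      (h.congr hae)
    refine ⟨c, ?_⟩
    rwa [eLpNorm_congr_ae (g := fun X => h.memLp.aestronglyMeasurable.mk φ X - c)]
    filter_upwards [hae] with X hX
    rw [hX]
  intro φ G hφm h
  set N := gradNorm Q G
  have hN : 0 ≤ N := gradNorm_nonneg
  have hk : Measurable fun p : Plane × Plane => ‖φ p.2 - φ p.1‖ₑ ^ 2 := by fun_prop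
  have hQm := hQ.measurableSet
  -- With `Y = X + w` and the order of integration exchanged, the inner integral is a squared finite
  -- difference. It vanishes unless `‖w‖ < R`, and is at most `(R N) ^ 2` otherwise.
  have hdouble : ∫⁻ X in Q, ∫⁻ Y in Q, ‖φ Y - φ X‖ₑ ^ 2 ≤
      volume B * ENNReal.ofReal ((R * N) ^ 2) := by
    have h1 : ∫⁻ X in Q, ∫⁻ Y in Q, ‖φ Y - φ X‖ₑ ^ 2 =
        ∫⁻ X, ∫⁻ w, (Q ∩ (fun X => X + w) ⁻¹' Q).indicator
          (fun X => ‖φ (X + w) - φ X‖ₑ ^ 2) X := by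
      rw [← lintegral_indicator hQm]
      refine lintegral_congr fun X => ?_
      by_cases hX : X ∈ Q
      · rw [indicator_of_mem hX, ← lintegral_indicator hQm,
          ← lintegral_add_left_eq_self _ X]
        refine lintegral_congr fun w => ?_
        by_cases hw : X + w ∈ Q
        · rw [indicator_of_mem hw, indicator_of_mem (show X ∈ Q ∩ _ from ⟨hX, hw⟩)]
        · rw [indicator_of_notMem hw, indicator_of_notMem fun h => hw h.2]
      · rw [indicator_of_notMem hX]
        symm
        rw [lintegral_congr (g := fun _ => 0), lintegral_zero]
        exact fun w => indicator_of_notMem (fun h => hX h.1) _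
    rw [h1, lintegral_lintegral_swap]
    · have h2 : ∀ w : Plane, ∫⁻ X, (Q ∩ (fun X => X + w) ⁻¹' Q).indicator
          (fun X => ‖φ (X + w) - φ X‖ₑ ^ 2) X ≤
          B.indicator (fun _ => ENNReal.ofReal ((R * N) ^ 2)) w := by
        intro w
        have hVm : MeasurableSet (Q ∩ (fun X => X + w) ⁻¹' Q) :=
          hQm.inter (hQm.preimage (by fun_prop))
        rw [lintegral_indicator hVm]
        by_cases hw : w ∈ B
        · rw [indicator_of_mem hw]
          refine (h.lintegral_sub_sq_le hQ hconv hQfin w).trans (ENNReal.ofReal_le_ofReal ?_)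
          have : ‖w‖ ≤ R := (mem_ball_zero_iff.1 hw).le
          gcongr
        · have : Q ∩ (fun X => X + w) ⁻¹' Q = ∅ := by
            by_contra hne
            obtain ⟨X, hX⟩ := nonempty_iff_ne_empty.2 hne
            refine hw (mem_ball_zero_iff.2 ?_)
            simpa [dist_eq_norm] using hR _ hX.2 _ hX.1
          rw [this]
          simp
      calc _ ≤ ∫⁻ w, B.indicator (fun _ => ENNReal.ofReal ((R * N) ^ 2)) w := lintegral_mono h2
        _ = _ := by
          rw [lintegral_indicator Metric.isOpen_ball.measurableSet, setLIntegral_const, mul_comm]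
    · have : Function.uncurry (fun X w : Plane => (Q ∩ (fun X => X + w) ⁻¹' Q).indicator
          (fun X => ‖φ (X + w) - φ X‖ₑ ^ 2) X) =
          {p : Plane × Plane | p.1 ∈ Q ∧ p.1 + p.2 ∈ Q}.indicator
            fun p => ‖φ (p.1 + p.2) - φ p.1‖ₑ ^ 2 := by
        ext ⟨X, w⟩
        rfl
      rw [this]
      refine (Measurable.indicator ?_ ?_).aemeasurable
      · fun_prop
      · exact (measurable_fst hQm).inter
          ((measurable_fst.add measurable_snd : Measurable fun p : Plane × Plane => p.1 + p.2) hQm)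
  -- The constant is not the mean of `φ` but its value at a point `X₀` where the inner integral does
  -- not exceed its average.
  obtain ⟨X₀, -, hX₀⟩ := exists_le_setLAverage (μ := volume) hQpos hQfin
    (f := fun X => ∫⁻ Y in Q, ‖φ Y - φ X‖ₑ ^ 2) (Measurable.lintegral_prod_right' hk).aemeasurable
  refine ⟨φ X₀, toReal_le_of_sq_le_ofReal_sq (by positivity) ?_⟩
  rw [eLpNorm_two_sq]
  refine hX₀.trans ?_
  rw [setLAverage_eq]
  refine (ENNReal.div_le_div_right hdouble _).trans (le_of_eq ?_)
  rw [mul_assoc, mul_pow (√_), Real.sq_sqrt (by positivity), ENNReal.ofReal_mul (by positivity),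
    ENNReal.ofReal_div_of_pos (ENNReal.toReal_pos hQpos hQfin), ENNReal.ofReal_toReal hBfin,
    ENNReal.ofReal_toReal hQfin, ENNReal.mul_div_right_comm]

end Poincare

/-! ### From local to global Poincaré inequalities -/

section PoincareUnion

open Filter Topology
open scoped NNReal ENNReal

variable {U V V₁ V₂ : Set Plane} {φ : Plane → ℝ} {G : Fin 2 → Plane → ℝ}

theorem eLpNorm_toReal_restrict_union_le {f : Plane → ℝ} (h₁ : MemLp f 2 (volume.restrict V₁))
    (h₂ : MemLp f 2 (volume.restrict V₂)) :
    (eLpNorm f 2 (volume.restrict (V₁ ∪ V₂))).toReal ≤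
      (eLpNorm f 2 (volume.restrict V₁)).toReal + (eLpNorm f 2 (volume.restrict V₂)).toReal := by
  rw [← ENNReal.toReal_add h₁.eLpNorm_ne_top h₂.eLpNorm_ne_top]
  refine ENNReal.toReal_mono (ENNReal.add_ne_top.2 ⟨h₁.eLpNorm_ne_top, h₂.eLpNorm_ne_top⟩) ?_
  rw [← ENNReal.pow_le_pow_left_iff (n := 2) two_ne_zero, eLpNorm_two_sq]
  refine (lintegral_union_le _ V₁ V₂).trans ?_
  rw [← eLpNorm_two_sq, ← eLpNorm_two_sq, add_sq]
  rw [add_right_comm]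
  exact le_self_add

theorem eLpNorm_toReal_mono_set {f : Plane → ℝ} (h : MemLp f 2 (volume.restrict V₂))
    (hV : V₁ ⊆ V₂) :
    (eLpNorm f 2 (volume.restrict V₁)).toReal ≤ (eLpNorm f 2 (volume.restrict V₂)).toReal :=
  ENNReal.toReal_mono h.eLpNorm_ne_top (eLpNorm_mono_measure _ (Measure.restrict_mono hV le_rfl))

theorem eLpNorm_toReal_sub_le {α : Type*} [MeasurableSpace α] {μ : Measure α} {f g : α → ℝ}
    (hf : MemLp f 2 μ) (hg : MemLp g 2 μ) :
    (eLpNorm (fun x => f x - g x) 2 μ).toReal ≤ (eLpNorm f 2 μ).toReal + (eLpNorm g 2 μ).toReal := by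
  rw [← ENNReal.toReal_add hf.eLpNorm_ne_top hg.eLpNorm_ne_top]
  exact ENNReal.toReal_mono (ENNReal.add_ne_top.2 ⟨hf.eLpNorm_ne_top, hg.eLpNorm_ne_top⟩)
    (eLpNorm_sub_le hf.aestronglyMeasurable hg.aestronglyMeasurable (by norm_num))

theorem eLpNorm_toReal_const (V : Set Plane) (c : ℝ) :
    (eLpNorm (fun _ => c) 2 (volume.restrict V)).toReal = |c| * √(volume V).toReal := by
  rw [eLpNorm_const' c (by norm_num) (by norm_num), ENNReal.toReal_mul, Measure.restrict_apply_univ,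
    ← ENNReal.toReal_rpow, Real.sqrt_eq_rpow]
  simp

/-- The Poincaré inequality on two overlapping sets gives the inequality on their union. -/
theorem PoincareOn.union (hU : volume U ≠ ∞) (h₁ : PoincareOn U V₁) (h₂ : PoincareOn U V₂)
    (hV₁ : V₁ ⊆ U) (hV₂ : V₂ ⊆ U) (ho₁ : IsOpen V₁) (ho₂ : IsOpen V₂)
    (hne : (V₁ ∩ V₂).Nonempty) : PoincareOn U (V₁ ∪ V₂) := by
  obtain ⟨C₁, hC₁, h₁⟩ := h₁
  obtain ⟨C₂, hC₂, h₂⟩ := h₂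
  set m := √(volume (V₁ ∩ V₂)).toReal
  have hm : 0 < m := Real.sqrt_pos.2 (ENNReal.toReal_pos ((ho₁.inter ho₂).measure_pos volume hne).ne'
    (measure_ne_top_of_subset (inter_subset_left.trans hV₁) hU))
  set M := √(volume V₂).toReal
  refine ⟨C₁ + (C₂ + (C₁ + C₂) / m * M), by positivity, fun φ G h => ?_⟩
  obtain ⟨c₁, hc₁⟩ := h₁ φ G h
  obtain ⟨c₂, hc₂⟩ := h₂ φ G h
  have hfin : IsFiniteMeasure (volume.restrict U) := ⟨by simpa using hU.lt_top⟩
  have hmem : ∀ c : ℝ, ∀ V ⊆ U, MemLp (fun X => φ X - c) 2 (volume.restrict V) := fun c V hV =>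
    (h.memLp.sub (memLp_const c)).mono_measure (Measure.restrict_mono hV le_rfl)
  have hconst : ∀ c : ℝ, ∀ V ⊆ U, MemLp (fun _ : Plane => c) 2 (volume.restrict V) := fun c V hV =>
    (memLp_const c).mono_measure (Measure.restrict_mono hV le_rfl)
  set N := gradNorm U G
  have hN : 0 ≤ N := gradNorm_nonneg
  -- On the overlap both constants approximate `φ`, and the constant function `c₁ - c₂` has norm
  -- `|c₁ - c₂| * m` there. The overlap is open and nonempty, so `m` is positive.
  have hcc : |c₁ - c₂| ≤ (C₁ + C₂) / m * N := by
    have hW : V₁ ∩ V₂ ⊆ U := inter_subset_left.trans hV₁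
    have h3 := eLpNorm_toReal_sub_le (hmem c₂ _ hW) (hmem c₁ _ hW)
    have h4 : (fun X => φ X - c₂ - (φ X - c₁)) = fun _ => c₁ - c₂ := by ext; ring
    rw [h4, eLpNorm_toReal_const] at h3
    have h5 := eLpNorm_toReal_mono_set (hmem c₂ _ hV₂) (inter_subset_right (s := V₁))
    have h6 := eLpNorm_toReal_mono_set (hmem c₁ _ hV₁) (inter_subset_left (t := V₂))
    rw [div_mul_eq_mul_div, le_div_iff₀ hm]
    change |c₁ - c₂| * m ≤ _ at h3
    linarith
  refine ⟨c₁, (eLpNorm_toReal_restrict_union_le (hmem _ _ hV₁) (hmem _ _ hV₂)).trans ?_⟩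
  have h7 := eLpNorm_toReal_sub_le (hmem c₂ _ hV₂) (hconst (c₁ - c₂) _ hV₂)
  have h8 : (fun X => φ X - c₂ - (c₁ - c₂)) = fun X => φ X - c₁ := by ext; ring
  rw [h8, eLpNorm_toReal_const] at h7
  have h9 : |c₁ - c₂| * M ≤ (C₁ + C₂) / m * N * M := by gcongr
  change _ ≤ _ + |c₁ - c₂| * M at h7
  nlinarith

theorem PoincareOn.mono {U' : Set Plane} (h : PoincareOn U' V) (hU : U' ⊆ U) : PoincareOn U V := by
  obtain ⟨C, hC, h⟩ := h
  refine ⟨C, hC, fun φ G hφ => ?_⟩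
  obtain ⟨c, hc⟩ := h φ G (hφ.mono hU)
  refine ⟨c, hc.trans ?_⟩
  refine mul_le_mul_of_nonneg_left (Finset.sum_le_sum fun α _ => ?_) hC
  exact eLpNorm_toReal_mono_set (hφ.memLp_grad α) hU

/-- A connected bounded open set that satisfies the Poincaré inequality locally, up to the
boundary, satisfies it globally. -/
theorem poincareOn_of_local (hU : IsOpen U) (hconn : IsConnected U) (hb : Bornology.IsBounded U)
    (hloc : ∀ p ∈ closure U, ∃ N, IsOpen N ∧ p ∈ N ∧ PoincareOn U (N ∩ U)) : PoincareOn U U := by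
  classical
  have hUfin : volume U ≠ ∞ := hb.measure_lt_top.ne
  choose! N hNo hpN hNP using hloc
  obtain ⟨t, ht, htcov⟩ := hb.isCompact_closure.elim_nhds_subcover N
    fun p hp => (hNo p hp).mem_nhds (hpN p hp)
  have hcov : U ⊆ ⋃ p ∈ t, N p := subset_closure.trans htcov
  have hint : ∀ p ∈ t, (N p ∩ U).Nonempty := fun p hp =>
    mem_closure_iff.1 (ht p hp) _ (hNo p (ht p hp)) (hpN p (ht p hp))
  set W : Finset Plane → Set Plane := fun s => ⋃ p ∈ s, N p ∩ U with hW
  have hWo : ∀ s ⊆ t, IsOpen (W s) := fun s hs =>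
    isOpen_biUnion fun p hp => (hNo p (ht p (hs hp))).inter hU
  have hWU : ∀ s, W s ⊆ U := fun s => iUnion₂_subset fun p _ => inter_subset_right
  have hWt : W t = U := by
    refine (hWU t).antisymm fun X hX => ?_
    obtain ⟨p, hp, hXp⟩ := mem_iUnion₂.1 (hcov hX)
    exact mem_iUnion₂.2 ⟨p, hp, hXp, hX⟩
  obtain ⟨X₀, hX₀⟩ := hconn.nonempty
  obtain ⟨p₀, hp₀, -⟩ := mem_iUnion₂.1 (hcov hX₀)
  -- A largest subfamily whose union satisfies the inequality must cover `U`: otherwise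
  -- connectedness makes its union meet a remaining piece, which could be adjoined. Subfamilies are
  -- required to be nonempty so that connectedness applies.
  set F := t.powerset.filter fun s => s.Nonempty ∧ PoincareOn U (W s) with hF
  have hFne : F.Nonempty := ⟨{p₀}, by
    simp only [hF, Finset.mem_filter, Finset.mem_powerset, Finset.singleton_subset_iff]
    refine ⟨hp₀, Finset.singleton_nonempty _, ?_⟩
    simpa [hW] using hNP p₀ (ht p₀ hp₀)⟩
  obtain ⟨s, hs, hmax⟩ := F.exists_max_image Finset.card hFne
  obtain ⟨hst, hsne, hsP⟩ : s ⊆ t ∧ s.Nonempty ∧ PoincareOn U (W s) := by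
    simpa [hF] using hs
  by_cases hall : W s = U
  · rwa [hall] at hsP
  exfalso
  have hsub : U ⊆ W s ∪ W (t \ s) := by
    intro X hX
    obtain ⟨p, hp, hXp⟩ := mem_iUnion₂.1 (hcov hX)
    by_cases hps : p ∈ s
    · exact Or.inl (mem_iUnion₂.2 ⟨p, hps, hXp, hX⟩)
    · exact Or.inr (mem_iUnion₂.2 ⟨p, by simp [hp, hps], hXp, hX⟩)
  have hne1 : (U ∩ W s).Nonempty := by
    obtain ⟨p, hp⟩ := hsne
    obtain ⟨X, hX⟩ := hint p (hst hp)
    exact ⟨X, hX.2, mem_iUnion₂.2 ⟨p, hp, hX⟩⟩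
  have hne2 : (U ∩ W (t \ s)).Nonempty := by
    obtain ⟨X, hX, hXs⟩ := not_subset.1 fun h => hall ((hWU s).antisymm h)
    exact ⟨X, hX, (hsub hX).resolve_left hXs⟩
  obtain ⟨X, hXU, hXs, hXt⟩ := hconn.isPreconnected _ _ (hWo s hst)
    (hWo (t \ s) Finset.sdiff_subset) hsub hne1 hne2
  obtain ⟨q, hq, hXq⟩ := mem_iUnion₂.1 hXt
  obtain ⟨hqt, hqs⟩ := Finset.mem_sdiff.1 hq
  have hunion := hsP.union hUfin (hNP q (ht q hqt)) (hWU s) inter_subset_right (hWo s hst)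
    ((hNo q (ht q hqt)).inter hU) ⟨X, hXs, hXq⟩
  have hWi : W (insert q s) = W s ∪ N q ∩ U := by
    simp only [hW, Finset.mem_insert, iUnion_iUnion_eq_or_left, union_comm]
  have hins : insert q s ∈ F := by
    simp only [hF, Finset.mem_filter, Finset.mem_powerset]
    refine ⟨Finset.insert_subset hqt hst, Finset.insert_nonempty _ _, ?_⟩
    rwa [hWi]
  have := hmax _ hins
  rw [Finset.card_insert_of_notMem hqs] at this
  omega

end PoincareUnion

/-! ### Straightening the boundary -/

section Shear

open Filter Topology
open scoped NNReal ENNReal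

/-- The shear `(x, y) ↦ (x, y + γ x)` followed by the inverse of a linear isometry `e`: it
straightens the graph of `γ`. -/
def graphShear (e : Plane ≃ₗᵢ[ℝ] Plane) (γ : ℝ → ℝ) (X : Plane) : Plane :=
  e.symm (X + γ (X 0) • EuclideanSpace.single 1 1)

/-- The inverse of `graphShear`. -/
def graphUnshear (e : Plane ≃ₗᵢ[ℝ] Plane) (γ : ℝ → ℝ) (Y : Plane) : Plane :=
  e Y - γ (e Y 0) • EuclideanSpace.single 1 1

variable {e : Plane ≃ₗᵢ[ℝ] Plane} {γ : ℝ → ℝ}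

theorem graphUnshear_graphShear (X : Plane) : graphUnshear e γ (graphShear e γ X) = X := by
  simp [graphUnshear, graphShear]

theorem graphShear_graphUnshear (Y : Plane) : graphShear e γ (graphUnshear e γ Y) = Y := by
  simp [graphUnshear, graphShear]

theorem contDiff_plane_apply (i : Fin 2) {n : WithTop ℕ∞} : ContDiff ℝ n fun X : Plane => X i :=
  (EuclideanSpace.proj (𝕜 := ℝ) i).contDiff

theorem contDiff_graphShear {n : WithTop ℕ∞} (hγ : ContDiff ℝ n γ) :
    ContDiff ℝ n (graphShear e γ) :=
  e.symm.contDiff.comp (contDiff_id.add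
    ((hγ.comp (contDiff_plane_apply 0)).smul contDiff_const))

theorem contDiff_graphUnshear {n : WithTop ℕ∞} (hγ : ContDiff ℝ n γ) :
    ContDiff ℝ n (graphUnshear e γ) :=
  e.contDiff.sub ((hγ.comp ((contDiff_plane_apply 0).comp e.contDiff)).smul contDiff_const)

/-- The shear along a graph as a homeomorphism. -/
def graphShearHomeomorph (e : Plane ≃ₗᵢ[ℝ] Plane) (hγ : Continuous γ) : Plane ≃ₜ Plane where
  toFun := graphShear e γ
  invFun := graphUnshear e γ
  left_inv := graphUnshear_graphShear
  right_inv := graphShear_graphUnshear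
  continuous_toFun := (contDiff_graphShear (n := 0) (contDiff_zero.2 hγ)).continuous
  continuous_invFun := (contDiff_graphUnshear (n := 0) (contDiff_zero.2 hγ)).continuous

/-- Each vertical line is merely translated, by `γ` of its abscissa, so Fubini gives the claim for
continuous `γ`. No Jacobian will appear when integrals and `L²` norms are transported. -/
theorem measurePreserving_graphShear (hγ : Continuous γ) :
    MeasurePreserving (graphShear e γ) volume volume := by
  have h1 : MeasurePreserving (fun p : ℝ × ℝ => (p.1, p.2 + γ p.1)) (volume.prod volume)
      (volume.prod volume) :=
    MeasurePreserving.skew_product (f := id) (g := fun a b => b + γ a) (MeasurePreserving.id _)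
      (by fun_prop) (Eventually.of_forall fun a => (measurePreserving_add_right volume (γ a)).map_eq)
  have h2 : MeasurePreserving (fun X : Plane => MeasurableEquiv.finTwoArrow X.ofLp) volume
      (volume.prod volume) :=
    (volume_preserving_finTwoArrow ℝ).comp (PiLp.volume_preserving_ofLp (Fin 2))
  have h3 : MeasurePreserving (fun p : ℝ × ℝ =>
      (WithLp.toLp 2 (MeasurableEquiv.finTwoArrow.symm p) : Plane)) (volume.prod volume) volume :=
    (PiLp.volume_preserving_toLp (Fin 2)).comp (volume_preserving_finTwoArrow ℝ).symm
  have h4 := e.symm.measurePreserving.comp (h3.comp (h1.comp h2))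
  have h5 : graphShear e γ = e.symm ∘ (fun p : ℝ × ℝ =>
      (WithLp.toLp 2 (MeasurableEquiv.finTwoArrow.symm p) : Plane)) ∘
      (fun p : ℝ × ℝ => (p.1, p.2 + γ p.1)) ∘
      fun X : Plane => MeasurableEquiv.finTwoArrow X.ofLp := by
    funext X
    refine congrArg e.symm ?_
    ext i
    fin_cases i <;> simp [MeasurableEquiv.finTwoArrow, MeasurableEquiv.piFinTwo]
  rw [h5]
  exact h4

theorem hasFDerivAt_graphShear_apply (hγ : Differentiable ℝ γ) {f : Plane → ℝ} {X : Plane}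
    (hf : DifferentiableAt ℝ f (graphShear e γ X)) (v : Plane) :
    fderiv ℝ (fun X => f (graphShear e γ X)) X v =
      fderiv ℝ f (graphShear e γ X) (e.symm v) +
        deriv γ (X 0) * v 0 *
          fderiv ℝ f (graphShear e γ X) (e.symm (EuclideanSpace.single 1 1)) := by
  have h0 : HasFDerivAt (fun X : Plane => X 0) (EuclideanSpace.proj (𝕜 := ℝ) (0 : Fin 2)) X :=
    (EuclideanSpace.proj (𝕜 := ℝ) (0 : Fin 2)).hasFDerivAt
  have h1 := (hγ (X 0)).hasDerivAt.comp_hasFDerivAt X h0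
  have h2 := ((hasFDerivAt_id X).add
    (h1.smul_const (EuclideanSpace.single (1 : Fin 2) (1 : ℝ))))
  have h3 := (e.symm.toContinuousLinearEquiv.toContinuousLinearMap.hasFDerivAt).comp X h2
  have h4 := hf.hasFDerivAt.comp X h3
  rw [show (fun X => f (graphShear e γ X)) = f ∘ _ from rfl, h4.fderiv]
  simp [mul_assoc]

variable {Q : Set Plane} {φ : Plane → ℝ} {G : Fin 2 → Plane → ℝ}

/-- The gradient of `φ ∘ graphShear e γ` according to the chain rule. -/
def shearGrad (e : Plane ≃ₗᵢ[ℝ] Plane) (γ : ℝ → ℝ) (G : Fin 2 → Plane → ℝ) (β : Fin 2)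
    (X : Plane) : ℝ :=
  let u : Plane := e.symm (EuclideanSpace.single β 1)
  let v : Plane := e.symm (EuclideanSpace.single 1 1)
  (u 0 * G 0 (graphShear e γ X) + u 1 * G 1 (graphShear e γ X)) +
    deriv γ (X 0) * (EuclideanSpace.single β (1 : ℝ) : Plane) 0 *
      (v 0 * G 0 (graphShear e γ X) + v 1 * G 1 (graphShear e γ X))

theorem measurePreserving_restrict_graphShear (hγ : Continuous γ) (hQ : MeasurableSet Q) :
    MeasurePreserving (graphShear e γ) (volume.restrict Q)
      (volume.restrict (graphUnshear e γ ⁻¹' Q)) := by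
  have hm : MeasurableSet (graphUnshear e γ ⁻¹' Q) :=
    hQ.preimage (graphShearHomeomorph e hγ).symm.continuous.measurable
  have := (measurePreserving_graphShear (e := e) hγ).restrict_preimage hm
  rw [← preimage_comp] at this
  have hid : graphUnshear e γ ∘ graphShear e γ = id := funext graphUnshear_graphShear
  rwa [hid, preimage_id] at this

theorem setIntegral_comp_graphShear (hγ : Continuous γ) (hQ : MeasurableSet Q) (f : Plane → ℝ) :
    ∫ X in Q, f (graphShear e γ X) = ∫ Y in graphUnshear e γ ⁻¹' Q, f Y :=
  (measurePreserving_restrict_graphShear hγ hQ).integral_comp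
    (graphShearHomeomorph e hγ).measurableEmbedding f

theorem IsTestFunction.comp_graphUnshear (hγ : ContDiff ℝ 1 γ) {η : Plane → ℝ}
    (hη : IsTestFunction Q η) :
    IsTestFunction (graphUnshear e γ ⁻¹' Q) (fun Y => η (graphUnshear e γ Y)) := by
  have hts : tsupport (fun Y => η (graphUnshear e γ Y)) = graphUnshear e γ ⁻¹' tsupport η :=
    tsupport_comp_eq_preimage η (graphShearHomeomorph e hγ.continuous).symm
  refine ⟨hη.1.comp (contDiff_graphUnshear hγ),
    hη.2.1.comp_homeomorph (graphShearHomeomorph e hγ.continuous).symm, ?_⟩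
  rw [hts]
  exact preimage_mono hη.2.2

/-- The chain rule for weak gradients under a shear. -/
theorem HasWeakGrad.comp_graphShear (hγ : ContDiff ℝ 2 γ) (hQ : IsOpen Q)
    (h : HasWeakGrad (graphUnshear e γ ⁻¹' Q) φ G) {L : ℝ} (hL : ∀ X ∈ Q, |deriv γ (X 0)| ≤ L) :
    HasWeakGrad Q (fun X => φ (graphShear e γ X)) (shearGrad e γ G) := by
  have hγc : Continuous γ := hγ.continuous
  have hmp := measurePreserving_restrict_graphShear (e := e) hγc hQ.measurableSet
  set V := graphUnshear e γ ⁻¹' Q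
  have hVo : IsOpen V := hQ.preimage (graphShearHomeomorph e hγc).symm.continuous
  have hγ' : ContDiff ℝ 1 (deriv γ) := ((contDiff_succ_iff_deriv (n := 1)).1 hγ).2.2
  have hdir : ∀ v : Plane, MemLp (fun X => v 0 * G 0 (graphShear e γ X) +
      v 1 * G 1 (graphShear e γ X)) 2 (volume.restrict Q) := fun v =>
    (h.memLp_dir v).comp_measurePreserving hmp
  refine ⟨h.memLp.comp_measurePreserving hmp, fun β => ?_, fun β η hη => ?_⟩
  · refine (hdir _).add ((hdir _).bounded_mul
      (C := L * |(EuclideanSpace.single β (1 : ℝ) : Plane) 0|) ?_ ?_)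
    · exact (Continuous.mul (hγ'.continuous.comp (contDiff_plane_apply 0 (n := 0)).continuous)
        continuous_const).aestronglyMeasurable
    · filter_upwards [ae_restrict_mem hQ.measurableSet] with X hX
      rw [abs_mul]
      gcongr
      exact hL X hX
  · set k : ℝ := (EuclideanSpace.single β (1 : ℝ) : Plane) 0
    set u : Plane := e.symm (EuclideanSpace.single β 1) with hu
    set v : Plane := e.symm (EuclideanSpace.single 1 1) with hv
    set ζ : Plane → ℝ := fun Y => η (graphUnshear e γ Y) with hζdef
    have hζ : IsTestFunction V ζ := hη.comp_graphUnshear (hγ.of_le one_le_two)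
    -- The slope in the chain rule is absorbed into the test function, which has to stay `C¹`; this
    -- is where `γ` of class `C²` enters. As `c` depends only on the first coordinate of `e Y`, its
    -- derivative along `v` vanishes and the product rule leaves no extra term.
    set c : Plane → ℝ := fun Y => deriv γ (e Y 0) * k with hcdef
    have hc : ContDiff ℝ 1 c :=
      (hγ'.comp ((contDiff_plane_apply 0).comp e.contDiff)).mul contDiff_const
    have hcζ : IsTestFunction V fun Y => c Y * ζ Y := hζ.mul_left hVo hc.contDiffOn
    have hcX : ∀ X, c (graphShear e γ X) = deriv γ (X 0) * k := by
      intro X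
      simp [hcdef, graphShear]
    have hζX : ∀ X, ζ (graphShear e γ X) = η X := by
      intro X
      simp [hζdef, graphUnshear_graphShear]
    have hcv : ∀ Y, fderiv ℝ c Y v = 0 := by
      intro Y
      have h0 : HasFDerivAt (fun Y : Plane => e Y 0)
          ((EuclideanSpace.proj (𝕜 := ℝ) (0 : Fin 2)).comp
            e.toContinuousLinearEquiv.toContinuousLinearMap) Y :=
        ((EuclideanSpace.proj (𝕜 := ℝ) (0 : Fin 2)).comp
            e.toContinuousLinearEquiv.toContinuousLinearMap).hasFDerivAt
      have h1 := ((hγ'.differentiable one_ne_zero (e Y 0)).hasDerivAt.comp_hasFDerivAt Y h0).mul_const k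
      rw [show c = fun Y => (deriv γ ∘ fun Y : Plane => e Y 0) Y * k from rfl, h1.fderiv]
      simp [hv]
    have hL1 : ∫ X in Q, shearGrad e γ G β X * η X =
        ∫ Y in V, ((u 0 * G 0 Y + u 1 * G 1 Y) * ζ Y + (v 0 * G 0 Y + v 1 * G 1 Y) * (c Y * ζ Y)) := by
      rw [← setIntegral_comp_graphShear hγc hQ.measurableSet]
      congr 1
      ext X
      rw [hζX, hcX]
      simp only [shearGrad]
      ring
    have hR1 : ∫ X in Q, φ (graphShear e γ X) * fderiv ℝ η X (EuclideanSpace.single β 1) =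
        ∫ Y in V, (φ Y * fderiv ℝ ζ Y u + φ Y * fderiv ℝ (fun Y => c Y * ζ Y) Y v) := by
      rw [← setIntegral_comp_graphShear hγc hQ.measurableSet]
      congr 1
      ext X
      have hd := hζ.1.differentiable one_ne_zero (graphShear e γ X)
      have h1 := hasFDerivAt_graphShear_apply (e := e) (hγ.differentiable two_ne_zero) hd
        (EuclideanSpace.single β (1 : ℝ) : Plane)
      simp_rw [hζX] at h1
      rw [h1, fderiv_fun_mul (hc.differentiable one_ne_zero _) hd]
      simp only [add_apply, smul_apply, smul_eq_mul, hcv,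
        hcX]
      ring
    rw [hL1, hR1, integral_add ((h.memLp_dir u).integrable_mul_two (hζ.memLp _))
      ((h.memLp_dir v).integrable_mul_two (hcζ.memLp _)), h.integral_dir_eq hζ u,
      h.integral_dir_eq hcζ v, integral_add (h.memLp.integrable_mul_two (hζ.memLp_fderiv _ u))
      (h.memLp.integrable_mul_two (hcζ.memLp_fderiv _ v)), neg_add]

/-- Each of the two components is a derivative along a unit vector, plus another such derivative
times a factor of size at most `|L|`. Composition with the shear preserves their norms. -/
theorem HasWeakGrad.gradNorm_shearGrad_le (hγ : ContDiff ℝ 2 γ) (hQ : IsOpen Q)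
    (h : HasWeakGrad (graphUnshear e γ ⁻¹' Q) φ G) {L : ℝ} (hL : ∀ X ∈ Q, |deriv γ (X 0)| ≤ L) :
    gradNorm Q (shearGrad e γ G) ≤ 2 * (1 + |L|) * gradNorm (graphUnshear e γ ⁻¹' Q) G := by
  have hmp := measurePreserving_restrict_graphShear (e := e) hγ.continuous hQ.measurableSet
  set V := graphUnshear e γ ⁻¹' Q
  have hdir : ∀ v : Plane, MemLp (fun X => v 0 * G 0 (graphShear e γ X) +
      v 1 * G 1 (graphShear e γ X)) 2 (volume.restrict Q) := fun v =>
    (h.memLp_dir v).comp_measurePreserving hmp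
  have hdirn : ∀ β : Fin 2, (eLpNorm (fun X =>
      (e.symm (EuclideanSpace.single β (1 : ℝ)) : Plane) 0 * G 0 (graphShear e γ X) +
      (e.symm (EuclideanSpace.single β (1 : ℝ)) : Plane) 1 * G 1 (graphShear e γ X)) 2
        (volume.restrict Q)).toReal ≤ gradNorm V G := by
    intro β
    have h1 := h.eLpNorm_dir_le (e.symm (EuclideanSpace.single β (1 : ℝ)))
    rw [LinearIsometryEquiv.norm_map, PiLp.norm_single, norm_one, one_mul] at h1
    rwa [← eLpNorm_comp_measurePreserving (h.memLp_dir _).aestronglyMeasurable hmp] at h1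
  have hone : ∀ β, (eLpNorm (shearGrad e γ G β) 2 (volume.restrict Q)).toReal ≤
      (1 + |L|) * gradNorm V G := by
    intro β
    have h1 := hdir (e.symm (EuclideanSpace.single β (1 : ℝ)))
    have h2 := (hdir (e.symm (EuclideanSpace.single 1 (1 : ℝ)))).const_mul |L|
    set f₁ : Plane → ℝ := fun X =>
      (e.symm (EuclideanSpace.single β (1 : ℝ)) : Plane) 0 * G 0 (graphShear e γ X) +
      (e.symm (EuclideanSpace.single β (1 : ℝ)) : Plane) 1 * G 1 (graphShear e γ X)
    set f₂ : Plane → ℝ := fun X => |L| * ((e.symm (EuclideanSpace.single 1 (1 : ℝ)) : Plane) 0 *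
      G 0 (graphShear e γ X) + (e.symm (EuclideanSpace.single 1 (1 : ℝ)) : Plane) 1 *
      G 1 (graphShear e γ X))
    have h3 : eLpNorm (shearGrad e γ G β) 2 (volume.restrict Q) ≤
        eLpNorm (fun X => ‖f₁ X‖) 2 (volume.restrict Q) +
          eLpNorm (fun X => ‖f₂ X‖) 2 (volume.restrict Q) := by
      refine (eLpNorm_mono_ae_real (g := fun X => ‖f₁ X‖ + ‖f₂ X‖) ?_).trans
        (eLpNorm_add_le h1.norm.aestronglyMeasurable h2.norm.aestronglyMeasurable (by norm_num))
      filter_upwards [ae_restrict_mem hQ.measurableSet] with X hX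
      refine (norm_add_le _ _).trans ?_
      gcongr
      simp only [f₂, norm_mul, Real.norm_eq_abs, abs_abs]
      gcongr
      have hk : |(EuclideanSpace.single β (1 : ℝ) : Plane) 0| ≤ 1 := by
        fin_cases β <;> simp
      calc _ ≤ |L| * 1 :=
            mul_le_mul ((hL X hX).trans (le_abs_self L)) hk (abs_nonneg _) (abs_nonneg _)
        _ = |L| := mul_one _
    rw [eLpNorm_norm, eLpNorm_norm] at h3
    have h4 := ENNReal.toReal_mono (ENNReal.add_ne_top.2 ⟨h1.eLpNorm_ne_top, h2.eLpNorm_ne_top⟩) h3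
    rw [ENNReal.toReal_add h1.eLpNorm_ne_top h2.eLpNorm_ne_top] at h4
    have h5 : ∀ f : Plane → ℝ, (eLpNorm (fun X => |L| * f X) 2 (volume.restrict Q)).toReal =
        |L| * (eLpNorm f 2 (volume.restrict Q)).toReal := by
      intro f
      rw [show (fun X => |L| * f X) = |L| • f from rfl, eLpNorm_const_smul, ENNReal.toReal_mul]
      simp
    rw [h5] at h4
    have h6 := mul_le_mul_of_nonneg_left (hdirn 1) (abs_nonneg L)
    have h7 := hdirn β
    linarith
  rw [gradNorm, Fin.sum_univ_two]
  linarith [hone 0, hone 1]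

/-- The Poincaré inequality on the image of a convex set under a shear. -/
theorem poincareOn_graphUnshear_preimage (hγ : ContDiff ℝ 2 γ) (hQ : IsOpen Q)
    (hconv : Convex ℝ Q) (hne : Q.Nonempty) (hb : Bornology.IsBounded Q) :
    PoincareOn (graphUnshear e γ ⁻¹' Q) (graphUnshear e γ ⁻¹' Q) := by
  obtain ⟨C, hC, hP⟩ := poincareOn_of_convex hQ hconv hne hb
  have hγ' : ContDiff ℝ 1 (deriv γ) := ((contDiff_succ_iff_deriv (n := 1)).1 hγ).2.2
  have hcont : Continuous fun X : Plane => deriv γ (X 0) :=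
    hγ'.continuous.comp (contDiff_plane_apply 0 (n := 0)).continuous
  obtain ⟨L, hL⟩ := hb.isCompact_closure.exists_bound_of_continuousOn hcont.continuousOn
  have hL' : ∀ X ∈ Q, |deriv γ (X 0)| ≤ L := fun X hX => hL X (subset_closure hX)
  refine ⟨C * (2 * (1 + |L|)), by positivity, fun φ G h => ?_⟩
  have h1 := h.comp_graphShear hγ hQ hL'
  obtain ⟨c, hc⟩ := hP _ _ h1
  refine ⟨c, ?_⟩
  have hmp := measurePreserving_restrict_graphShear (e := e) hγ.continuous hQ.measurableSet
  have hm : AEStronglyMeasurable (fun X => φ X - c) (volume.restrict (graphUnshear e γ ⁻¹' Q)) :=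
    h.memLp.aestronglyMeasurable.sub aestronglyMeasurable_const
  rw [← eLpNorm_comp_measurePreserving hm hmp, mul_assoc]
  exact hc.trans (mul_le_mul_of_nonneg_left (h.gradNorm_shearGrad_le hγ hQ hL') hC)

/-- The Poincaré inequality near a boundary point. -/
theorem HasC2Boundary.exists_poincareOn {U : Set Plane} (hU : IsOpen U) (hC2 : HasC2Boundary U)
    {p : Plane} (hp : p ∈ frontier U) :
    ∃ N, IsOpen N ∧ p ∈ N ∧ PoincareOn U (N ∩ U) := by
  obtain ⟨r, hr, e, γ, hγ, hUγ⟩ := hC2 p hp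
  have hpU : p ∉ U := by
    rw [hU.frontier_eq] at hp
    exact hp.2
  -- The point lies on the graph: not above it, since `p ∉ U`, and not below it, as a limit of
  -- points of `U` near `p`.
  have hpγ : e p 1 = γ (e p 0) := by
    refine le_antisymm (not_lt.1 fun h => hpU ((hUγ p (Metric.mem_ball_self hr)).2 h)) ?_
    have hcl : p ∈ closure (Metric.ball p r ∩ U) :=
      Metric.isOpen_ball.inter_closure ⟨Metric.mem_ball_self hr, frontier_subset_closure hp⟩
    have hclosed : IsClosed {X : Plane | γ (e X 0) ≤ e X 1} :=
      isClosed_le (hγ.continuous.comp ((contDiff_plane_apply 0 (n := 0)).continuous.comp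
        e.continuous)) ((contDiff_plane_apply 1 (n := 0)).continuous.comp e.continuous)
    exact closure_minimal (fun X hX => ((hUγ X hX.1).1 hX.2).le) hclosed hcl
  have hSp1 : graphUnshear e γ p 1 = 0 := by simp [graphUnshear, hpγ]
  have hTcont : Continuous (graphShear e γ) := (contDiff_graphShear hγ).continuous
  have hScont : Continuous (graphUnshear e γ) := (contDiff_graphUnshear hγ).continuous
  have hnhds : graphShear e γ ⁻¹' Metric.ball p r ∈ 𝓝 (graphUnshear e γ p) :=
    hTcont.continuousAt.preimage_mem_nhds (by
      rw [graphShear_graphUnshear]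
      exact Metric.ball_mem_nhds p hr)
  obtain ⟨ρ, hρ, hball⟩ := Metric.mem_nhds_iff.1 hnhds
  set B := Metric.ball (graphUnshear e γ p) ρ
  -- In straightened coordinates `U` near `p` is the part of a small ball above the horizontal axis,
  -- which is convex. The radius is small enough for the ball to come from the one in which the
  -- graph description holds.
  set Q := B ∩ {X : Plane | 0 < X 1}
  have hc1 : Continuous fun X : Plane => X 1 := (contDiff_plane_apply 1 (n := 0)).continuous
  have hQo : IsOpen Q := Metric.isOpen_ball.inter (isOpen_lt continuous_const hc1)
  have hQconv : Convex ℝ Q := (convex_ball _ _).inter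
    ((convex_Ioi (0 : ℝ)).linear_preimage (EuclideanSpace.proj (𝕜 := ℝ) (1 : Fin 2)).toLinearMap)
  have hQne : Q.Nonempty := by
    refine ⟨graphUnshear e γ p + (ρ / 2) • EuclideanSpace.single 1 1, ?_, ?_⟩
    · rw [Metric.mem_ball, dist_eq_norm, add_sub_cancel_left, norm_smul]
      simp only [Real.norm_eq_abs, PiLp.norm_single, norm_one, mul_one]
      rw [abs_of_pos (by positivity)]
      linarith
    · simp only [mem_ofPred_eq, PiLp.add_apply, hSp1, PiLp.smul_apply]
      simp [hρ]
  have hQb : Bornology.IsBounded Q := Metric.isBounded_ball.subset inter_subset_left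
  have hpB : graphUnshear e γ p ∈ B := Metric.mem_ball_self hρ
  have hBo : IsOpen (graphUnshear e γ ⁻¹' B) := Metric.isOpen_ball.preimage hScont
  clear_value B
  have hVeq : graphUnshear e γ ⁻¹' B ∩ U = graphUnshear e γ ⁻¹' Q := by
    ext Y
    have hY : graphUnshear e γ Y ∈ B → Y ∈ Metric.ball p r := fun h => by
      simpa [graphShear_graphUnshear] using hball h
    have h1 : graphUnshear e γ Y 1 = e Y 1 - γ (e Y 0) := by simp [graphUnshear]
    constructor
    · rintro ⟨hYB, hYU⟩
      refine ⟨hYB, ?_⟩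
      rw [mem_ofPred_eq, h1, sub_pos]
      exact (hUγ Y (hY hYB)).1 hYU
    · rintro ⟨hYB, hY1⟩
      refine ⟨hYB, (hUγ Y (hY hYB)).2 ?_⟩
      rwa [mem_ofPred_eq, h1, sub_pos] at hY1
  have hsub : graphUnshear e γ ⁻¹' Q ⊆ U := by
    rw [← hVeq]
    exact inter_subset_right
  have hP : PoincareOn U (graphUnshear e γ ⁻¹' B ∩ U) := by
    rw [hVeq]
    exact (poincareOn_graphUnshear_preimage hγ hQo hQconv hQne hQb).mono hsub
  exact ⟨graphUnshear e γ ⁻¹' B, hBo, hpB, hP⟩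

/-- The Poincaré inequality on bounded domains with `C²` boundary. -/
theorem HasC2Boundary.poincareOn {U : Set Plane} (hC2 : HasC2Boundary U) (hU : IsOpen U)
    (hconn : IsConnected U) (hb : Bornology.IsBounded U) : PoincareOn U U := by
  refine poincareOn_of_local hU hconn hb fun p hp => ?_
  by_cases hpU : p ∈ U
  · obtain ⟨ρ, hρ, hball⟩ := Metric.isOpen_iff.1 hU p hpU
    refine ⟨Metric.ball p ρ, Metric.isOpen_ball, Metric.mem_ball_self hρ, ?_⟩
    rw [inter_eq_left.2 hball]
    exact (poincareOn_of_convex Metric.isOpen_ball (convex_ball p ρ)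
      ⟨p, Metric.mem_ball_self hρ⟩ Metric.isBounded_ball).mono hball
  · exact hC2.exists_poincareOn hU (by rw [hU.frontier_eq]; exact ⟨hp, hpU⟩)

end Shear

/-! ### Identities for the cross product -/

section CrossProduct

/-- Components of the cross product, with cyclic indices. -/
theorem crossProduct_apply_cyclic (u v : Fin 3 → ℝ) (j : Fin 3) :
    (u ⨯₃ v) j = u (j + 1) * v (j + 2) - u (j + 2) * v (j + 1) := by
  fin_cases j <;> simp [cross_apply]

/-- The cross product of two vectors orthogonal to the unit vector `n` is parallel to `n`. -/
theorem crossProduct_eq_mul_of_orthogonal {n u v : Fin 3 → ℝ} (hn : n ⬝ᵥ n = 1) (hu : n ⬝ᵥ u = 0)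
    (hv : n ⬝ᵥ v = 0) (j : Fin 3) : (u ⨯₃ v) j = n ⬝ᵥ (u ⨯₃ v) * n j := by
  simp only [dotProduct, Fin.sum_univ_three] at *
  fin_cases j
  · simp [cross_apply]
    linear_combination (-(u 1 * v 2 - u 2 * v 1)) * hn - (n 1 * u 2 - n 2 * u 1) * hv +
      (n 1 * v 2 - n 2 * v 1) * hu
  · simp [cross_apply]
    linear_combination (-(u 2 * v 0 - u 0 * v 2)) * hn - (n 2 * u 0 - n 0 * u 2) * hv +
      (n 2 * v 0 - n 0 * v 2) * hu
  · simp [cross_apply]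
    linear_combination (-(u 0 * v 1 - u 1 * v 0)) * hn - (n 0 * u 1 - n 1 * u 0) * hv +
      (n 0 * v 1 - n 1 * v 0) * hu

end CrossProduct

/-! ### Geometry of the parametrization and the divergence form of the surface derivative -/

namespace SurfaceWithBoundary

open Filter Topology

variable (Γ : SurfaceWithBoundary)

/-- The vector `𝔤₁ × 𝔤₂`. -/
def crossTangent (X : Plane) : Space :=
  WithLp.toLp 2 ((Γ.tangent 0 X).ofLp ⨯₃ (Γ.tangent 1 X).ofLp)

/-- The area density `|𝔤₁ × 𝔤₂|`. -/
def areaDensity (X : Plane) : ℝ := ‖Γ.crossTangent X‖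

theorem normal_eq (X : Plane) : Γ.normal X = (Γ.areaDensity X)⁻¹ • Γ.crossTangent X := rfl

variable {Γ} {X : Plane}

theorem closure_mem_nhds (hX : X ∈ Γ.domain) : closure Γ.domain ∈ 𝓝 X :=
  mem_of_superset (Γ.isOpen_domain.mem_nhds hX) subset_closure

theorem pderiv_eq_fderiv {V : Type*} [NormedAddCommGroup V] [NormedSpace ℝ V] (α : Fin 2)
    (f : Plane → V) (hX : X ∈ Γ.domain) :
    Γ.pderiv α f X = fderiv ℝ f X (EuclideanSpace.single α 1) := by
  rw [pderiv, pderivOn, fderivWithin_of_mem_nhds (closure_mem_nhds hX)]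

theorem contDiffAt_param (hX : X ∈ Γ.domain) : ContDiffAt ℝ 2 Γ.param X :=
  Γ.contDiffOn_param.contDiffAt (closure_mem_nhds hX)

theorem tangent_eq_fderiv (α : Fin 2) (hX : X ∈ Γ.domain) :
    Γ.tangent α X = fderiv ℝ Γ.param X (EuclideanSpace.single α 1) :=
  pderiv_eq_fderiv α _ hX

theorem contDiffOn_tangent (α : Fin 2) : ContDiffOn ℝ 1 (Γ.tangent α) Γ.domain := by
  have h1 : ContDiffOn ℝ 1 (fun X => fderiv ℝ Γ.param X (EuclideanSpace.single α 1)) Γ.domain :=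
    ((Γ.contDiffOn_param.mono subset_closure).fderiv_of_isOpen Γ.isOpen_domain
      (by norm_num)).clm_apply contDiffOn_const
  exact h1.congr fun X hX => tangent_eq_fderiv α hX

theorem contDiffOn_tangent_apply (α : Fin 2) (j : Fin 3) :
    ContDiffOn ℝ 1 (fun X => Γ.tangent α X j) Γ.domain :=
  (EuclideanSpace.proj (𝕜 := ℝ) j).contDiff.comp_contDiffOn (contDiffOn_tangent α)

theorem crossTangent_apply (j : Fin 3) (X : Plane) : Γ.crossTangent X j =
    Γ.tangent 0 X (j + 1) * Γ.tangent 1 X (j + 2) - Γ.tangent 0 X (j + 2) * Γ.tangent 1 X (j + 1) :=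
  crossProduct_apply_cyclic _ _ j

theorem contDiffOn_crossTangent : ContDiffOn ℝ 1 Γ.crossTangent Γ.domain := by
  rw [contDiffOn_euclidean]
  intro j
  simp_rw [crossTangent_apply]
  exact ((contDiffOn_tangent_apply _ _).mul (contDiffOn_tangent_apply _ _)).sub
    ((contDiffOn_tangent_apply _ _).mul (contDiffOn_tangent_apply _ _))

theorem areaDensity_nonneg (X : Plane) : 0 ≤ Γ.areaDensity X := norm_nonneg _

theorem areaDensity_sq (X : Plane) : Γ.areaDensity X ^ 2 =
    (Γ.tangent 0 X 1 * Γ.tangent 1 X 2 - Γ.tangent 0 X 2 * Γ.tangent 1 X 1) ^ 2 +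
    (Γ.tangent 0 X 2 * Γ.tangent 1 X 0 - Γ.tangent 0 X 0 * Γ.tangent 1 X 2) ^ 2 +
    (Γ.tangent 0 X 0 * Γ.tangent 1 X 1 - Γ.tangent 0 X 1 * Γ.tangent 1 X 0) ^ 2 := by
  rw [areaDensity, EuclideanSpace.norm_sq_eq, Fin.sum_univ_three]
  simp only [crossTangent_apply, Real.norm_eq_abs, sq_abs]
  rfl

/-- The left side of the nondegeneracy condition is `|𝔤₁ × 𝔤₂|²`, up to the sign of one component
inside a square. -/
theorem exists_le_areaDensity :
    ∃ lam > 0, ∀ X ∈ closure Γ.domain, lam ≤ Γ.areaDensity X := by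
  obtain ⟨lam, hlam, h⟩ := Γ.nondegenerate
  refine ⟨lam, hlam, fun X hX => ?_⟩
  have h1 := h X hX
  refine le_of_sq_le_sq ?_ (norm_nonneg _)
  rw [areaDensity_sq]
  refine h1.trans (le_of_eq ?_)
  simp only [tangent, pderiv]
  ring

theorem areaDensity_pos (hX : X ∈ Γ.domain) : 0 < Γ.areaDensity X := by
  obtain ⟨lam, hlam, h⟩ := Γ.exists_le_areaDensity
  exact hlam.trans_le (h X (subset_closure hX))

theorem contDiffOn_areaDensity : ContDiffOn ℝ 1 Γ.areaDensity Γ.domain :=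
  contDiffOn_crossTangent.norm ℝ fun _ hX => norm_pos_iff.1 (areaDensity_pos hX)

theorem normal_apply (j : Fin 3) (X : Plane) :
    Γ.normal X j = (Γ.areaDensity X)⁻¹ * Γ.crossTangent X j := by
  simp [normal_eq]

theorem contDiffOn_normal_apply (j : Fin 3) :
    ContDiffOn ℝ 1 (fun X => Γ.normal X j) Γ.domain := by
  simp_rw [normal_apply]
  exact (contDiffOn_areaDensity.inv fun X hX => (areaDensity_pos hX).ne').mul
    ((EuclideanSpace.proj (𝕜 := ℝ) j).contDiff.comp_contDiffOn contDiffOn_crossTangent)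

theorem hasStrictFDerivAt_param (hX : X ∈ Γ.domain) :
    HasStrictFDerivAt Γ.param (fderiv ℝ Γ.param X) X :=
  (contDiffAt_param hX).hasStrictFDerivAt two_ne_zero

/-- Lagrange's identity: the Gram determinant `|𝔤₁|² |𝔤₂|² - (𝔤₁ · 𝔤₂)²` is `|𝔤₁ × 𝔤₂|²`. -/
theorem areaDensity_eq_normDet (hX : X ∈ Γ.domain) :
    Γ.areaDensity X = (fderiv ℝ Γ.param X).toLinearMap.normDet := by
  have h1 := (fderiv ℝ Γ.param X).toLinearMap.normDet_sq_eq_det_gram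
    (EuclideanSpace.basisFun (Fin 2) ℝ)
  rw [← sq_eq_sq₀ (areaDensity_nonneg _) (LinearMap.normDet_nonneg _)]
  refine Eq.trans ?_ h1.symm
  rw [Matrix.det_fin_two, areaDensity_sq]
  simp only [Matrix.gram_apply, EuclideanSpace.basisFun_apply, ContinuousLinearMap.coe_coe,
    ← tangent_eq_fderiv _ hX, PiLp.inner_apply, Fin.sum_univ_three, RCLike.inner_apply, conj_trivial]
  ring

theorem injective_fderiv_param (hX : X ∈ Γ.domain) : Function.Injective (fderiv ℝ Γ.param X) := by
  refine ((fderiv ℝ Γ.param X).toLinearMap.normDet_ne_zero_tfae.out 0 4).1 ?_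
  rw [← areaDensity_eq_normDet hX]
  exact (areaDensity_pos hX).ne'

/-- The vector fields `𝔤₂ × n` and `n × 𝔤₁`, which are `|𝔤₁ × 𝔤₂|` times the dual basis of
`𝔤₁, 𝔤₂`. -/
def conormal (Γ : SurfaceWithBoundary) (β : Fin 2) (X : Plane) : Fin 3 → ℝ :=
  if β = 0 then (Γ.tangent 1 X).ofLp ⨯₃ (Γ.normal X).ofLp
  else (Γ.normal X).ofLp ⨯₃ (Γ.tangent 0 X).ofLp

theorem conormal_zero (j : Fin 3) (X : Plane) : Γ.conormal 0 X j =
    Γ.tangent 1 X (j + 1) * Γ.normal X (j + 2) - Γ.tangent 1 X (j + 2) * Γ.normal X (j + 1) :=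
  crossProduct_apply_cyclic _ _ j

theorem conormal_one (j : Fin 3) (X : Plane) : Γ.conormal 1 X j =
    Γ.normal X (j + 1) * Γ.tangent 0 X (j + 2) - Γ.normal X (j + 2) * Γ.tangent 0 X (j + 1) :=
  crossProduct_apply_cyclic _ _ j

theorem contDiffOn_conormal (β : Fin 2) (j : Fin 3) :
    ContDiffOn ℝ 1 (fun X => Γ.conormal β X j) Γ.domain := by
  fin_cases β
  · exact (((contDiffOn_tangent_apply _ _).mul (contDiffOn_normal_apply _)).sub
      ((contDiffOn_tangent_apply _ _).mul (contDiffOn_normal_apply _))).congr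
      fun X _ => conormal_zero j X
  · exact (((contDiffOn_normal_apply _).mul (contDiffOn_tangent_apply _ _)).sub
      ((contDiffOn_normal_apply _).mul (contDiffOn_tangent_apply _ _))).congr
      fun X _ => conormal_one j X

theorem det_metric (X : Plane) : (Γ.metric X).det = Γ.areaDensity X ^ 2 := by
  rw [Matrix.det_fin_two, areaDensity_sq]
  simp only [metric, Matrix.of_apply, PiLp.inner_apply, Fin.sum_univ_three, RCLike.inner_apply,
    conj_trivial]
  ring

/-- Raising the index of the tangent frame gives the dual basis of the tangent plane. Cramer's
formula, with `det_metric` for the determinant, identifies it with the conormal fields divided by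
the density. -/
theorem areaDensity_mul_sum_metric_inv (hX : X ∈ Γ.domain) (β : Fin 2) (j : Fin 3) :
    Γ.areaDensity X * ∑ α, (Γ.metric X)⁻¹ α β * Γ.tangent α X j = Γ.conormal β X j := by
  have hJ := (areaDensity_pos hX).ne'
  rw [Matrix.inv_def, det_metric, Matrix.adjugate_fin_two]
  simp only [Fin.sum_univ_two, Ring.inverse_eq_inv']
  fin_cases β <;> fin_cases j <;>
  · simp [conormal, cross_apply, normal_apply, crossTangent, metric, PiLp.inner_apply,
      Fin.sum_univ_three]
    field_simp
    ring

/-- The surface derivative in divergence form. -/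
theorem areaDensity_mul_surfDeriv (hX : X ∈ Γ.domain) (j : Fin 3) (φ : Plane → ℝ) :
    Γ.areaDensity X * Γ.surfDeriv j φ X =
      ∑ β, Γ.conormal β X j * fderiv ℝ φ X (EuclideanSpace.single β 1) := by
  simp_rw [← areaDensity_mul_sum_metric_inv hX, surfDeriv, pderiv_eq_fderiv _ _ hX]
  rw [Finset.sum_comm]
  simp_rw [Finset.mul_sum, Finset.sum_mul]
  refine Finset.sum_congr rfl fun β _ => Finset.sum_congr rfl fun α _ => ?_
  ring

theorem normal_dotProduct_normal (hX : X ∈ Γ.domain) :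
    (Γ.normal X).ofLp ⬝ᵥ (Γ.normal X).ofLp = 1 := by
  have h1 : ‖Γ.normal X‖ = 1 := by
    rw [normal_eq, norm_smul, norm_inv, Real.norm_of_nonneg (areaDensity_nonneg X)]
    exact inv_mul_cancel₀ (areaDensity_pos hX).ne'
  have h2 : ‖Γ.normal X‖ ^ 2 = 1 := by rw [h1, one_pow]
  rw [EuclideanSpace.norm_sq_eq] at h2
  simpa [dotProduct, sq] using h2

theorem normal_dotProduct_tangent (α : Fin 2) (X : Plane) :
    (Γ.normal X).ofLp ⬝ᵥ (Γ.tangent α X).ofLp = 0 := by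
  have h1 : (Γ.normal X).ofLp = (Γ.areaDensity X)⁻¹ • (Γ.crossTangent X).ofLp := by
    rw [normal_eq]
    rfl
  rw [h1, smul_dotProduct, crossTangent, dotProduct_comm]
  fin_cases α
  · simp [dot_self_cross]
  · simp [dot_cross_self]

theorem differentiableAt_of_contDiffOn {f : Plane → ℝ} (hf : ContDiffOn ℝ 1 f Γ.domain)
    (hX : X ∈ Γ.domain) : DifferentiableAt ℝ f X :=
  (hf.differentiableOn one_ne_zero).differentiableAt (Γ.isOpen_domain.mem_nhds hX)

/-- Differentiating `|n|² = 1` shows that the derivatives of the normal are tangential. -/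
theorem normal_dotProduct_fderiv_normal (hX : X ∈ Γ.domain) (v : Plane) :
    (Γ.normal X).ofLp ⬝ᵥ (fun j => fderiv ℝ (fun Y => Γ.normal Y j) X v) = 0 := by
  have hd : ∀ j : Fin 3, HasFDerivAt (fun Y => Γ.normal Y j)
      (fderiv ℝ (fun Y => Γ.normal Y j) X) X := fun j =>
    (differentiableAt_of_contDiffOn (contDiffOn_normal_apply j) hX).hasFDerivAt
  have h1 : HasFDerivAt (fun Y => Γ.normal Y 0 * Γ.normal Y 0 + Γ.normal Y 1 * Γ.normal Y 1 +
      Γ.normal Y 2 * Γ.normal Y 2) _ X :=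
    (((hd 0).mul (hd 0)).add ((hd 1).mul (hd 1))).add ((hd 2).mul (hd 2))
  have h2 : (fun Y => Γ.normal Y 0 * Γ.normal Y 0 + Γ.normal Y 1 * Γ.normal Y 1 +
      Γ.normal Y 2 * Γ.normal Y 2) =ᶠ[𝓝 X] fun _ => 1 := by
    filter_upwards [Γ.isOpen_domain.mem_nhds hX] with Y hY
    have := normal_dotProduct_normal hY
    rwa [dotProduct, Fin.sum_univ_three] at this
  have h3 := congrArg (fun L => L v) ((h1.congr_of_eventuallyEq h2.symm).unique
    (hasFDerivAt_const 1 X))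
  simp at h3
  rw [dotProduct, Fin.sum_univ_three]
  linarith

/-- The second derivatives of the parametrization commute. -/
theorem fderiv_tangent_comm (hX : X ∈ Γ.domain) (j : Fin 3) :
    fderiv ℝ (fun Y => Γ.tangent 1 Y j) X (EuclideanSpace.single 0 1) =
      fderiv ℝ (fun Y => Γ.tangent 0 Y j) X (EuclideanSpace.single 1 1) := by
  have hsymm : IsSymmSndFDerivAt ℝ Γ.param X :=
    (contDiffAt_param hX).isSymmSndFDerivAt (by simp)
  have hdiff : DifferentiableAt ℝ (fderiv ℝ Γ.param) X :=
    ((contDiffAt_param hX).fderiv_right (m := 1) (by norm_num)).differentiableAt one_ne_zero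
  have h1 : ∀ (α : Fin 2) (v : Plane), fderiv ℝ (fun Y => Γ.tangent α Y j) X v =
      (fderiv ℝ (fderiv ℝ Γ.param) X v (EuclideanSpace.single α 1)) j := by
    intro α v
    have h2 : (fun Y => Γ.tangent α Y j) =ᶠ[𝓝 X]
        fun Y => (EuclideanSpace.proj (𝕜 := ℝ) j : Space →L[ℝ] ℝ)
          (fderiv ℝ Γ.param Y (EuclideanSpace.single α 1)) := by
      filter_upwards [Γ.isOpen_domain.mem_nhds hX] with Y hY
      rw [tangent_eq_fderiv α hY]
      rfl
    have h3 := (EuclideanSpace.proj (𝕜 := ℝ) j : Space →L[ℝ] ℝ).hasFDerivAt.comp X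
      (hdiff.hasFDerivAt.clm_apply (hasFDerivAt_const (EuclideanSpace.single α (1 : ℝ) : Plane) X))
    rw [h2.fderiv_eq, show (fun Y => (EuclideanSpace.proj (𝕜 := ℝ) j : Space →L[ℝ] ℝ)
          (fderiv ℝ Γ.param Y (EuclideanSpace.single α 1))) = _ ∘ _ from rfl, h3.fderiv]
    simp
  rw [h1, h1, hsymm]

theorem areaDensity_mul_meanCurv (hX : X ∈ Γ.domain) : Γ.areaDensity X * Γ.meanCurv X =
    - ∑ j, ∑ β, Γ.conormal β X j *
      fderiv ℝ (fun Y => Γ.normal Y j) X (EuclideanSpace.single β 1) := by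
  rw [meanCurv, mul_neg, Finset.mul_sum]
  simp_rw [areaDensity_mul_surfDeriv hX]

/-- The divergence of the conormal fields is the mean curvature vector. -/
theorem sum_fderiv_conormal (hX : X ∈ Γ.domain) (j : Fin 3) :
    ∑ β, fderiv ℝ (fun Y => Γ.conormal β Y j) X (EuclideanSpace.single β 1) =
      Γ.areaDensity X * Γ.meanCurv X * Γ.normal X j := by
  have hn : ∀ j : Fin 3, HasFDerivAt (fun Y => Γ.normal Y j)
      (fderiv ℝ (fun Y => Γ.normal Y j) X) X := fun j =>
    (differentiableAt_of_contDiffOn (contDiffOn_normal_apply j) hX).hasFDerivAt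
  have ht : ∀ (α : Fin 2) (j : Fin 3), HasFDerivAt (fun Y => Γ.tangent α Y j)
      (fderiv ℝ (fun Y => Γ.tangent α Y j) X) X := fun α j =>
    (differentiableAt_of_contDiffOn (contDiffOn_tangent_apply α j) hX).hasFDerivAt
  have h0 := (((ht 1 (j + 1)).mul (hn (j + 2))).sub
    ((ht 1 (j + 2)).mul (hn (j + 1)))).congr_of_eventuallyEq
      (Eventually.of_forall (conormal_zero j))
  have h1 := (((hn (j + 1)).mul (ht 0 (j + 2))).sub
    ((hn (j + 2)).mul (ht 0 (j + 1)))).congr_of_eventuallyEq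
      (Eventually.of_forall (conormal_one j))
  set p : Fin 3 → ℝ := fun j => fderiv ℝ (fun Y => Γ.normal Y j) X (EuclideanSpace.single 0 1)
    with hp
  set q : Fin 3 → ℝ := fun j => fderiv ℝ (fun Y => Γ.normal Y j) X (EuclideanSpace.single 1 1)
    with hq
  -- In `∂₁(𝔤₂ × n) + ∂₂(n × 𝔤₁)` the second derivatives of the parametrization cancel by symmetry,
  -- leaving `𝔤₂ × ∂₁n - 𝔤₁ × ∂₂n`. All four factors are orthogonal to `n`, so this is a multiple of
  -- `n`, and its normal component is `J H_Γ`.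
  have hc1 := fderiv_tangent_comm hX (j + 1)
  have hc2 := fderiv_tangent_comm hX (j + 2)
  have hnn := normal_dotProduct_normal hX
  have hna := normal_dotProduct_tangent (Γ := Γ) 0 X
  have hnb := normal_dotProduct_tangent (Γ := Γ) 1 X
  have hnp := normal_dotProduct_fderiv_normal hX (EuclideanSpace.single 0 1)
  have hnq := normal_dotProduct_fderiv_normal hX (EuclideanSpace.single 1 1)
  have hbp := crossProduct_eq_mul_of_orthogonal hnn hnb hnp j
  have haq := crossProduct_eq_mul_of_orthogonal hnn hna hnq j
  have hH : Γ.areaDensity X * Γ.meanCurv X =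
      (Γ.normal X).ofLp ⬝ᵥ ((Γ.tangent 1 X).ofLp ⨯₃ p) -
      (Γ.normal X).ofLp ⬝ᵥ ((Γ.tangent 0 X).ofLp ⨯₃ q) := by
    rw [areaDensity_mul_meanCurv hX]
    simp only [Fin.sum_univ_three, Fin.sum_univ_two, conormal, dotProduct, cross_apply, hp, hq]
    simp
    ring
  rw [hH, sub_mul, ← hbp, ← haq, crossProduct_apply_cyclic, crossProduct_apply_cyclic,
    Fin.sum_univ_two, h0.fderiv, h1.fderiv]
  simp only [sub_apply, add_apply, smul_apply, smul_eq_mul, hc1, hc2]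
  ring

/-- The integrand of the integration by parts formula in divergence form. -/
theorem areaDensity_mul_surfDeriv_add (hX : X ∈ Γ.domain) (j : Fin 3) {η : Plane → ℝ}
    (hη : DifferentiableAt ℝ η X) :
    Γ.areaDensity X * (Γ.surfDeriv j η X + Γ.meanCurv X * Γ.normal X j * η X) =
      ∑ β, fderiv ℝ (fun Y => Γ.conormal β Y j * η Y) X (EuclideanSpace.single β 1) := by
  have h1 : ∀ β : Fin 2, fderiv ℝ (fun Y => Γ.conormal β Y j * η Y) X
      (EuclideanSpace.single β 1) = Γ.conormal β X j * fderiv ℝ η X (EuclideanSpace.single β 1) +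
        fderiv ℝ (fun Y => Γ.conormal β Y j) X (EuclideanSpace.single β 1) * η X := by
    intro β
    rw [fderiv_fun_mul (differentiableAt_of_contDiffOn (contDiffOn_conormal β j) hX) hη]
    simp only [add_apply, smul_apply, smul_eq_mul]
    ring
  simp_rw [h1]
  rw [Finset.sum_add_distrib, ← Finset.sum_mul, sum_fderiv_conormal hX,
    ← areaDensity_mul_surfDeriv hX]
  ring

/-- The tangent vectors are bounded. -/
theorem exists_norm_tangent_le : ∃ M : ℝ, ∀ X ∈ Γ.domain, ∀ α, ‖Γ.tangent α X‖ ≤ M := by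
  -- Being `C¹` within the closure provides, near each of its points, a derivative field continuous
  -- at that point and hence bounded nearby. At points of the domain it is the ordinary derivative.
  -- Compactness of the closure makes the bound uniform.
  have hloc : ∀ x ∈ closure Γ.domain, ∃ O ∈ 𝓝 x, ∃ M : ℝ, ∀ X ∈ O ∩ Γ.domain,
      ‖fderiv ℝ Γ.param X‖ ≤ M := by
    intro x hx
    have h1 := (Γ.contDiffOn_param x hx).of_le (one_le_two : (1 : WithTop ℕ∞) ≤ 2)
    obtain ⟨u, hu, -, -, f', hf', hcont⟩ := (contDiffWithinAt_succ_iff_hasFDerivWithinAt' (n := 0)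
      (by simp)).1 (by simpa using h1)
    rw [insert_eq_of_mem hx] at hu
    have hlt : {y | ‖f' y‖ < ‖f' x‖ + 1} ∈ 𝓝[closure Γ.domain] x :=
      hcont.continuousWithinAt.norm.eventually_lt continuousWithinAt_const (by simp)
    obtain ⟨O, hO, hOs⟩ := mem_nhdsWithin_iff_exists_mem_nhds_inter.1 (inter_mem hu hlt)
    refine ⟨O, hO, ‖f' x‖ + 1, fun X hX => ?_⟩
    obtain ⟨hXu, hXlt⟩ := hOs ⟨hX.1, subset_closure hX.2⟩
    rw [((hf' X hXu).hasFDerivAt (closure_mem_nhds hX.2)).fderiv]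
    exact le_of_lt hXlt
  choose! O hO M hM using hloc
  obtain ⟨t, ht, hcov⟩ := Γ.isBounded_domain.isCompact_closure.elim_nhds_subcover O hO
  refine ⟨∑ x ∈ t, |M x|, fun X hX α => ?_⟩
  obtain ⟨x, hx, hXx⟩ := mem_iUnion₂.1 (hcov (subset_closure hX))
  rw [tangent_eq_fderiv α hX]
  refine ((fderiv ℝ Γ.param X).le_opNorm _).trans ?_
  rw [PiLp.norm_single, norm_one, mul_one]
  refine (hM x (ht x hx) X ⟨hXx, hX⟩).trans ((le_abs_self _).trans ?_)
  exact Finset.single_le_sum (f := fun x => |M x|) (fun _ _ => abs_nonneg _) hx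

end SurfaceWithBoundary

/-! ### The Lax–Milgram argument on a closed graph -/

section WeakSolutions

/-- A linear functional of the first component of a closed space of vectors whose other components
control the first one is represented by the inner product of the other components. -/
theorem exists_sum_inner_succ_eq {H : Type*} [NormedAddCommGroup H] [InnerProductSpace ℝ H]
    [CompleteSpace H] {n : ℕ} (K : Submodule ℝ (PiLp 2 fun _ : Fin (n + 1) => H))
    (hK : IsClosed (K : Set (PiLp 2 fun _ : Fin (n + 1) => H))) {C : ℝ}
    (hC : ∀ p ∈ K, ‖p 0‖ ^ 2 ≤ C * ∑ j : Fin n, ‖p j.succ‖ ^ 2) (F : H) :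
    ∃ v ∈ K, ∀ q ∈ K, ∑ j : Fin n, inner ℝ (v j.succ) (q j.succ) = inner ℝ F (q 0) := by
  have : CompleteSpace K := hK.completeSpace_coe
  let π : Fin (n + 1) → K →L[ℝ] H := fun i => (PiLp.proj 2 (fun _ => H) i).comp K.subtypeL
  let B : K →L[ℝ] K →L[ℝ] ℝ := ∑ j : Fin n, (innerSL ℝ).bilinearComp (π j.succ) (π j.succ)
  have hB : ∀ p q : K, B p q = ∑ j : Fin n, inner ℝ (p.1 j.succ) (q.1 j.succ) := by
    intro p q
    simp [B, π]
  -- The form omits component `0`, which the hypothesis controls by the others, so `‖p‖² ≤ (|C| + 1)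
  -- B p p`. The absolute value is there because `C` carries no sign condition.
  have hcoer : IsCoercive B := by
    refine ⟨(|C| + 1)⁻¹, by positivity, fun p => ?_⟩
    rw [hB]
    simp_rw [real_inner_self_eq_norm_sq]
    have h1 : ‖p‖ * ‖p‖ = ‖p.1 0‖ ^ 2 + ∑ j : Fin n, ‖p.1 j.succ‖ ^ 2 := by
      rw [← sq, Submodule.coe_norm, PiLp.norm_sq_eq_of_L2, Fin.sum_univ_succ]
    have h0 : 0 ≤ ∑ j : Fin n, ‖p.1 j.succ‖ ^ 2 := Finset.sum_nonneg fun _ _ => by positivity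
    have h2 := hC p.1 p.2
    have h3 : C * ∑ j : Fin n, ‖p.1 j.succ‖ ^ 2 ≤ |C| * ∑ j : Fin n, ‖p.1 j.succ‖ ^ 2 := by
      gcongr
      exact le_abs_self C
    rw [mul_assoc, h1, inv_mul_le_iff₀ (by positivity)]
    linarith
  let ℓ : StrongDual ℝ K := (innerSL ℝ F).comp (π 0)
  let r : K := (InnerProductSpace.toDual ℝ K).symm ℓ
  obtain ⟨v, hv⟩ := hcoer.continuousLinearEquivOfBilin.surjective r
  refine ⟨v.1, v.2, fun q hq => ?_⟩
  have h1 := hcoer.continuousLinearEquivOfBilin_apply v ⟨q, hq⟩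
  rw [hv, hB, InnerProductSpace.toDual_symm_apply] at h1
  rw [← h1]
  rfl

end WeakSolutions

/-! ### Comparison of `L²` on the surface and in the parameter -/

namespace SurfaceWithBoundary

open Filter Topology
open scoped ENNReal NNReal

variable (Γ : SurfaceWithBoundary)

/-- The area measure, in the parameter. -/
def paramArea : Measure Plane :=
  (volume.restrict Γ.domain).withDensity fun X => ENNReal.ofReal (Γ.areaDensity X)

variable {Γ} {X : Plane}

theorem injOn_param : InjOn Γ.param (closure Γ.domain) := Γ.bijOn_param.injOn

theorem chart_param (hX : X ∈ Γ.domain) : Γ.chart (Γ.param X) = X :=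
  injOn_param.leftInvOn_invFunOn (subset_closure hX)

theorem area_eq : Γ.area = (μHE[Module.finrank ℝ Plane]).restrict (Γ.param '' Γ.domain) := by
  rw [area, carrier]
  simp

theorem measurePreserving_param :
    MeasurePreserving (Γ.domain.indicator Γ.param) Γ.paramArea Γ.area := by
  rw [area_eq]
  exact measurePreserving_indicator_of_immersion Γ.isOpen_domain.measurableSet
    (fun X hX => hasStrictFDerivAt_param hX) (fun X hX => injective_fderiv_param hX)
    (injOn_param.mono subset_closure)
    (fun X hX => (contDiffOn_areaDensity.contDiffAt (Γ.isOpen_domain.mem_nhds hX)).continuousAt)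
    (fun X hX => areaDensity_eq_normDet hX)

theorem measurePreserving_chart :
    MeasurePreserving (Γ.carrier.indicator Γ.chart) Γ.area Γ.paramArea := by
  rw [area_eq]
  exact measurePreserving_indicator_inverse_of_immersion Γ.isOpen_domain.measurableSet
    (fun X hX => hasStrictFDerivAt_param hX) (fun X hX => injective_fderiv_param hX)
    (fun X hX => chart_param hX)
    (fun X hX => (contDiffOn_areaDensity.contDiffAt (Γ.isOpen_domain.mem_nhds hX)).continuousAt)
    (fun X hX => areaDensity_eq_normDet hX)

theorem measurableSet_carrier : MeasurableSet Γ.carrier :=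
  Γ.isOpen_domain.measurableSet.image_of_continuousOn_injOn
    (Γ.contDiffOn_param.continuousOn.mono subset_closure) (injOn_param.mono subset_closure)

theorem ae_mem_carrier : ∀ᵐ x ∂Γ.area, x ∈ Γ.carrier := ae_restrict_mem measurableSet_carrier

theorem aemeasurable_areaDensity : AEMeasurable Γ.areaDensity (volume.restrict Γ.domain) :=
  contDiffOn_areaDensity.continuousOn.aemeasurable Γ.isOpen_domain.measurableSet

theorem ae_mem_domain : ∀ᵐ X ∂(volume.restrict Γ.domain), X ∈ Γ.domain :=
  ae_restrict_mem Γ.isOpen_domain.measurableSet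

theorem paramArea_absolutelyContinuous : Γ.paramArea ≪ volume.restrict Γ.domain :=
  withDensity_absolutelyContinuous _ _

theorem absolutelyContinuous_paramArea : volume.restrict Γ.domain ≪ Γ.paramArea := by
  refine withDensity_absolutelyContinuous' aemeasurable_areaDensity.ennreal_ofReal ?_
  filter_upwards [ae_mem_domain] with X hX
  simpa using areaDensity_pos hX

/-- By Lagrange's identity `|𝔤₁ × 𝔤₂| ≤ |𝔤₁| |𝔤₂|`, and the tangent vectors are bounded. -/
theorem exists_areaDensity_le : ∃ M : ℝ≥0, ∀ X ∈ Γ.domain, Γ.areaDensity X ≤ M := by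
  obtain ⟨M, hM⟩ := Γ.exists_norm_tangent_le
  refine ⟨⟨|M| * |M|, by positivity⟩, fun X hX => ?_⟩
  refine le_of_sq_le_sq (b := |M| * |M|) ?_ (by positivity)
  have h0 := (hM X hX 0).trans (le_abs_self M)
  have h1 := (hM X hX 1).trans (le_abs_self M)
  calc Γ.areaDensity X ^ 2 ≤ ‖Γ.tangent 0 X‖ ^ 2 * ‖Γ.tangent 1 X‖ ^ 2 := by
        rw [areaDensity_sq, EuclideanSpace.norm_sq_eq, EuclideanSpace.norm_sq_eq,
          Fin.sum_univ_three, Fin.sum_univ_three]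
        simp only [Real.norm_eq_abs, sq_abs]
        nlinarith [sq_nonneg (Γ.tangent 0 X 0 * Γ.tangent 1 X 0 +
          Γ.tangent 0 X 1 * Γ.tangent 1 X 1 + Γ.tangent 0 X 2 * Γ.tangent 1 X 2)]
    _ ≤ |M| ^ 2 * |M| ^ 2 := by gcongr
    _ = _ := by ring

/-- Together with `exists_le_paramArea`, this makes pulling back to the parameter an operation with
two-sided bounds on `L²` norms. -/
theorem exists_paramArea_le :
    ∃ c : ℝ≥0∞, c ≠ ∞ ∧ Γ.paramArea ≤ c • volume.restrict Γ.domain := by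
  obtain ⟨M, hM⟩ := Γ.exists_areaDensity_le
  refine ⟨M, ENNReal.coe_ne_top, Measure.le_iff.2 fun s hs => ?_⟩
  rw [paramArea, withDensity_apply _ hs, Measure.smul_apply, smul_eq_mul, ← setLIntegral_const]
  refine lintegral_mono_ae (ae_restrict_of_ae ?_)
  filter_upwards [ae_mem_domain] with X hX
  rw [← ENNReal.ofReal_coe_nnreal]
  exact ENNReal.ofReal_le_ofReal (hM X hX)

theorem exists_le_paramArea :
    ∃ c : ℝ≥0∞, c ≠ ∞ ∧ volume.restrict Γ.domain ≤ c • Γ.paramArea := by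
  obtain ⟨lam, hlam, h⟩ := Γ.exists_le_areaDensity
  have hpos : ENNReal.ofReal lam ≠ 0 := by simpa using hlam
  refine ⟨(ENNReal.ofReal lam)⁻¹, ENNReal.inv_ne_top.2 hpos, Measure.le_iff.2 fun s hs => ?_⟩
  rw [Measure.smul_apply, smul_eq_mul, ← ENNReal.mul_le_iff_le_inv hpos ENNReal.ofReal_ne_top,
    paramArea, withDensity_apply _ hs, ← setLIntegral_const]
  refine lintegral_mono_ae (ae_restrict_of_ae ?_)
  filter_upwards [ae_mem_domain] with X hX
  exact ENNReal.ofReal_le_ofReal (h X (subset_closure hX))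

/-- Null sets of the surface pull back to Lebesgue null sets because the area density is positive.
-/
theorem ae_param {p : Space → Prop} (h : ∀ᵐ x ∂Γ.area, p x) :
    ∀ᵐ X ∂(volume.restrict Γ.domain), p (Γ.param X) := by
  filter_upwards [absolutelyContinuous_paramArea.ae_le
    (measurePreserving_param.quasiMeasurePreserving.ae h), ae_mem_domain] with X hX hXU
  rwa [indicator_of_mem hXU] at hX

theorem param_chart {x : Space} (hx : x ∈ Γ.carrier) : Γ.param (Γ.chart x) = x := by
  obtain ⟨X, hX, rfl⟩ := hx
  rw [chart_param hX]

theorem eLpNorm_comp_param (f : Γ.L2) :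
    eLpNorm f 2 Γ.area = eLpNorm (fun X => f (Γ.param X)) 2 Γ.paramArea := by
  rw [← eLpNorm_comp_measurePreserving (Lp.aestronglyMeasurable f) measurePreserving_param]
  refine eLpNorm_congr_ae (paramArea_absolutelyContinuous.ae_le ?_)
  filter_upwards [ae_mem_domain] with X hX
  rw [Function.comp_apply, indicator_of_mem hX]

theorem aestronglyMeasurable_comp_param (f : Γ.L2) :
    AEStronglyMeasurable (fun X => f (Γ.param X)) (volume.restrict Γ.domain) := by
  have h1 := ((Lp.aestronglyMeasurable f).comp_measurePreserving
    measurePreserving_param).mono_ac absolutelyContinuous_paramArea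
  refine h1.congr ?_
  filter_upwards [ae_mem_domain] with X hX
  rw [Function.comp_apply, indicator_of_mem hX]

theorem memLp_comp_param (f : Γ.L2) :
    MemLp (fun X => f (Γ.param X)) 2 (volume.restrict Γ.domain) := by
  obtain ⟨c, hc, hle⟩ := Γ.exists_le_paramArea
  refine ⟨aestronglyMeasurable_comp_param f, (eLpNorm_mono_measure _ hle).trans_lt ?_⟩
  rw [eLpNorm_smul_measure_of_ne_top (by norm_num), ← eLpNorm_comp_param, smul_eq_mul]
  exact ENNReal.mul_lt_top (ENNReal.rpow_lt_top_of_nonneg (by positivity) hc) (Lp.eLpNorm_lt_top f)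

theorem exists_eLpNorm_comp_param_le : ∃ C : ℝ, 0 ≤ C ∧ ∀ f : Γ.L2,
    (eLpNorm (fun X => f (Γ.param X)) 2 (volume.restrict Γ.domain)).toReal ≤ C * ‖f‖ := by
  obtain ⟨c, hc, hle⟩ := Γ.exists_le_paramArea
  refine ⟨(c ^ (1 / (2 : ℝ≥0∞)).toReal).toReal, ENNReal.toReal_nonneg, fun f => ?_⟩
  rw [Lp.norm_def, ← ENNReal.toReal_mul]
  refine ENNReal.toReal_mono (ENNReal.mul_ne_top
    (ENNReal.rpow_ne_top_of_nonneg (by positivity) hc) (Lp.eLpNorm_ne_top f)) ?_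
  refine (eLpNorm_mono_measure _ hle).trans ?_
  rw [eLpNorm_smul_measure_of_ne_top (by norm_num), ← eLpNorm_comp_param, smul_eq_mul]

theorem exists_norm_le_eLpNorm_comp_param : ∃ C : ℝ, 0 ≤ C ∧ ∀ f : Γ.L2,
    ‖f‖ ≤ C * (eLpNorm (fun X => f (Γ.param X)) 2 (volume.restrict Γ.domain)).toReal := by
  obtain ⟨c, hc, hle⟩ := Γ.exists_paramArea_le
  refine ⟨(c ^ (1 / (2 : ℝ≥0∞)).toReal).toReal, ENNReal.toReal_nonneg, fun f => ?_⟩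
  rw [Lp.norm_def, ← ENNReal.toReal_mul, eLpNorm_comp_param]
  refine ENNReal.toReal_mono (ENNReal.mul_ne_top
    (ENNReal.rpow_ne_top_of_nonneg (by positivity) hc) (memLp_comp_param f).eLpNorm_ne_top) ?_
  refine (eLpNorm_mono_measure _ hle).trans ?_
  rw [eLpNorm_smul_measure_of_ne_top (by norm_num), smul_eq_mul]

instance isFiniteMeasure_domain : IsFiniteMeasure (volume.restrict Γ.domain) :=
  ⟨by simpa using Γ.isBounded_domain.measure_lt_top⟩

instance isFiniteMeasure_area : IsFiniteMeasure Γ.area := by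
  obtain ⟨c, hc, hle⟩ := Γ.exists_paramArea_le
  rw [← measurePreserving_param.map_eq]
  have : IsFiniteMeasure Γ.paramArea := ⟨by
    refine (hle univ).trans_lt ?_
    rw [Measure.smul_apply, smul_eq_mul]
    exact ENNReal.mul_lt_top hc.lt_top (measure_lt_top _ _)⟩
  infer_instance

theorem integral_paramArea (g : Plane → ℝ) :
    ∫ X, g X ∂Γ.paramArea = ∫ X in Γ.domain, Γ.areaDensity X * g X := by
  rw [paramArea, integral_withDensity_eq_integral_toReal_smul₀
    aemeasurable_areaDensity.ennreal_ofReal (by simp)]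
  simp_rw [ENNReal.toReal_ofReal (areaDensity_nonneg _), smul_eq_mul]

/-- Integrals over the surface in the parameter. -/
theorem integral_area_mul_chart (f : Γ.L2) {k : Plane → ℝ}
    (hk : AEStronglyMeasurable k (volume.restrict Γ.domain)) :
    ∫ x, f x * k (Γ.chart x) ∂Γ.area =
      ∫ X in Γ.domain, f (Γ.param X) * (Γ.areaDensity X * k X) := by
  have hk1 : AEStronglyMeasurable (fun x => k (Γ.chart x)) Γ.area := by
    have h1 := (hk.mono_ac paramArea_absolutelyContinuous).comp_measurePreserving
      measurePreserving_chart
    refine h1.congr ?_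
    filter_upwards [ae_mem_carrier] with x hx
    rw [Function.comp_apply, indicator_of_mem hx]
  have hf := (Lp.aestronglyMeasurable f).mul hk1
  have h2 := integral_map (measurePreserving_param (Γ := Γ)).aemeasurable
    (f := fun x => f x * k (Γ.chart x)) (by rw [measurePreserving_param.map_eq]; exact hf)
  rw [measurePreserving_param.map_eq] at h2
  rw [h2, integral_paramArea]
  refine integral_congr_ae ?_
  filter_upwards [ae_mem_domain] with X hX
  rw [indicator_of_mem hX, chart_param hX]
  ring

/-- The weak surface derivative in the parameter, in divergence form. -/
theorem isWeakSurfDeriv_iff (j : Fin 3) (ψ Υ : Γ.L2) : Γ.IsWeakSurfDeriv j ψ Υ ↔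
    ∀ η, IsTestFunction Γ.domain η →
      ∫ X in Γ.domain, Υ (Γ.param X) * (Γ.areaDensity X * η X) =
        - ∫ X in Γ.domain, ψ (Γ.param X) *
          ∑ β, fderiv ℝ (fun Y => Γ.conormal β Y j * η Y) X (EuclideanSpace.single β 1) := by
  refine forall₂_congr fun η hη => ?_
  have hdiv : ∀ X ∈ Γ.domain, Γ.areaDensity X *
      (Γ.surfDeriv j η X + Γ.meanCurv X * Γ.normal X j * η X) =
      ∑ β, fderiv ℝ (fun Y => Γ.conormal β Y j * η Y) X (EuclideanSpace.single β 1) := fun X hX =>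
    areaDensity_mul_surfDeriv_add hX j (hη.1.differentiable one_ne_zero X)
  -- The divergence form also settles measurability: on the domain the integrand is `J⁻¹` times a
  -- continuous function, so metric and curvature need no separate treatment.
  have hm : AEStronglyMeasurable (fun X => Γ.surfDeriv j η X +
      Γ.meanCurv X * Γ.normal X j * η X) (volume.restrict Γ.domain) := by
    have hm1 : AEStronglyMeasurable (fun X => (Γ.areaDensity X)⁻¹ *
        ∑ β, fderiv ℝ (fun Y => Γ.conormal β Y j * η Y) X (EuclideanSpace.single β 1))
        (volume.restrict Γ.domain) := by
      refine aemeasurable_areaDensity.inv.aestronglyMeasurable.mul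
        (Continuous.aestronglyMeasurable ?_)
      refine continuous_finsetSum _ fun β _ => ?_
      exact (hη.mul_left Γ.isOpen_domain
        (contDiffOn_conormal β j)).continuous_fderiv.clm_apply continuous_const
    refine hm1.congr ?_
    filter_upwards [ae_mem_domain] with X hX
    rw [← hdiv X hX, inv_mul_cancel_left₀ (areaDensity_pos hX).ne']
  rw [integral_area_mul_chart Υ hη.1.continuous.aestronglyMeasurable,
    integral_area_mul_chart (k := fun X => Γ.surfDeriv j η X +
      Γ.meanCurv X * Γ.normal X j * η X) ψ hm]
  have hR : ∫ X in Γ.domain, ψ (Γ.param X) * (Γ.areaDensity X *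
      (Γ.surfDeriv j η X + Γ.meanCurv X * Γ.normal X j * η X)) =
      ∫ X in Γ.domain, ψ (Γ.param X) *
        ∑ β, fderiv ℝ (fun Y => Γ.conormal β Y j * η Y) X (EuclideanSpace.single β 1) :=
    setIntegral_congr_fun Γ.isOpen_domain.measurableSet fun X hX => by
      simp only
      rw [hdiv X hX]
  rw [hR]

end SurfaceWithBoundary

/-! ### Weak surface derivatives and weak gradients in the parameter -/

namespace SurfaceWithBoundary

open Filter Topology
open scoped ENNReal NNReal

variable {Γ : SurfaceWithBoundary} {X : Plane}

theorem comp_param_add_ae (f g : Γ.L2) : (fun X => (f + g : Γ.L2) (Γ.param X))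
    =ᵐ[volume.restrict Γ.domain] fun X => f (Γ.param X) + g (Γ.param X) :=
  ae_param (Lp.coeFn_add f g)

theorem comp_param_sub_ae (f g : Γ.L2) : (fun X => (f - g : Γ.L2) (Γ.param X))
    =ᵐ[volume.restrict Γ.domain] fun X => f (Γ.param X) - g (Γ.param X) :=
  ae_param (Lp.coeFn_sub f g)

theorem comp_param_smul_ae (c : ℝ) (f : Γ.L2) : (fun X => (c • f : Γ.L2) (Γ.param X))
    =ᵐ[volume.restrict Γ.domain] fun X => c * f (Γ.param X) :=
  ae_param (Lp.coeFn_smul c f)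

variable (Γ) in
/-- The pull-back of square integrable functions to the parameter domain. -/
def pullback : Γ.L2 →L[ℝ] Lp ℝ 2 (volume.restrict Γ.domain) :=
  LinearMap.mkContinuous
    { toFun := fun f => (memLp_comp_param f).toLp
      map_add' := fun f g => by
        rw [← MemLp.toLp_add]
        exact MemLp.toLp_congr _ _ (comp_param_add_ae f g)
      map_smul' := fun c f => by
        rw [RingHom.id_apply, ← MemLp.toLp_const_smul]
        exact MemLp.toLp_congr _ _ (comp_param_smul_ae c f) }
    Γ.exists_eLpNorm_comp_param_le.choose fun f => by
      change ‖(memLp_comp_param f).toLp‖ ≤ _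
      rw [Lp.norm_toLp]
      exact Γ.exists_eLpNorm_comp_param_le.choose_spec.2 f

variable (Γ) in
/-- The functional `f ↦ ∫ (f ∘ param) k` on `L²(Γ₀)`. -/
def pairing {k : Plane → ℝ} (hk : MemLp k 2 (volume.restrict Γ.domain)) : Γ.L2 →L[ℝ] ℝ :=
  (innerSL ℝ (hk.toLp k)).comp Γ.pullback

theorem pairing_apply {k : Plane → ℝ} (hk : MemLp k 2 (volume.restrict Γ.domain)) (f : Γ.L2) :
    Γ.pairing hk f = ∫ X in Γ.domain, f (Γ.param X) * k X := by
  rw [(memLp_comp_param f).integral_mul_eq_inner hk, real_inner_comm]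
  rfl

theorem eq_of_comp_param_ae_eq {f g : Γ.L2} (h : (fun X => f (Γ.param X))
    =ᵐ[volume.restrict Γ.domain] fun X => g (Γ.param X)) : f = g := by
  obtain ⟨C, -, hC⟩ := Γ.exists_norm_le_eLpNorm_comp_param
  have h1 : eLpNorm (fun X => (f - g : Γ.L2) (Γ.param X)) 2 (volume.restrict Γ.domain) = 0 := by
    rw [eLpNorm_congr_ae (g := fun _ => (0 : ℝ))]
    · exact eLpNorm_zero
    · filter_upwards [comp_param_sub_ae f g, h] with X hX hX'
      rw [hX, hX', sub_self]
  have h2 := hC (f - g)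
  rw [h1, ENNReal.toReal_zero, mul_zero] at h2
  exact sub_eq_zero.1 (norm_le_zero_iff.1 h2)

theorem isTestFunction_tangent_mul {η : Plane → ℝ} (hη : IsTestFunction Γ.domain η) (α : Fin 2)
    (j : Fin 3) : IsTestFunction Γ.domain fun X => Γ.tangent α X j * η X :=
  hη.mul_left Γ.isOpen_domain (contDiffOn_tangent_apply α j)

theorem isTestFunction_conormal_mul {η : Plane → ℝ} (hη : IsTestFunction Γ.domain η) (β : Fin 2)
    (j : Fin 3) : IsTestFunction Γ.domain fun X => Γ.conormal β X j * η X :=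
  hη.mul_left Γ.isOpen_domain (contDiffOn_conormal β j)

theorem isTestFunction_areaDensity_mul {η : Plane → ℝ} (hη : IsTestFunction Γ.domain η) :
    IsTestFunction Γ.domain fun X => Γ.areaDensity X * η X :=
  hη.mul_left Γ.isOpen_domain contDiffOn_areaDensity

theorem memLp_bounded_mul {f b : Plane → ℝ} (hf : MemLp f 2 (volume.restrict Γ.domain))
    (hb : ContDiffOn ℝ 1 b Γ.domain) {C : ℝ} (hC : ∀ X ∈ Γ.domain, |b X| ≤ C) :
    MemLp (fun X => b X * f X) 2 (volume.restrict Γ.domain) :=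
  hf.bounded_mul (hb.continuousOn.aestronglyMeasurable Γ.isOpen_domain.measurableSet)
    (ae_mem_domain.mono hC)

theorem exists_abs_tangent_apply_le :
    ∃ M : ℝ, 0 ≤ M ∧ ∀ X ∈ Γ.domain, ∀ α j, |Γ.tangent α X j| ≤ M := by
  obtain ⟨M, hM⟩ := Γ.exists_norm_tangent_le
  refine ⟨|M|, abs_nonneg M, fun X hX α j => ?_⟩
  have h1 : ‖Γ.tangent α X j‖ ≤ ‖Γ.tangent α X‖ := PiLp.norm_apply_le _ j
  exact h1.trans ((hM X hX α).trans (le_abs_self M))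

theorem exists_abs_conormal_le :
    ∃ M : ℝ, ∀ X ∈ Γ.domain, ∀ β j, |Γ.conormal β X j| ≤ M := by
  obtain ⟨M, hM0, hM⟩ := Γ.exists_abs_tangent_apply_le
  have hn : ∀ X ∈ Γ.domain, ∀ j, |Γ.normal X j| ≤ 1 := by
    intro X hX j
    have h1 := normal_dotProduct_normal hX
    rw [dotProduct] at h1
    rw [abs_le_one_iff_mul_self_le_one, ← h1]
    exact Finset.single_le_sum (f := fun j => Γ.normal X j * Γ.normal X j)
      (fun _ _ => mul_self_nonneg _) (Finset.mem_univ j)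
  have habs : ∀ a b c d : ℝ, |a| ≤ M → |b| ≤ 1 → |c| ≤ M → |d| ≤ 1 → |a * b - c * d| ≤ M + M := by
    intro a b c d ha hb hc hd
    refine (abs_sub _ _).trans ?_
    rw [abs_mul, abs_mul]
    exact add_le_add ((mul_le_mul ha hb (abs_nonneg _) hM0).trans_eq (mul_one M))
      ((mul_le_mul hc hd (abs_nonneg _) hM0).trans_eq (mul_one M))
  refine ⟨M + M, fun X hX β j => ?_⟩
  fin_cases β
  · exact (congrArg abs (conormal_zero j X)).trans_le
      (habs _ _ _ _ (hM X hX _ _) (hn X hX _) (hM X hX _ _) (hn X hX _))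
  · refine (congrArg abs (conormal_one j X)).trans_le ?_
    rw [mul_comm (Γ.normal X (j + 1)), mul_comm (Γ.normal X (j + 2))]
    exact habs _ _ _ _ (hM X hX _ _) (hn X hX _) (hM X hX _ _) (hn X hX _)

/-- These are triple products: `𝔤₁ · (𝔤₂ × n)` and `𝔤₂ · (n × 𝔤₁)` both equal `n · (𝔤₁ × 𝔤₂)`, and a
repeated factor gives zero. The duality recovers parameter derivatives from surface derivatives. -/
theorem sum_tangent_mul_conormal (hX : X ∈ Γ.domain) (α β : Fin 2) :
    ∑ j, Γ.tangent α X j * Γ.conormal β X j = if α = β then Γ.areaDensity X else 0 := by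
  have hJ := (areaDensity_pos hX).ne'
  have hsq := areaDensity_sq (Γ := Γ) X
  fin_cases α <;> fin_cases β <;>
    simp [Fin.sum_univ_three, conormal, cross_apply, normal_apply, crossTangent] <;>
    field_simp <;> first | (rw [hsq]; ring) | ring

/-- If the pull-back of `ψ` has a weak gradient then the weak surface derivatives of `ψ` are given
by the formula for differentiable functions. -/
theorem isWeakSurfDeriv_iff_ae_eq {ψ : Γ.L2} {G : Fin 2 → Plane → ℝ}
    (h : HasWeakGrad Γ.domain (fun X => ψ (Γ.param X)) G) (j : Fin 3) (Υ : Γ.L2) :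
    Γ.IsWeakSurfDeriv j ψ Υ ↔ (fun X => Γ.areaDensity X * Υ (Γ.param X))
      =ᵐ[volume.restrict Γ.domain] fun X => ∑ β, Γ.conormal β X j * G β X := by
  obtain ⟨M, hM⟩ := Γ.exists_abs_conormal_le
  obtain ⟨M', hM'⟩ := Γ.exists_areaDensity_le
  have hmA : ∀ β, MemLp (fun X => Γ.conormal β X j * G β X) 2 (volume.restrict Γ.domain) :=
    fun β => memLp_bounded_mul (h.memLp_grad β) (contDiffOn_conormal β j) fun X hX => hM X hX β j
  have hmS : MemLp (fun X => ∑ β, Γ.conormal β X j * G β X) 2 (volume.restrict Γ.domain) :=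
    memLp_finsetSum _ fun β _ => hmA β
  have hmJ : MemLp (fun X => Γ.areaDensity X * Υ (Γ.param X)) 2 (volume.restrict Γ.domain) :=
    memLp_bounded_mul (memLp_comp_param Υ) contDiffOn_areaDensity fun X hX => by
      rw [abs_of_nonneg (areaDensity_nonneg X)]
      exact hM' X hX
  -- The conormal fields are `C¹`, so their components times `η` are admissible in the definition of
  -- the weak gradient.
  have hR : ∀ η, IsTestFunction Γ.domain η → - ∫ X in Γ.domain, ψ (Γ.param X) *
      ∑ β, fderiv ℝ (fun Y => Γ.conormal β Y j * η Y) X (EuclideanSpace.single β 1) =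
      ∫ X in Γ.domain, (∑ β, Γ.conormal β X j * G β X) * η X := by
    intro η hη
    simp_rw [Finset.mul_sum, Finset.sum_mul]
    rw [integral_finsetSum _ fun β _ => h.memLp.integrable_mul_two
        ((isTestFunction_conormal_mul hη β j).memLp_fderiv _ _),
      integral_finsetSum _ fun β _ => (hmA β).integrable_mul_two (hη.memLp _),
      ← Finset.sum_neg_distrib]
    refine Finset.sum_congr rfl fun β _ => ?_
    rw [← h.integral_eq β _ (isTestFunction_conormal_mul hη β j)]
    congr 1
    ext X
    ring
  have hL : ∀ η : Plane → ℝ, ∫ X in Γ.domain, Υ (Γ.param X) * (Γ.areaDensity X * η X) =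
      ∫ X in Γ.domain, (Γ.areaDensity X * Υ (Γ.param X)) * η X := by
    intro η
    congr 1
    ext X
    ring
  rw [isWeakSurfDeriv_iff]
  constructor
  · intro hw
    have h0 := ae_eq_zero_of_forall_isTestFunction Γ.isOpen_domain (hmJ.sub hmS) fun η hη => by
      have h1 := hw η hη
      rw [hL, hR η hη] at h1
      simp_rw [Pi.sub_apply, sub_mul]
      rw [integral_sub (hmJ.integrable_mul_two (hη.memLp _))
        (hmS.integrable_mul_two (hη.memLp _)), h1, sub_self]
    filter_upwards [h0] with X hX
    exact sub_eq_zero.1 hX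
  · intro hae η hη
    rw [hL, hR η hη]
    refine integral_congr_ae ?_
    filter_upwards [hae] with X hX
    rw [hX]

/-- The difference of two candidates, times the positive area density, is orthogonal to all test
functions. Hence the choice made in `weakSurfDeriv` is immaterial. -/
theorem IsWeakSurfDeriv.unique {j : Fin 3} {ψ Υ Υ' : Γ.L2} (h : Γ.IsWeakSurfDeriv j ψ Υ)
    (h' : Γ.IsWeakSurfDeriv j ψ Υ') : Υ = Υ' := by
  rw [isWeakSurfDeriv_iff] at h h'
  obtain ⟨M', hM'⟩ := Γ.exists_areaDensity_le
  have hmJ : ∀ f : Γ.L2, MemLp (fun X => Γ.areaDensity X * f (Γ.param X)) 2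
      (volume.restrict Γ.domain) := fun f =>
    memLp_bounded_mul (memLp_comp_param f) contDiffOn_areaDensity fun X hX => by
      rw [abs_of_nonneg (areaDensity_nonneg X)]
      exact hM' X hX
  have h0 := ae_eq_zero_of_forall_isTestFunction Γ.isOpen_domain ((hmJ Υ).sub (hmJ Υ'))
    fun η hη => by
      have h1 := (h η hη).trans (h' η hη).symm
      simp_rw [Pi.sub_apply, sub_mul]
      rw [integral_sub ((hmJ Υ).integrable_mul_two (hη.memLp _))
        ((hmJ Υ').integrable_mul_two (hη.memLp _)), sub_eq_zero]
      convert h1 using 2 <;>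
      · ext X
        ring
  refine eq_of_comp_param_ae_eq ?_
  filter_upwards [h0, ae_mem_domain] with X hX hXU
  exact mul_left_cancel₀ (areaDensity_pos hXU).ne' (sub_eq_zero.1 hX)

theorem IsWeakSurfDeriv.weakSurfDeriv_eq {j : Fin 3} {ψ Υ : Γ.L2} (h : Γ.IsWeakSurfDeriv j ψ Υ) :
    Γ.weakSurfDeriv j ψ = Υ := by
  have hex : ∃ Υ : Γ.L2, Γ.IsWeakSurfDeriv j ψ Υ := ⟨Υ, h⟩
  rw [weakSurfDeriv, dif_pos hex]
  exact hex.choose_spec.unique h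

theorem isWeakSurfDeriv_weakSurfDeriv {ψ : Γ.L2} (hψ : ψ ∈ Γ.W12) (j : Fin 3) :
    Γ.IsWeakSurfDeriv j ψ (Γ.weakSurfDeriv j ψ) := by
  obtain ⟨Υ, h⟩ := hψ.2 j
  rwa [h.weakSurfDeriv_eq]

variable (Γ) in
/-- The derivatives in the parameter that belong to the tangential gradient `Υ`. -/
def paramGrad (Υ : Fin 3 → Γ.L2) (α : Fin 2) (X : Plane) : ℝ :=
  ∑ j, Γ.tangent α X j * Υ j (Γ.param X)

theorem memLp_tangent_mul (α : Fin 2) (j : Fin 3) (f : Γ.L2) :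
    MemLp (fun X => Γ.tangent α X j * f (Γ.param X)) 2 (volume.restrict Γ.domain) := by
  obtain ⟨M, -, hM⟩ := Γ.exists_abs_tangent_apply_le
  exact memLp_bounded_mul (memLp_comp_param f) (contDiffOn_tangent_apply α j)
    fun X hX => hM X hX α j

theorem memLp_paramGrad (Υ : Fin 3 → Γ.L2) (α : Fin 2) :
    MemLp (Γ.paramGrad Υ α) 2 (volume.restrict Γ.domain) :=
  memLp_finsetSum _ fun j _ => memLp_tangent_mul α j (Υ j)

theorem _root_.HasWeakGrad.congr_grad {U : Set Plane} {φ : Plane → ℝ} {G G' : Fin 2 → Plane → ℝ}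
    (h : HasWeakGrad U φ G) (hG : ∀ α, G α =ᵐ[volume.restrict U] G' α) : HasWeakGrad U φ G' where
  memLp := h.memLp
  memLp_grad α := (h.memLp_grad α).ae_eq (hG α)
  integral_eq α η hη := by
    rw [← h.integral_eq α η hη]
    refine integral_congr_ae ?_
    filter_upwards [hG α] with X hX
    rw [hX]

/-- The pull-back of a function in `W^{1,2}(Γ₀)` has the weak gradient determined by its surface
derivatives. -/
theorem hasWeakGrad_paramGrad {ψ : Γ.L2} (hψ : ψ ∈ Γ.W12) : HasWeakGrad Γ.domain
    (fun X => ψ (Γ.param X)) (Γ.paramGrad fun j => Γ.weakSurfDeriv j ψ) := by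
  obtain ⟨φ, ⟨hφ, hφG⟩, hψφ⟩ := hψ.1
  choose G hG hGφ using hφG
  have h1 : HasWeakGrad Γ.domain φ G := ⟨hφ, hG, hGφ⟩
  have h2 : HasWeakGrad Γ.domain (fun X => ψ (Γ.param X)) G := by
    refine h1.congr ?_
    filter_upwards [ae_param hψφ, ae_mem_domain] with X hX hXU
    rw [hX, chart_param hXU]
  refine HasWeakGrad.congr_grad h2 fun α => ?_
  have h3 := fun j => (isWeakSurfDeriv_iff_ae_eq h2 j _).1 (isWeakSurfDeriv_weakSurfDeriv hψ j)
  filter_upwards [ae_all_iff.2 h3, ae_mem_domain] with X hX hXU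
  -- After multiplication by the density, contracting `∑ c_β G_β` with `𝔤_α` leaves only the term `J
  -- G_α`.
  refine mul_left_cancel₀ (areaDensity_pos hXU).ne' ?_
  rw [paramGrad, Finset.mul_sum]
  simp_rw [mul_left_comm (Γ.areaDensity X), hX, Finset.mul_sum]
  rw [Finset.sum_comm]
  simp_rw [← mul_assoc, ← Finset.sum_mul, sum_tangent_mul_conormal hXU]
  simp

/-- Functions whose pull-back has a weak gradient belong to `W^{1,2}(Γ₀)` if they have weak surface
derivatives. -/
theorem mem_W12_of_hasWeakGrad {ψ : Γ.L2} {G : Fin 2 → Plane → ℝ}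
    (h : HasWeakGrad Γ.domain (fun X => ψ (Γ.param X)) G) {Υ : Fin 3 → Γ.L2}
    (hΥ : ∀ j, Γ.IsWeakSurfDeriv j ψ (Υ j)) : ψ ∈ Γ.W12 := by
  refine ⟨⟨fun X => ψ (Γ.param X), ⟨h.memLp, fun α => ⟨G α, h.memLp_grad α, h.integral_eq α⟩⟩, ?_⟩,
    fun j => ⟨Υ j, hΥ j⟩⟩
  filter_upwards [ae_mem_carrier] with x hx
  rw [param_chart hx]

end SurfaceWithBoundary

/-- Integration by parts against the constant `1`. It is what gives constants a vanishing weak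
gradient. -/
theorem IsTestFunction.integral_fderiv_eq_zero {U : Set Plane} {η : Plane → ℝ}
    (hη : IsTestFunction U η) (v : Plane) : ∫ X in U, fderiv ℝ η X v = 0 := by
  rw [setIntegral_eq_integral_of_forall_compl_eq_zero fun X hX => by
    rw [hη.fderiv_eq_zero hX, zero_apply]]
  have hi : Integrable fun X => fderiv ℝ η X v :=
    (hη.continuous_fderiv.clm_apply continuous_const).integrable_of_hasCompactSupport
      (hη.2.1.fderiv_apply ℝ v)
  have hi' : Integrable η := hη.1.continuous.integrable_of_hasCompactSupport hη.2.1
  have h := integral_mul_fderiv_eq_neg_fderiv_mul_of_integrable (μ := (volume : Measure Plane))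
    (f := fun _ : Plane => (1 : ℝ)) (g := η) (v := v) (by simp) (by simpa using hi)
    (by simpa using hi') (fun X _ => differentiableAt_const _)
    (fun X _ => hη.1.differentiable one_ne_zero X)
  simpa using h

/-! ### The closed graph of the surface gradient and the weak problem -/

namespace SurfaceWithBoundary

open Filter Topology
open scoped ENNReal NNReal

variable {Γ : SurfaceWithBoundary} {X : Plane}

theorem memLp_fderiv_conormal_mul {η : Plane → ℝ} (hη : IsTestFunction Γ.domain η) (j : Fin 3) :
    MemLp (fun X => ∑ β, fderiv ℝ (fun Y => Γ.conormal β Y j * η Y) X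
      (EuclideanSpace.single β 1)) 2 (volume.restrict Γ.domain) :=
  memLp_finsetSum _ fun β _ => (isTestFunction_conormal_mul hη β j).memLp_fderiv _ _

variable (Γ) in
/-- Pairs of a function and a candidate for its tangential gradient. -/
abbrev Jet : Type := PiLp 2 fun _ : Fin 4 => Γ.L2

/-- The functional that tests whether `p (j + 1)` is the `j`-th weak surface derivative of `p 0`. -/
def surfDerivTest {η : Plane → ℝ} (hη : IsTestFunction Γ.domain η) (j : Fin 3) :
    Γ.Jet →L[ℝ] ℝ :=
  (Γ.pairing ((isTestFunction_areaDensity_mul hη).memLp _)).comp (PiLp.proj 2 _ j.succ) +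
    (Γ.pairing (memLp_fderiv_conormal_mul hη j)).comp (PiLp.proj 2 _ 0)

/-- The functional that tests whether the components of `p` determine the weak derivative in the
parameter of `p 0`. -/
def paramDerivTest {η : Plane → ℝ} (hη : IsTestFunction Γ.domain η) (α : Fin 2) :
    Γ.Jet →L[ℝ] ℝ :=
  (∑ j : Fin 3, (Γ.pairing ((isTestFunction_tangent_mul hη α j).memLp _)).comp
    (PiLp.proj 2 _ j.succ)) +
    (Γ.pairing (hη.memLp_fderiv _ (EuclideanSpace.single α 1))).comp (PiLp.proj 2 _ 0)

variable (Γ) in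
/-- The graph of the weak tangential gradient on `W^{1,2}(Γ₀)`. -/
def gradGraph : Submodule ℝ Γ.Jet :=
  (⨅ (η : {η // IsTestFunction Γ.domain η}) (j : Fin 3), (surfDerivTest η.2 j).ker) ⊓
    ⨅ (η : {η // IsTestFunction Γ.domain η}) (α : Fin 2), (paramDerivTest η.2 α).ker

theorem surfDerivTest_apply {η : Plane → ℝ} (hη : IsTestFunction Γ.domain η) (j : Fin 3)
    (p : Γ.Jet) : surfDerivTest hη j p =
      (∫ X in Γ.domain, p j.succ (Γ.param X) * (Γ.areaDensity X * η X)) +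
      ∫ X in Γ.domain, p 0 (Γ.param X) * ∑ β, fderiv ℝ (fun Y => Γ.conormal β Y j * η Y) X
        (EuclideanSpace.single β 1) := by
  rw [← pairing_apply ((isTestFunction_areaDensity_mul hη).memLp _),
    ← pairing_apply (memLp_fderiv_conormal_mul hη j)]
  rfl

theorem paramDerivTest_apply {η : Plane → ℝ} (hη : IsTestFunction Γ.domain η) (α : Fin 2)
    (p : Γ.Jet) : paramDerivTest hη α p =
      (∫ X in Γ.domain, Γ.paramGrad (fun j => p j.succ) α X * η X) +
      ∫ X in Γ.domain, p 0 (Γ.param X) * fderiv ℝ η X (EuclideanSpace.single α 1) := by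
  have h1 : ∫ X in Γ.domain, Γ.paramGrad (fun j => p j.succ) α X * η X =
      ∑ j : Fin 3, Γ.pairing ((isTestFunction_tangent_mul hη α j).memLp _) (p j.succ) := by
    simp_rw [pairing_apply, paramGrad, Finset.sum_mul]
    rw [integral_finsetSum _ fun j _ =>
      (memLp_tangent_mul α j (p j.succ)).integrable_mul_two (hη.memLp _)]
    refine Finset.sum_congr rfl fun j _ => ?_
    congr 1
    ext X
    ring
  rw [h1, ← pairing_apply (hη.memLp_fderiv _ (EuclideanSpace.single α 1)), paramDerivTest,
    add_apply, sum_apply]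
  rfl

/-- The second family of tests is needed because `W12` also demands a weak gradient in the
parameter. Writing that gradient as `paramGrad` of the other components turns an existence statement
into linear equations. -/
theorem mem_gradGraph {p : Γ.Jet} : p ∈ Γ.gradGraph ↔
    (∀ j : Fin 3, Γ.IsWeakSurfDeriv j (p 0) (p j.succ)) ∧
      HasWeakGrad Γ.domain (fun X => p 0 (Γ.param X)) (Γ.paramGrad fun j => p j.succ) := by
  simp only [gradGraph, Submodule.mem_inf, Submodule.mem_iInf, LinearMap.mem_ker,
    ContinuousLinearMap.coe_coe, Subtype.forall, surfDerivTest_apply, paramDerivTest_apply,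
    isWeakSurfDeriv_iff, add_eq_zero_iff_eq_neg]
  exact and_congr ⟨fun h j η hη => h η hη j, fun h η hη j => h j η hη⟩
    ⟨fun h => ⟨memLp_comp_param _, fun α => memLp_paramGrad _ α, fun α η hη => h η hη α⟩,
      fun h η hη α => h.integral_eq α η hη⟩

/-- An intersection of kernels of continuous functionals; this plays the role of completeness of
`W^{1,2}(Γ₀)`. -/
theorem isClosed_gradGraph : IsClosed (Γ.gradGraph : Set Γ.Jet) := by
  simp only [gradGraph, Submodule.coe_inf, Submodule.coe_iInf]
  exact (isClosed_iInter fun η => isClosed_iInter fun j => (surfDerivTest η.2 j).isClosed_ker).inter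
    (isClosed_iInter fun η => isClosed_iInter fun α => (paramDerivTest η.2 α).isClosed_ker)

/-- The pair of a function and its weak tangential gradient. -/
def jet (ψ : Γ.L2) : Γ.Jet :=
  WithLp.toLp 2 (Fin.cons ψ fun j => Γ.weakSurfDeriv j ψ)

theorem jet_succ (ψ : Γ.L2) (j : Fin 3) : jet ψ j.succ = Γ.weakSurfDeriv j ψ := rfl

theorem jet_mem_gradGraph {ψ : Γ.L2} (hψ : ψ ∈ Γ.W12) : jet ψ ∈ Γ.gradGraph :=
  mem_gradGraph.2 ⟨isWeakSurfDeriv_weakSurfDeriv hψ, hasWeakGrad_paramGrad hψ⟩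

theorem mem_W12_of_mem_gradGraph {p : Γ.Jet} (hp : p ∈ Γ.gradGraph) : p 0 ∈ Γ.W12 :=
  mem_W12_of_hasWeakGrad (mem_gradGraph.1 hp).2 (mem_gradGraph.1 hp).1

theorem weakSurfDeriv_of_mem_gradGraph {p : Γ.Jet} (hp : p ∈ Γ.gradGraph) (j : Fin 3) :
    Γ.weakSurfDeriv j (p 0) = p j.succ :=
  ((mem_gradGraph.1 hp).1 j).weakSurfDeriv_eq

theorem jet_of_mem_gradGraph {p : Γ.Jet} (hp : p ∈ Γ.gradGraph) : jet (p 0) = p := by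
  ext1 i
  refine Fin.cases rfl (fun j => ?_) i
  exact (jet_succ (p 0) j).trans (weakSurfDeriv_of_mem_gradGraph hp j)

variable (Γ) in
/-- The constant function on the surface. -/
def constL2 (c : ℝ) : Γ.L2 := Lp.const 2 Γ.area c

theorem constL2_ae (c : ℝ) : Γ.constL2 c =ᵐ[Γ.area] fun _ => c :=
  Lp.coeFn_const 2 Γ.area c

variable (Γ) in
/-- The constant function with zero gradient. -/
def constJet (c : ℝ) : Γ.Jet :=
  WithLp.toLp 2 (Fin.cons (Γ.constL2 c) fun _ => 0)

/-- Thanks to the curvature term, the expression tested is the divergence of a compactly supported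
`C¹` field, whose integral against a constant vanishes. -/
theorem constJet_mem_gradGraph (c : ℝ) : Γ.constJet c ∈ Γ.gradGraph := by
  have h0 : (fun X => (0 : Γ.L2) (Γ.param X)) =ᵐ[volume.restrict Γ.domain] fun _ => 0 :=
    ae_param (Lp.coeFn_zero ℝ 2 Γ.area)
  have hc := ae_param (constL2_ae (Γ := Γ) c)
  refine mem_gradGraph.2 ⟨fun j => (isWeakSurfDeriv_iff j _ _).2 fun η hη => ?_, memLp_comp_param _,
    memLp_paramGrad _, fun α η hη => ?_⟩
  · trans 0
    · refine integral_eq_zero_of_ae ?_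
      filter_upwards [h0] with X hX
      change (0 : Γ.L2) (Γ.param X) * _ = 0
      rw [hX, zero_mul]
    · rw [eq_comm, neg_eq_zero]
      trans ∫ X in Γ.domain, c * ∑ β, fderiv ℝ (fun Y => Γ.conormal β Y j * η Y) X
        (EuclideanSpace.single β 1)
      · refine integral_congr_ae ?_
        filter_upwards [hc] with X hX
        change Γ.constL2 c (Γ.param X) * _ = _
        rw [hX]
      · rw [integral_const_mul, integral_finsetSum _ fun β _ =>
          ((isTestFunction_conormal_mul hη β j).memLp_fderiv _ _).integrable one_le_two]
        simp_rw [(isTestFunction_conormal_mul hη _ j).integral_fderiv_eq_zero]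
        simp
  · trans 0
    · refine integral_eq_zero_of_ae ?_
      filter_upwards [h0] with X hX
      change (∑ j, Γ.tangent α X j * (0 : Γ.L2) (Γ.param X)) * _ = 0
      rw [Finset.sum_eq_zero fun j _ => by rw [hX, mul_zero], zero_mul]
    · rw [eq_comm, neg_eq_zero]
      trans ∫ X in Γ.domain, c * fderiv ℝ η X (EuclideanSpace.single α 1)
      · refine integral_congr_ae ?_
        filter_upwards [hc] with X hX
        change Γ.constL2 c (Γ.param X) * _ = _
        rw [hX]
      · rw [integral_const_mul, hη.integral_fderiv_eq_zero, mul_zero]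

theorem integral_mul_eq_inner (f g : Γ.L2) : ∫ x, f x * g x ∂Γ.area = inner ℝ f g := by
  rw [(Lp.memLp f).integral_mul_eq_inner (Lp.memLp g), Lp.toLp_coeFn, Lp.toLp_coeFn]

theorem inner_constL2 (f : Γ.L2) (c : ℝ) : inner ℝ f (Γ.constL2 c) = (∫ x, f x ∂Γ.area) * c := by
  rw [← integral_mul_eq_inner, ← integral_mul_const]
  refine integral_congr_ae ?_
  filter_upwards [constL2_ae (Γ := Γ) c] with x hx
  rw [hx]

theorem mem_L20_iff {f : Γ.L2} : f ∈ Γ.L20 ↔ inner ℝ f (Γ.constL2 1) = 0 := by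
  rw [inner_constL2, mul_one]
  rfl

theorem inner_constL2_eq_zero {f : Γ.L2} (hf : f ∈ Γ.L20) (c : ℝ) :
    inner ℝ f (Γ.constL2 c) = 0 := by
  rw [inner_constL2, show ∫ x, f x ∂Γ.area = 0 from hf, zero_mul]

/-- Among all translates by constants, functions with mean zero have minimal norm. -/
theorem norm_le_norm_sub_constL2 {f : Γ.L2} (hf : f ∈ Γ.L20) (c : ℝ) :
    ‖f‖ ≤ ‖f - Γ.constL2 c‖ := by
  have h1 : ‖f‖ * ‖f‖ ≤ ‖f‖ * ‖f - Γ.constL2 c‖ := by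
    rw [← real_inner_self_eq_norm_mul_norm]
    refine le_trans (le_of_eq ?_) (real_inner_le_norm _ _)
    rw [inner_sub_right, inner_constL2_eq_zero hf, sub_zero]
  rcases (norm_nonneg f).eq_or_lt' with h | h
  · rw [h]
    exact norm_nonneg _
  · exact le_of_mul_le_mul_left h1 h

-- Bounded tangent vectors and the bounded pull-back give `M * C` for each of the two components.
-- This transfers the right side of the Poincaré inequality to the surface.
variable (Γ) in
theorem exists_gradNorm_paramGrad_le : ∃ C : ℝ, 0 ≤ C ∧ ∀ Υ : Fin 3 → Γ.L2,
    gradNorm Γ.domain (Γ.paramGrad Υ) ≤ C * ∑ j, ‖Υ j‖ := by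
  obtain ⟨M, hM0, hM⟩ := Γ.exists_abs_tangent_apply_le
  obtain ⟨C, hC0, hC⟩ := Γ.exists_eLpNorm_comp_param_le
  refine ⟨2 * (M * C), by positivity, fun Υ => ?_⟩
  have h1 : ∀ α j, (eLpNorm (fun X => Γ.tangent α X j * Υ j (Γ.param X)) 2
      (volume.restrict Γ.domain)).toReal ≤ M * C * ‖Υ j‖ := by
    intro α j
    have h2 : eLpNorm (fun X => Γ.tangent α X j * Υ j (Γ.param X)) 2 (volume.restrict Γ.domain) ≤
        ENNReal.ofReal M * eLpNorm (fun X => Υ j (Γ.param X)) 2 (volume.restrict Γ.domain) := by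
      refine eLpNorm_le_mul_eLpNorm_of_ae_le_mul ?_ 2
      filter_upwards [ae_mem_domain] with X hX
      rw [norm_mul]
      exact mul_le_mul_of_nonneg_right (hM X hX α j) (norm_nonneg _)
    have h3 := ENNReal.toReal_mono
      (ENNReal.mul_ne_top ENNReal.ofReal_ne_top (memLp_comp_param (Υ j)).2.ne) h2
    rw [ENNReal.toReal_mul, ENNReal.toReal_ofReal hM0] at h3
    rw [mul_assoc]
    exact h3.trans (mul_le_mul_of_nonneg_left (hC _) hM0)
  have h2 : ∀ α, (eLpNorm (Γ.paramGrad Υ α) 2 (volume.restrict Γ.domain)).toReal ≤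
      M * C * ∑ j, ‖Υ j‖ := by
    intro α
    have h3 := eLpNorm_sum_le (s := Finset.univ) (p := 2)
      (fun j _ => (memLp_tangent_mul α j (Υ j)).1) one_le_two
    have h4 := ENNReal.toReal_mono
      (ENNReal.sum_ne_top.2 fun j _ => (memLp_tangent_mul α j (Υ j)).2.ne) h3
    rw [ENNReal.toReal_sum fun j _ => (memLp_tangent_mul α j (Υ j)).2.ne] at h4
    have h5 : Γ.paramGrad Υ α = ∑ j, fun X => Γ.tangent α X j * Υ j (Γ.param X) := by
      ext X
      rw [paramGrad, Finset.sum_apply]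
    rw [h5, Finset.mul_sum]
    exact h4.trans (Finset.sum_le_sum fun j _ => h1 α j)
  rw [gradNorm, Fin.sum_univ_two, mul_assoc, two_mul]
  exact add_le_add (h2 0) (h2 1)

variable (Γ) in
/-- The Poincaré inequality on the surface. -/
theorem exists_norm_sq_le : ∃ C : ℝ, 0 ≤ C ∧ ∀ p ∈ Γ.gradGraph, p 0 ∈ Γ.L20 →
    ‖p 0‖ ^ 2 ≤ C * ∑ j : Fin 3, ‖p j.succ‖ ^ 2 := by
  obtain ⟨A, hA0, hA⟩ := Γ.hasC2Boundary_domain.poincareOn Γ.isOpen_domain Γ.isConnected_domain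
    Γ.isBounded_domain
  obtain ⟨B, hB0, hB⟩ := Γ.exists_norm_le_eLpNorm_comp_param
  obtain ⟨D, hD0, hD⟩ := Γ.exists_gradNorm_paramGrad_le
  refine ⟨(B * (A * D)) ^ 2 * 3, by positivity, fun p hp h0 => ?_⟩
  obtain ⟨c, hc⟩ := hA _ _ (mem_gradGraph.1 hp).2
  have h1 : ‖p 0‖ ≤ B * (A * D) * ∑ j : Fin 3, ‖p j.succ‖ := by
    -- The constant supplied by the inequality on `U` need not be the surface mean; orthogonality of
    -- `p 0` to constants makes any constant good enough.
    refine (norm_le_norm_sub_constL2 h0 c).trans ((hB _).trans ?_)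
    rw [mul_assoc, mul_assoc]
    refine mul_le_mul_of_nonneg_left ?_ hB0
    refine le_trans (le_of_eq ?_)
      (hc.trans (mul_le_mul_of_nonneg_left (hD fun j => p j.succ) hA0))
    congr 1
    refine eLpNorm_congr_ae ?_
    filter_upwards [comp_param_sub_ae (p 0) (Γ.constL2 c), ae_param (constL2_ae c)] with X hX hX'
    rw [hX, hX']
  have h2 : (∑ j : Fin 3, ‖p j.succ‖) ^ 2 ≤ 3 * ∑ j : Fin 3, ‖p j.succ‖ ^ 2 := by
    simpa using sq_sum_le_card_mul_sum_sq (s := Finset.univ) (f := fun j : Fin 3 => ‖p j.succ‖)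
  calc ‖p 0‖ ^ 2 ≤ (B * (A * D) * ∑ j : Fin 3, ‖p j.succ‖) ^ 2 :=
        pow_le_pow_left₀ (norm_nonneg _) h1 2
    _ ≤ (B * (A * D)) ^ 2 * (3 * ∑ j : Fin 3, ‖p j.succ‖ ^ 2) := by
        rw [mul_pow]
        exact mul_le_mul_of_nonneg_left h2 (sq_nonneg _)
    _ = _ := by ring

variable (Γ) in
/-- The graph of the weak tangential gradient on the functions with mean zero. -/
def meanZeroGraph : Submodule ℝ Γ.Jet :=
  Γ.gradGraph ⊓ ((innerSL ℝ (Γ.constL2 1)).comp (PiLp.proj 2 (fun _ : Fin 4 => Γ.L2) 0)).ker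

theorem mem_meanZeroGraph {p : Γ.Jet} : p ∈ Γ.meanZeroGraph ↔ p ∈ Γ.gradGraph ∧ p 0 ∈ Γ.L20 := by
  rw [mem_L20_iff, real_inner_comm]
  rfl

theorem isClosed_meanZeroGraph : IsClosed (Γ.meanZeroGraph : Set Γ.Jet) :=
  isClosed_gradGraph.inter (ContinuousLinearMap.isClosed_ker _)

theorem jet_mem_meanZeroGraph {v : Γ.L2} (hv : v ∈ Γ.H1) : jet v ∈ Γ.meanZeroGraph :=
  mem_meanZeroGraph.2 ⟨jet_mem_gradGraph hv.2, hv.1⟩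

/-- A function in `W^{1,2}(Γ₀)` can be shifted by a constant to have mean zero. -/
theorem exists_jet_sub_constJet_mem {ψ : Γ.L2} (hψ : ψ ∈ Γ.W12) :
    ∃ c, jet ψ - Γ.constJet c ∈ Γ.meanZeroGraph := by
  refine ⟨(∫ x, Γ.constL2 1 x ∂Γ.area)⁻¹ * inner ℝ ψ (Γ.constL2 1), mem_meanZeroGraph.2
    ⟨sub_mem (jet_mem_gradGraph hψ) (constJet_mem_gradGraph _), ?_⟩⟩
  rw [mem_L20_iff]
  change inner ℝ (ψ - Γ.constL2 _) _ = 0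
  rw [inner_sub_left, real_inner_comm (Γ.constL2 1) (Γ.constL2 _),
    inner_constL2 (Γ.constL2 1)]
  -- If the total area were zero, the constant `1` would be the zero element of `L²` and every mean
  -- would vanish, so positivity of the area need not be proved.
  rcases eq_or_ne (∫ x, Γ.constL2 1 x ∂Γ.area) 0 with h | h
  · have h1 : inner ℝ (Γ.constL2 1) (Γ.constL2 1) = 0 := by rw [inner_constL2, h, zero_mul]
    rw [h, zero_mul, sub_zero, inner_self_eq_zero.1 h1, inner_zero_right]
  · rw [mul_inv_cancel_left₀ h, sub_self]

theorem gradInner_eq (v ψ : Γ.L2) : Γ.gradInner v ψ =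
    ∑ j, inner ℝ (Γ.weakSurfDeriv j v) (Γ.weakSurfDeriv j ψ) := by
  simp_rw [gradInner, integral_mul_eq_inner]

/-- It suffices to test with functions of mean zero. -/
theorem isWeakSolution_iff {F v : Γ.L2} (hF : F ∈ Γ.L20) (hv : v ∈ Γ.H1) :
    Γ.IsWeakSolution F v ↔ ∀ q ∈ Γ.meanZeroGraph,
      ∑ j : Fin 3, inner ℝ (jet v j.succ) (q j.succ) = inner ℝ F (q 0) := by
  simp_rw [IsWeakSolution, gradInner_eq, integral_mul_eq_inner]
  constructor
  · rintro ⟨-, h⟩ q hq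
    have h1 := (mem_meanZeroGraph.1 hq).1
    simp only [jet_succ]
    simpa only [weakSurfDeriv_of_mem_gradGraph h1] using h _ (mem_W12_of_mem_gradGraph h1)
  · refine fun h => ⟨hv, fun ψ hψ => ?_⟩
    -- Subtracting the constant leaves the gradient components unchanged, and `F`, having mean zero,
    -- does not see it.
    obtain ⟨c, hc⟩ := exists_jet_sub_constJet_mem hψ
    have h1 := h _ hc
    have h2 : (jet ψ - Γ.constJet c) 0 = ψ - Γ.constL2 c := rfl
    have h3 : ∀ j : Fin 3, (jet ψ - Γ.constJet c) j.succ = Γ.weakSurfDeriv j ψ := fun j =>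
      sub_zero (Γ.weakSurfDeriv j ψ)
    simp_rw [h2, h3, inner_sub_right, inner_constL2_eq_zero hF, sub_zero] at h1
    exact h1

/-- The energy identity: the solution is its own test function. -/
theorem IsWeakSolution.sum_norm_sq_eq {F v : Γ.L2} (hv : Γ.IsWeakSolution F v) :
    ∑ j, ‖Γ.weakSurfDeriv j v‖ ^ 2 = inner ℝ F v := by
  have h := hv.2 v hv.1.2
  rw [gradInner_eq, integral_mul_eq_inner] at h
  simpa only [real_inner_self_eq_norm_sq] using h

variable (Γ) in
theorem W12norm_eq (ψ : Γ.L2) :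
    Γ.W12norm ψ = √(‖ψ‖ ^ 2 + ∑ j, ‖Γ.weakSurfDeriv j ψ‖ ^ 2) := by
  have hi : ∀ f : Γ.L2, Integrable (fun x => |f x| ^ 2) Γ.area := fun f => by
    simp_rw [sq_abs, sq]
    exact (Lp.memLp f).integrable_mul_two (Lp.memLp f)
  have hn : ∀ f : Γ.L2, ∫ x, |f x| ^ 2 ∂Γ.area = ‖f‖ ^ 2 := fun f => by
    simp_rw [sq_abs, sq]
    rw [integral_mul_eq_inner, real_inner_self_eq_norm_mul_norm]
  rw [W12norm, integral_add (hi ψ) (integrable_finsetSum _ fun j _ => hi _),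
    integral_finsetSum _ fun j _ => hi _]
  simp_rw [hn]

theorem existsUnique_isWeakSolution {F : Γ.L2} (hF : F ∈ Γ.L20) :
    ∃! v : Γ.L2, Γ.IsWeakSolution F v := by
  obtain ⟨C, hC0, hC⟩ := Γ.exists_norm_sq_le
  have hC' : ∀ p ∈ Γ.meanZeroGraph, ‖p 0‖ ^ 2 ≤ C * ∑ j : Fin 3, ‖p j.succ‖ ^ 2 := fun p hp =>
    hC p (mem_meanZeroGraph.1 hp).1 (mem_meanZeroGraph.1 hp).2
  obtain ⟨p, hp, h⟩ := exists_sum_inner_succ_eq Γ.meanZeroGraph isClosed_meanZeroGraph hC' F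
  obtain ⟨hp1, hp0⟩ := mem_meanZeroGraph.1 hp
  refine ⟨p 0, (isWeakSolution_iff hF ⟨hp0, mem_W12_of_mem_gradGraph hp1⟩).2 ?_, fun w hw => ?_⟩
  · rwa [jet_of_mem_gradGraph hp1]
  -- Testing the difference of two solutions with itself makes its gradient vanish; the Poincaré
  -- inequality then makes the difference vanish.
  · have hd : jet w - p ∈ Γ.meanZeroGraph := sub_mem (jet_mem_meanZeroGraph hw.1) hp
    have h1 := (isWeakSolution_iff hF hw.1).1 hw _ hd
    rw [← h _ hd, ← sub_eq_zero, ← Finset.sum_sub_distrib] at h1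
    have h2 : ∑ j : Fin 3, ‖(jet w - p) j.succ‖ ^ 2 = 0 := by
      rw [← h1]
      refine Finset.sum_congr rfl fun j _ => ?_
      rw [← inner_sub_left, ← real_inner_self_eq_norm_sq]
      rfl
    have h3 := hC' _ hd
    rw [h2, mul_zero] at h3
    exact sub_eq_zero.1 (norm_eq_zero.1 (pow_eq_zero_iff two_ne_zero |>.1
      (le_antisymm h3 (sq_nonneg _))))

variable (Γ) in
theorem exists_W12norm_le : ∃ C > 0, ∀ F v : Γ.L2, Γ.IsWeakSolution F v →
    Γ.W12norm v ≤ C * ‖F‖ := by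
  obtain ⟨C, hC0, hC⟩ := Γ.exists_norm_sq_le
  -- Energy and Poincaré give `‖v‖ ≤ C ‖F‖`, so the squared norm is at most `(C² + C) ‖F‖² ≤ (C +
  -- 1)² ‖F‖²`. The added `1` also ensures positivity.
  refine ⟨C + 1, by positivity, fun F v hv => ?_⟩
  have h1 : ‖v‖ ^ 2 ≤ C * ∑ j, ‖Γ.weakSurfDeriv j v‖ ^ 2 :=
    hC (jet v) (jet_mem_gradGraph hv.1.2) hv.1.1
  have h2 : inner ℝ F v ≤ ‖F‖ * ‖v‖ := real_inner_le_norm _ _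
  rw [hv.sum_norm_sq_eq] at h1
  have h3 : ‖v‖ ≤ C * ‖F‖ := by
    rcases (norm_nonneg v).eq_or_lt' with h | h
    · rw [h]
      positivity
    · refine le_of_mul_le_mul_right ?_ h
      nlinarith [mul_le_mul_of_nonneg_left h2 hC0]
  rw [W12norm_eq, hv.sum_norm_sq_eq]
  refine Real.sqrt_le_iff.2 ⟨by positivity, ?_⟩
  have h4 : ‖F‖ * ‖v‖ ≤ ‖F‖ * (C * ‖F‖) := mul_le_mul_of_nonneg_left h3 (norm_nonneg F)
  have h5 : ‖v‖ ^ 2 ≤ (C * ‖F‖) ^ 2 := pow_le_pow_left₀ (norm_nonneg v) h3 2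
  nlinarith [mul_nonneg hC0 (sq_nonneg ‖F‖), sq_nonneg ‖F‖]

end SurfaceWithBoundary

end

theorem proposition2p8 (Γ : SurfaceWithBoundary) :
    (∀ F ∈ Γ.L20, ∃! v : Γ.L2, Γ.IsWeakSolution F v) ∧
      ∃ C > 0, ∀ F ∈ Γ.L20, ∀ v : Γ.L2, Γ.IsWeakSolution F v → Γ.W12norm v ≤ C * ‖F‖ := by
  obtain ⟨C, hC, h⟩ := Γ.exists_W12norm_le
  exact ⟨fun F hF => SurfaceWithBoundary.existsUnique_isWeakSolution hF,
    C, hC, fun F _ v hv => h F v hv⟩
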